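/- Let $(X(p))_p$, $p$ prime, be independent random variables on a probability space $(\Omega,\mathbf P)$, each uniformly distributed on the unit circle $\{|z|=1\}$. For $\sigma>1/2$ let $$\zeta(\sigma,X)=\prod_p\Big(1-\frac{X(p)}{p^{\sigma}}\Big)^{-1},\qquad \log\zeta(\sigma,X)=-\sum_p\log\Big(1-\frac{X(p)}{p^{\sigma}}\Big),\qquad \psi(\sigma)=\sum_{p}\sum_{k\ge1}\frac{1}{k^{2}p^{2k\sigma}},$$ where $p$ runs over the primes in increasing order and the logarithms of $1-X(p)p^{-\sigma}$ are principal. The series $\psi(\sigma)$ converges, the product and the sum defining $\zeta(\sigma,X)$ and $\log\zeta(\sigma,X)$ converge almost surely, and $\exp(\log\zeta(\sigma,X))=\zeta(\sigma,X)$ almost surely. For $\theta>0$ and $T\ge10$ put $$\sigma_T=\frac12+\frac1{(\log T)^{\theta}},\qquad \psi_T=\psi(\sigma_T),\qquad \kappa(\sigma_T,X)=\frac{\log\zeta(\sigma_T,X)}{\sqrt{\pi\psi_T}}.$$ Then, for every fixed $\theta>0$, $\psi_T=\theta\log\log T+O_\theta(1)$ for $T\ge10$. Moreover there are real polynomials $g_k(x,y)$,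 $0\le k\le5$, with $g_0=1$ and $\deg g_k\le k$, which do not depend on any of the parameters, such that for all fixed $\theta>0$ and all real $a<b$, $c<d$, and for all $T\ge10$, $$\mathbf P\big[\kappa(\sigma_T,X)\in[a,b]\times[c,d]\big]=\sum_{0\le k\le5}\frac1{\sqrt{\psi_T}^{\,k}}\int_c^d\!\!\int_a^b g_k(x,y)\,e^{-\pi(x^2+y^2)}\,dx\,dy+O\Big(\frac1{(\log\log T)^3}\Big),$$ where $[a,b]\times[c,d]$ denotes $\{z\in\mathbb C:\operatorname{Re}z\in[a,b],\ \operatorname{Im}z\in[c,d]\}$ and the implied constant depends at most on $\theta,a,b,c,d$. -/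

import Mathlib

open MeasureTheory ProbabilityTheory Filter Topology

noncomputable section

/-- The uniform (normalised arc length) probability measure on the unit circle `|z| = 1`,
as a measure on `ℂ`: the law of `exp (2 π i t)` for `t` uniform on `(0, 1]`. -/
def uniformUnitCircle : Measure ℂ :=
  ((volume : Measure ℝ).restrict (Set.Ioc 0 1)).map
    (fun t : ℝ => Complex.exp (2 * Real.pi * Complex.I * t))

/-- The random variables `X p` (`p` prime) are independent and each of them is uniformly
distributed on the unit circle. -/
structure IsUniformOnCircleFamily {Ω : Type*} [MeasurableSpace Ω] (P : Measure Ω)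
    (X : Nat.Primes → Ω → ℂ) : Prop where
  measurable : ∀ p, Measurable (X p)
  indep : iIndepFun X P
  law : ∀ p, P.map (X p) = uniformUnitCircle

/-- The finite set of all primes `p < N`. -/
def primesLT (N : ℕ) : Finset Nat.Primes := (Finset.range N).subtype Nat.Prime

/-- The finite Euler product `∏_{p < N} (1 - X(p) p^{-σ})⁻¹`. -/
def partialRandomZeta {Ω : Type*} (σ : ℝ) (X : Nat.Primes → Ω → ℂ) (N : ℕ) (ω : Ω) : ℂ :=
  ∏ p ∈ primesLT N, (1 - X p ω / (((p : ℕ) : ℝ) ^ σ : ℝ))⁻¹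

/-- The logarithm `-∑_{p < N} log (1 - X(p) p^{-σ})` of the finite Euler product, with the
principal branch of `log (1 - z)`, `|z| < 1`, in each term. -/
def partialLogRandomZeta {Ω : Type*} (σ : ℝ) (X : Nat.Primes → Ω → ℂ) (N : ℕ) (ω : Ω) : ℂ :=
  ∑ p ∈ primesLT N, -Complex.log (1 - X p ω / (((p : ℕ) : ℝ) ^ σ : ℝ))

/-- The randomised zeta function `ζ(σ, X) = ∏_p (1 - X(p) p^{-σ})⁻¹`, the product being taken
over the primes in increasing order. -/
def randomZeta {Ω : Type*} (σ : ℝ) (X : Nat.Primes → Ω → ℂ) (ω : Ω) : ℂ :=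
  limUnder atTop (fun N => partialRandomZeta σ X N ω)

/-- `log ζ(σ, X) = -∑_p log (1 - X(p) p^{-σ})`, the sum being taken over the primes in
increasing order. -/
def logRandomZeta {Ω : Type*} (σ : ℝ) (X : Nat.Primes → Ω → ℂ) (ω : Ω) : ℂ :=
  limUnder atTop (fun N => partialLogRandomZeta σ X N ω)

/-- The summand `k^{-2} p^{-2kσ}` of `ψ(σ)`. -/
def psiTerm (σ : ℝ) (q : Nat.Primes × ℕ+) : ℝ :=
  1 / ((q.2 : ℕ) : ℝ) ^ 2 * ((q.1 : ℕ) : ℝ) ^ (-2 * ((q.2 : ℕ) : ℝ) * σ)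

/-- `ψ(σ) = ∑_{p, k} k^{-2} p^{-2kσ}`, over primes `p` and integers `k ≥ 1`. -/
def psi (σ : ℝ) : ℝ := ∑' q : Nat.Primes × ℕ+, psiTerm σ q

/-- `σ_T = 1/2 + (log T)^{-θ}`. -/
def sigmaT (θ T : ℝ) : ℝ := 1 / 2 + 1 / (Real.log T) ^ θ

/-- `κ(σ, X) = log ζ(σ, X) / √(π ψ(σ))`. -/
def kappa {Ω : Type*} (σ : ℝ) (X : Nat.Primes → Ω → ℂ) (ω : Ω) : ℂ :=
  logRandomZeta σ X ω / (Real.sqrt (Real.pi * psi σ) : ℝ)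

end

open MeasureTheory ProbabilityTheory Filter Topology

noncomputable section

/-! By independence, the characteristic function of `log ζ(σ, X)` is the product over p of those of
w = -log(1 - z p^{-σ}), z uniform on the circle. Since w is holomorphic in z and vanishes at 0, the
mean value property gives E w = E w² = 0. So the covariance matrix of (Re w, Im w) is a multiple of
the identity, and Parseval gives E|w|² = ∑ k⁻² p^{-2kσ}. With ρ² = u² + v², the logarithm of one
factor is therefore -ρ² E|w|²/4, plus cumulant forms of degrees 3, 4, 5, plus O((ρ p^{-σ})⁶)
(`norm_log_eulerCharFun_sub_le`).

Summed over p, the quadratic parts give -ρ²ψ/4. Cumulants of order at least 3 are O(p^{-3σ}) and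
Lipschitz in the weight, so their sums converge down to σ = 1/2 and may be replaced by their values
there at cost O(σ - 1/2), which is exponentially small in ψ. This is why the g_k carry no parameter.
Exponentiating the cumulant sum S = O(ρ³) to 1 + S costs O(ρ⁶) (`exists_charFun_expansion`). At the
frequency ξ of κ one has ρ² = 4π|ξ|²/ψ, so degree k becomes ψ^{-k/2} and the error becomes ψ⁻³.
Inverting the Fourier transform turns the monomials into Hermite polynomials, giving g_3, g_4, g_5,
with g_1 = g_2 = 0.

To pass to probabilities of rectangles, the law of κ is convolved with a Gaussian of width ψ⁻⁵
(`abs_measureReal_rectangle_sub_le`). The required bound on the Fourier side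
(`exists_fourier_approximation`) uses the expansion for ρ ≤ 1/12, the Gaussian decay of the product
(`exists_charFun_decay`) up to ρ = ψ⁶, and the smoothing factor beyond.

The size of ψ_T comes from ψ(σ) = log ζ(2σ) + O(1) = -log(2σ - 1) + O(1). Almost sure convergence is
martingale convergence for sums bounded in L². -/

/-! ### Integration over the unit circle -/

lemma continuous_circleParam :
    Continuous fun t : ℝ => Complex.exp (2 * Real.pi * Complex.I * t) := by fun_prop

instance isProbabilityMeasure_uniformUnitCircle : IsProbabilityMeasure uniformUnitCircle := by
  have : IsProbabilityMeasure ((volume : Measure ℝ).restrict (Set.Ioc 0 1)) :=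
    ⟨by simp⟩
  exact Measure.isProbabilityMeasure_map continuous_circleParam.measurable.aemeasurable

lemma ae_norm_eq_one_uniformUnitCircle : ∀ᵐ z ∂uniformUnitCircle, ‖z‖ = 1 := by
  rw [uniformUnitCircle, ae_map_iff continuous_circleParam.measurable.aemeasurable
    (measurableSet_eq_fun measurable_norm measurable_const)]
  refine Eventually.of_forall fun t => ?_
  rw [Complex.norm_exp]
  simp

lemma integral_uniformUnitCircle_eq_circleAverage {E : Type*} [NormedAddCommGroup E]
    [NormedSpace ℝ E] {f : ℂ → E} (hf : AEStronglyMeasurable f uniformUnitCircle) :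
    ∫ z, f z ∂uniformUnitCircle = Real.circleAverage f 0 1 := by
  rw [uniformUnitCircle, integral_map continuous_circleParam.measurable.aemeasurable hf,
    Real.circleAverage_def, ← intervalIntegral.integral_of_le zero_le_one]
  have h := intervalIntegral.smul_integral_comp_mul_left (a := 0) (b := 1)
    (fun θ : ℝ => f (circleMap 0 1 θ)) (2 * Real.pi)
  rw [mul_zero, mul_one] at h
  rw [← h, smul_smul, inv_mul_cancel₀ (by positivity), one_smul]
  refine intervalIntegral.integral_congr fun t _ => ?_
  simp only [circleMap]
  congr 1
  push_cast
  simp only [zero_add, one_mul]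
  ring_nf

/-- The mean value property. It is the source of every vanishing moment used later. -/
lemma integral_uniformUnitCircle_of_differentiable {f : ℂ → ℂ} (hf : Measurable f)
    (hd : DifferentiableOn ℂ f (Metric.closedBall 0 1)) :
    ∫ z, f z ∂uniformUnitCircle = f 0 := by
  rw [integral_uniformUnitCircle_eq_circleAverage hf.aestronglyMeasurable]
  apply DiffContOnCl.circleAverage
  rw [abs_one]
  apply DifferentiableOn.diffContOnCl
  rwa [closure_ball _ one_ne_zero]

/-- On the circle the conjugate inverts z, so the integrand is a power of z or of its conjugate, and
the mean value property applies. -/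
lemma integral_pow_mul_conj_pow (n m : ℕ) :
    ∫ z, z ^ n * (starRingEnd ℂ z) ^ m ∂uniformUnitCircle = if n = m then 1 else 0 := by
  have key : ∀ k : ℕ, ∫ z, z ^ k ∂uniformUnitCircle = if k = 0 then 1 else 0 := by
    intro k
    rw [integral_uniformUnitCircle_of_differentiable (by fun_prop) (by fun_prop)]
    by_cases hk : k = 0 <;> simp [hk]
  have hz : ∀ z : ℂ, ‖z‖ = 1 → z * starRingEnd ℂ z = 1 := by
    intro z hz
    rw [Complex.mul_conj, Complex.normSq_eq_norm_sq, hz]; simp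
  rcases le_total m n with h | h
  · obtain ⟨k, rfl⟩ := Nat.exists_eq_add_of_le h
    have : ∀ᵐ z ∂uniformUnitCircle, z ^ (m + k) * (starRingEnd ℂ z) ^ m = z ^ k := by
      filter_upwards [ae_norm_eq_one_uniformUnitCircle] with z h1
      rw [pow_add, mul_right_comm, ← mul_pow, hz z h1, one_pow, one_mul]
    rw [integral_congr_ae this, key]
    by_cases hk : k = 0 <;> simp [hk]
  · obtain ⟨k, rfl⟩ := Nat.exists_eq_add_of_le h
    have : ∀ᵐ z ∂uniformUnitCircle,
        z ^ n * (starRingEnd ℂ z) ^ (n + k) = starRingEnd ℂ (z ^ k) := by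
      filter_upwards [ae_norm_eq_one_uniformUnitCircle] with z h1
      rw [pow_add, ← mul_assoc, ← mul_pow, hz z h1, one_pow, one_mul, map_pow]
    rw [integral_congr_ae this, integral_conj, key]
    by_cases hk : k = 0 <;> simp [hk]

/-! ### The logarithm of one Euler factor -/

/-- The Euler factor logarithm `-log (1 - z x)`. -/
def eulerLog (x : ℝ) (z : ℂ) : ℂ := -Complex.log (1 - z * x)

@[fun_prop]
lemma measurable_eulerLog (x : ℝ) : Measurable (eulerLog x) := by
  unfold eulerLog
  fun_prop

lemma norm_mul_ofReal_le {x : ℝ} (h0 : 0 ≤ x) {z : ℂ} (hz : ‖z‖ ≤ 1) : ‖z * (x : ℂ)‖ ≤ x := by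
  rw [norm_mul, Complex.norm_real, Real.norm_of_nonneg h0]
  nlinarith [norm_nonneg z]

lemma lt_of_sq_le_half {x : ℝ} (h : x ^ 2 ≤ 1 / 2) : x < 5 / 7 := by
  nlinarith

lemma one_sub_mem_slitPlane {x : ℝ} (h0 : 0 ≤ x) (h : x < 1) {z : ℂ} (hz : ‖z‖ ≤ 1) :
    1 - z * (x : ℂ) ∈ Complex.slitPlane := by
  rw [sub_eq_add_neg]
  apply Complex.mem_slitPlane_of_norm_lt_one
  rw [norm_neg]
  exact (norm_mul_ofReal_le h0 hz).trans_lt h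

lemma differentiableOn_eulerLog {x : ℝ} (h0 : 0 ≤ x) (h : x < 1) :
    DifferentiableOn ℂ (eulerLog x) (Metric.closedBall 0 1) := by
  unfold eulerLog
  refine DifferentiableOn.neg (DifferentiableOn.clog (by fun_prop) fun z hz => ?_)
  exact one_sub_mem_slitPlane h0 h (by simpa using hz)

lemma eulerLog_zero (x : ℝ) : eulerLog x 0 = 0 := by simp [eulerLog]

lemma integral_eulerLog {x : ℝ} (h0 : 0 ≤ x) (h : x < 1) :
    ∫ z, eulerLog x z ∂uniformUnitCircle = 0 := by
  rw [integral_uniformUnitCircle_of_differentiable (by fun_prop) (differentiableOn_eulerLog h0 h),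
    eulerLog_zero]

lemma integral_eulerLog_sq {x : ℝ} (h0 : 0 ≤ x) (h : x < 1) :
    ∫ z, eulerLog x z ^ 2 ∂uniformUnitCircle = 0 := by
  have := integral_uniformUnitCircle_of_differentiable (f := fun z => eulerLog x z ^ 2)
    (by fun_prop) ((differentiableOn_eulerLog h0 h).pow 2)
  simpa [eulerLog_zero] using this

lemma norm_eulerLog_le {x : ℝ} (h0 : 0 ≤ x) (h : x ^ 2 ≤ 1 / 2) {z : ℂ} (hz : ‖z‖ ≤ 1) :
    ‖eulerLog x z‖ ≤ 4 * x := by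
  have hx := lt_of_sq_le_half h
  have hw := norm_mul_ofReal_le h0 hz
  have h1 := Complex.norm_log_one_add_le (z := -(z * (x : ℂ))) (by rw [norm_neg]; linarith)
  rw [← sub_eq_add_neg, norm_neg] at h1
  unfold eulerLog
  rw [norm_neg]
  refine h1.trans ?_
  set r := ‖z * (x : ℂ)‖
  have hr : 0 ≤ r := norm_nonneg _
  have h2 : (1 - r)⁻¹ ≤ 7 / 2 := by
    rw [inv_le_comm₀ (by linarith) (by norm_num)]
    linarith
  have h3 : r ^ 2 * (1 - r)⁻¹ ≤ r ^ 2 * (7 / 2) := by gcongr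
  nlinarith

/-- Mean value inequality on the disc of radius 5/7, where the derivative 1/(1 - w) has modulus at
most 7/2. -/
lemma norm_eulerLog_sub_le {x x' : ℝ} (h0 : 0 ≤ x) (h : x ^ 2 ≤ 1 / 2) (h0' : 0 ≤ x')
    (h' : x' ^ 2 ≤ 1 / 2) {z : ℂ} (hz : ‖z‖ ≤ 1) :
    ‖eulerLog x z - eulerLog x' z‖ ≤ 4 * |x - x'| := by
  have hx := lt_of_sq_le_half h
  have hx' := lt_of_sq_le_half h'
  have key := (convex_closedBall (0 : ℂ) (5 / 7)).norm_image_sub_le_of_norm_hasDerivWithin_le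
    (f := fun w => -Complex.log (1 - w)) (f' := fun w => (1 - w)⁻¹) (C := 4) (x := z * x')
    (y := z * x) ?_ ?_ ?_ ?_
  · refine key.trans ?_
    rw [← mul_sub, norm_mul, ← Complex.ofReal_sub, Complex.norm_real, Real.norm_eq_abs]
    nlinarith [abs_nonneg (x - x'), norm_nonneg z]
  · intro w hw
    have hw' : ‖w‖ ≤ 5 / 7 := by simpa using hw
    have : 1 - w ∈ Complex.slitPlane := by
      rw [sub_eq_add_neg]
      apply Complex.mem_slitPlane_of_norm_lt_one
      rw [norm_neg]; linarith
    have := (((hasDerivAt_id w).const_sub 1).clog this).neg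
    simp only [neg_div, neg_neg, one_div] at this
    exact this.hasDerivWithinAt
  · intro w hw
    have hw' : ‖w‖ ≤ 5 / 7 := by simpa using hw
    have h1 : 2 / 7 ≤ ‖1 - w‖ := by
      have := norm_sub_norm_le (1 : ℂ) w
      rw [norm_one] at this
      linarith
    rw [norm_inv]
    rw [inv_le_comm₀ (by linarith) (by norm_num)]
    linarith
  · simpa using (norm_mul_ofReal_le h0' hz).trans hx'.le
  · simpa using (norm_mul_ofReal_le h0 hz).trans hx.le

lemma integrable_of_bounded_on_circle {E : Type*} [NormedAddCommGroup E] {f : ℂ → E}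
    (hf : AEStronglyMeasurable f uniformUnitCircle) {C : ℝ} (hC : ∀ z, ‖z‖ = 1 → ‖f z‖ ≤ C) :
    Integrable f uniformUnitCircle :=
  Integrable.of_bound hf C (by
    filter_upwards [ae_norm_eq_one_uniformUnitCircle] with z hz using hC z hz)

/-- The Taylor series of the logarithm is integrated term by term, dominated by a geometric series.
The term n = 0 is zero by the convention on division by 0. -/
lemma hasSum_integral_eulerLog_mul {x : ℝ} (h0 : 0 ≤ x) (h : x ^ 2 ≤ 1 / 2) {f : ℂ → ℂ}
    (hf : Measurable f) {C : ℝ} (hC : ∀ z, ‖z‖ = 1 → ‖f z‖ ≤ C) :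
    HasSum (fun n : ℕ => (x : ℂ) ^ n / n * ∫ z, z ^ n * f z ∂uniformUnitCircle)
      (∫ z, eulerLog x z * f z ∂uniformUnitCircle) := by
  have hx := lt_of_sq_le_half h
  have hC0 : 0 ≤ C := (norm_nonneg _).trans (hC 1 (by simp))
  have hb : ∀ (n : ℕ) (z : ℂ), ‖z‖ = 1 → ‖(z * x) ^ n / n * f z‖ ≤ x ^ n * C := by
    intro n z hz
    rw [norm_mul, norm_div, norm_pow, norm_mul, hz, one_mul, Complex.norm_real,
      Real.norm_of_nonneg h0, Complex.norm_natCast]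
    gcongr
    · rcases Nat.eq_zero_or_pos n with rfl | hn
      · simp
      · exact div_le_self (by positivity) (by exact_mod_cast hn)
    · exact hC z hz
  have hs : HasSum (fun n : ℕ => ∫ z, (z * x) ^ n / n * f z ∂uniformUnitCircle)
      (∫ z, eulerLog x z * f z ∂uniformUnitCircle) := by
    refine hasSum_integral_of_dominated_convergence (fun n _ => x ^ n * C) ?_ ?_ ?_ ?_ ?_
    · intro n
      have : Measurable fun z : ℂ => (z * x) ^ n / n * f z := by fun_prop
      exact this.aestronglyMeasurable
    · intro n
      filter_upwards [ae_norm_eq_one_uniformUnitCircle] with z hz using hb n z hz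
    · exact Eventually.of_forall fun z => (summable_geometric_of_lt_one h0 (by linarith)).mul_right C
    · exact integrable_const _
    · filter_upwards [ae_norm_eq_one_uniformUnitCircle] with z hz
      refine HasSum.mul_right _ ?_
      exact Complex.hasSum_taylorSeries_neg_log
        ((norm_mul_ofReal_le h0 hz.le).trans_lt (by linarith))
  convert hs using 2 with n
  rw [← integral_const_mul]
  congr 1
  ext z
  ring

/-- The second moment of `eulerLog x` over the circle. -/
def eulerVar (x : ℝ) : ℝ := ∫ z, ‖eulerLog x z‖ ^ 2 ∂uniformUnitCircle

/-- Parseval: term-by-term integration is used twice, against the conjugate of the logarithm itself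
and, to identify its coefficients, against conjugate powers. -/
lemma hasSum_eulerVar {x : ℝ} (h0 : 0 ≤ x) (h : x ^ 2 ≤ 1 / 2) :
    HasSum (fun n : ℕ => (x ^ n / n) ^ 2) (eulerVar x) := by
  have h1 := hasSum_integral_eulerLog_mul h0 h (f := fun z => starRingEnd ℂ (eulerLog x z))
    (Complex.continuous_conj.measurable.comp (measurable_eulerLog x)) (C := 4 * x)
    (fun z hz => by rw [RCLike.norm_conj]; exact norm_eulerLog_le h0 h hz.le)
  have h2 : ∀ n : ℕ, ∫ z, z ^ n * starRingEnd ℂ (eulerLog x z) ∂uniformUnitCircle = x ^ n / n := by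
    intro n
    have h3 := hasSum_integral_eulerLog_mul h0 h (f := fun z => starRingEnd ℂ z ^ n)
      (Complex.continuous_conj.measurable.pow_const n) (C := 1)
      (fun z hz => by rw [norm_pow, RCLike.norm_conj, hz, one_pow])
    have h4 : ∫ z, eulerLog x z * starRingEnd ℂ z ^ n ∂uniformUnitCircle = (x : ℂ) ^ n / n := by
      rw [← h3.tsum_eq, tsum_eq_single n]
      · rw [integral_pow_mul_conj_pow, if_pos rfl, mul_one]
      · intro m hm
        rw [integral_pow_mul_conj_pow, if_neg hm, mul_zero]
    have h5 : ∀ z : ℂ, z ^ n * starRingEnd ℂ (eulerLog x z)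
        = starRingEnd ℂ (eulerLog x z * starRingEnd ℂ z ^ n) := by
      intro z
      rw [map_mul, map_pow, Complex.conj_conj, mul_comm]
    simp_rw [h5]
    rw [integral_conj, h4]
    simp
  simp_rw [h2] at h1
  have h6 : (∫ z, eulerLog x z * starRingEnd ℂ (eulerLog x z) ∂uniformUnitCircle)
      = ((eulerVar x : ℝ) : ℂ) := by
    rw [eulerVar, ← integral_complex_ofReal]
    congr 1
    ext z
    rw [Complex.mul_conj, Complex.normSq_eq_norm_sq]
  rw [h6] at h1
  refine Complex.hasSum_ofReal.mp ?_
  convert h1 using 2 with n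
  push_cast
  ring

lemma sq_le_eulerVar {x : ℝ} (h0 : 0 ≤ x) (h : x ^ 2 ≤ 1 / 2) : x ^ 2 ≤ eulerVar x := by
  have := le_hasSum (hasSum_eulerVar h0 h) 1 fun n _ => by positivity
  simpa using this

lemma eulerVar_nonneg (x : ℝ) : 0 ≤ eulerVar x := integral_nonneg fun _ => by positivity

lemma eulerVar_le {x : ℝ} (h0 : 0 ≤ x) (h : x ^ 2 ≤ 1 / 2) : eulerVar x ≤ 16 * x ^ 2 := by
  have : eulerVar x ≤ ∫ _, 16 * x ^ 2 ∂uniformUnitCircle := by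
    refine integral_mono_ae ?_ (integrable_const _) ?_
    · refine integrable_of_bounded_on_circle (C := (4 * x) ^ 2)
        ((measurable_eulerLog x).norm.pow_const 2).aestronglyMeasurable fun z hz => ?_
      rw [Real.norm_of_nonneg (by positivity)]
      gcongr
      exact norm_eulerLog_le h0 h hz.le
    · filter_upwards [ae_norm_eq_one_uniformUnitCircle] with z hz
      calc ‖eulerLog x z‖ ^ 2 ≤ (4 * x) ^ 2 := by gcongr; exact norm_eulerLog_le h0 h hz.le
        _ = _ := by ring
  simpa using this

lemma integrable_eulerLog {x : ℝ} (h0 : 0 ≤ x) (h : x ^ 2 ≤ 1 / 2) :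
    Integrable (eulerLog x) uniformUnitCircle :=
  integrable_of_bounded_on_circle (measurable_eulerLog x).aestronglyMeasurable
    fun _ hz => norm_eulerLog_le h0 h hz.le

/-! ### Moments and characteristic function of one Euler factor -/

/-- The real linear form `u Re w + v Im w` at `w = eulerLog x z`. -/
def eulerLin (x u v : ℝ) (z : ℂ) : ℝ := u * (eulerLog x z).re + v * (eulerLog x z).im

/-- The characteristic function of `eulerLog x z`, `z` uniform on the unit circle. -/
def eulerCharFun (x u v : ℝ) : ℂ :=
  ∫ z, Complex.exp (Complex.I * (eulerLin x u v z : ℝ)) ∂uniformUnitCircle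

@[fun_prop]
lemma measurable_eulerLin (x u v : ℝ) : Measurable (eulerLin x u v) := by
  unfold eulerLin
  fun_prop

lemma abs_linear_le {u v ρ : ℝ} (hρ : 0 ≤ ρ) (h : u ^ 2 + v ^ 2 = ρ ^ 2) (w : ℂ) :
    |u * w.re + v * w.im| ≤ ρ * ‖w‖ := by
  apply abs_le_of_sq_le_sq _ (by positivity)
  rw [mul_pow, ← h, ← Complex.normSq_eq_norm_sq, Complex.normSq_apply]
  nlinarith [sq_nonneg (u * w.im - v * w.re)]

lemma abs_eulerLin_le {x u v ρ : ℝ} (h0 : 0 ≤ x) (hx : x ^ 2 ≤ 1 / 2) (hρ : 0 ≤ ρ)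
    (h : u ^ 2 + v ^ 2 = ρ ^ 2) {z : ℂ} (hz : ‖z‖ ≤ 1) : |eulerLin x u v z| ≤ 4 * ρ * x := by
  refine (abs_linear_le hρ h _).trans ?_
  have := norm_eulerLog_le h0 hx hz
  nlinarith

/-- Normalised mixed moments of `eulerLog x`. -/
def eulerMoment (i j : ℕ) (x : ℝ) : ℝ :=
  (∫ z, (eulerLog x z).re ^ i * (eulerLog x z).im ^ j ∂uniformUnitCircle)
    / (i.factorial * j.factorial)

/-- The homogeneous polynomial of degree `n` formed from the normalised moments. -/
def eulerMomentForm (n : ℕ) (x u v : ℝ) : ℝ :=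
  ∑ m ∈ Finset.HasAntidiagonal.antidiagonal n, eulerMoment m.1 m.2 x * (u ^ m.1 * v ^ m.2)

lemma integrable_eulerLog_pow {x : ℝ} (h0 : 0 ≤ x) (hx : x ^ 2 ≤ 1 / 2) (i j : ℕ) :
    Integrable (fun z => (eulerLog x z).re ^ i * (eulerLog x z).im ^ j) uniformUnitCircle := by
  have hm : Measurable fun z => (eulerLog x z).re ^ i * (eulerLog x z).im ^ j := by fun_prop
  refine integrable_of_bounded_on_circle hm.aestronglyMeasurable
    (C := (4 * x) ^ i * (4 * x) ^ j) fun z hz => ?_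
  have := norm_eulerLog_le h0 hx hz.le
  rw [norm_mul, norm_pow, norm_pow, Real.norm_eq_abs, Real.norm_eq_abs]
  gcongr
  · exact (Complex.abs_re_le_norm _).trans this
  · exact (Complex.abs_im_le_norm _).trans this

lemma eulerMomentForm_eq {x : ℝ} (h0 : 0 ≤ x) (hx : x ^ 2 ≤ 1 / 2) (n : ℕ) (u v : ℝ) :
    eulerMomentForm n x u v
      = ∫ z, eulerLin x u v z ^ n / n.factorial ∂uniformUnitCircle := by
  have : ∀ z, eulerLin x u v z ^ n / n.factorial = ∑ m ∈ Finset.HasAntidiagonal.antidiagonal n,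
      (((m.1.factorial : ℝ) * m.2.factorial)⁻¹ * (u ^ m.1 * v ^ m.2)) *
        ((eulerLog x z).re ^ m.1 * (eulerLog x z).im ^ m.2) := by
    intro z
    rw [eulerLin, (Commute.all _ _).add_pow', Finset.sum_div]
    refine Finset.sum_congr rfl fun m hm => ?_
    rw [Finset.HasAntidiagonal.mem_antidiagonal] at hm
    have hc := Nat.add_choose_mul_factorial_mul_factorial m.2 m.1
    rw [add_comm, hm, mul_right_comm] at hc
    have h1 : (n.factorial : ℝ) = n.choose m.1 * m.1.factorial * m.2.factorial := by
      exact_mod_cast hc.symm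
    have h2 : (n.choose m.1 : ℝ) ≠ 0 := by
      have := Nat.choose_pos (n := n) (k := m.1) (by omega)
      positivity
    have h3 : (m.1.factorial : ℝ) ≠ 0 := by positivity
    have h4 : (m.2.factorial : ℝ) ≠ 0 := by positivity
    rw [h1, nsmul_eq_mul, mul_pow, mul_pow]
    field_simp
  simp_rw [this]
  rw [integral_finsetSum _ fun m _ => (integrable_eulerLog_pow h0 hx m.1 m.2).const_mul _]
  refine Finset.sum_congr rfl fun m _ => ?_
  rw [integral_const_mul, eulerMoment]
  ring

lemma abs_eulerMomentForm_le {x u v ρ : ℝ} (h0 : 0 ≤ x) (hx : x ^ 2 ≤ 1 / 2) (hρ : 0 ≤ ρ)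
    (h : u ^ 2 + v ^ 2 = ρ ^ 2) (n : ℕ) : |eulerMomentForm n x u v| ≤ (4 * ρ * x) ^ n := by
  rw [eulerMomentForm_eq h0 hx, ← Real.norm_eq_abs]
  refine (norm_integral_le_of_norm_le_const (C := (4 * ρ * x) ^ n) ?_).trans (by simp)
  filter_upwards [ae_norm_eq_one_uniformUnitCircle] with z hz
  rw [norm_div, norm_pow, Real.norm_eq_abs, Real.norm_of_nonneg (by positivity)]
  have h1 : (1 : ℝ) ≤ n.factorial := by exact_mod_cast Nat.factorial_pos n
  refine (div_le_self (by positivity) h1).trans ?_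
  gcongr
  exact abs_eulerLin_le h0 hx hρ h hz.le

lemma norm_eulerCharFun_sub_le {x u v ρ : ℝ} (h0 : 0 ≤ x) (hx : x ^ 2 ≤ 1 / 2) (hρ : 0 ≤ ρ)
    (h : u ^ 2 + v ^ 2 = ρ ^ 2) (hs : 4 * ρ * x ≤ 1) {n : ℕ} (hn : 2 ≤ n) :
    ‖eulerCharFun x u v - ∑ k ∈ Finset.range n, Complex.I ^ k * (eulerMomentForm k x u v : ℝ)‖
      ≤ (4 * ρ * x) ^ n := by
  have hint : ∀ k : ℕ, Integrable
      (fun z => (Complex.I * (eulerLin x u v z : ℝ)) ^ k / (k.factorial : ℂ)) uniformUnitCircle := by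
    intro k
    have hm : Measurable fun z => (Complex.I * (eulerLin x u v z : ℝ)) ^ k / (k.factorial : ℂ) := by
      fun_prop
    refine integrable_of_bounded_on_circle hm.aestronglyMeasurable
      (C := (4 * ρ * x) ^ k / k.factorial) fun z hz => ?_
    rw [norm_div, norm_pow, norm_mul, Complex.norm_I, one_mul, Complex.norm_real, Real.norm_eq_abs,
      Complex.norm_natCast]
    gcongr
    exact abs_eulerLin_le h0 hx hρ h hz.le
  have h1 : ∀ k : ℕ, Complex.I ^ k * (eulerMomentForm k x u v : ℝ)
      = ∫ z, (Complex.I * (eulerLin x u v z : ℝ)) ^ k / (k.factorial : ℂ) ∂uniformUnitCircle := by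
    intro k
    rw [eulerMomentForm_eq h0 hx, ← integral_complex_ofReal, ← integral_const_mul]
    congr 1
    ext z
    push_cast
    ring
  have hexp : Integrable (fun z => Complex.exp (Complex.I * (eulerLin x u v z : ℝ)))
      uniformUnitCircle := by
    have hm : Measurable fun z => Complex.exp (Complex.I * (eulerLin x u v z : ℝ)) := by fun_prop
    refine integrable_of_bounded_on_circle hm.aestronglyMeasurable (C := 1) fun z hz => ?_
    rw [mul_comm, Complex.norm_exp_ofReal_mul_I]
  simp_rw [h1]
  rw [eulerCharFun, ← integral_finsetSum _ fun k _ => hint k,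
    ← integral_sub hexp (integrable_finsetSum _ fun k _ => hint k)]
  refine (norm_integral_le_of_norm_le_const (C := (4 * ρ * x) ^ n) ?_).trans (by simp)
  filter_upwards [ae_norm_eq_one_uniformUnitCircle] with z hz
  have hl := abs_eulerLin_le h0 hx hρ h hz.le
  have hnorm : ‖Complex.I * (eulerLin x u v z : ℝ)‖ = |eulerLin x u v z| := by
    rw [norm_mul, Complex.norm_I, one_mul, Complex.norm_real, Real.norm_eq_abs]
  refine (Complex.exp_bound (by rw [hnorm]; linarith) (by omega)).trans ?_
  rw [hnorm]
  -- The constant of `Complex.exp_bound` is at most 1 only from n = 2 on, whence the hypothesis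
  -- `hn`.
  have h2 : ((n.succ : ℝ) * ((n.factorial : ℝ) * n)⁻¹) ≤ 1 := by
    rw [← div_eq_mul_inv, div_le_one (by positivity)]
    have : n.succ ≤ n.factorial * n := by
      have := Nat.self_le_factorial n
      nlinarith
    exact_mod_cast this
  calc |eulerLin x u v z| ^ n * ((n.succ : ℝ) * ((n.factorial : ℝ) * n)⁻¹)
      ≤ |eulerLin x u v z| ^ n * 1 := by gcongr
    _ ≤ (4 * ρ * x) ^ n := by rw [mul_one]; gcongr

lemma eulerMomentForm_zero {x : ℝ} (h0 : 0 ≤ x) (hx : x ^ 2 ≤ 1 / 2) (u v : ℝ) :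
    eulerMomentForm 0 x u v = 1 := by
  simp [eulerMomentForm_eq h0 hx]

lemma eulerMomentForm_one {x : ℝ} (h0 : 0 ≤ x) (hx : x ^ 2 ≤ 1 / 2) (u v : ℝ) :
    eulerMomentForm 1 x u v = 0 := by
  have hi := integrable_eulerLog h0 hx
  have h1 := integral_eulerLog h0 ((lt_of_sq_le_half hx).trans (by norm_num))
  have hr : ∫ z, (eulerLog x z).re ∂uniformUnitCircle = 0 := by
    have := integral_re hi
    rw [h1] at this
    simpa using this
  have him : ∫ z, (eulerLog x z).im ∂uniformUnitCircle = 0 := by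
    have := integral_im hi
    rw [h1] at this
    simpa using this
  rw [eulerMomentForm_eq h0 hx]
  simp only [pow_one, Nat.factorial_one, Nat.cast_one, div_one, eulerLin]
  have hri : Integrable (fun z => (eulerLog x z).re) uniformUnitCircle := hi.re
  have hii : Integrable (fun z => (eulerLog x z).im) uniformUnitCircle := hi.im
  rw [integral_add (hri.const_mul u) (hii.const_mul v), integral_const_mul, integral_const_mul]
  simp [hr, him]

/-- The linear form is Re((u - iv)w), and (Re ζ)² = (|ζ|² + Re ζ²)/2. The last term has mean zero
because E w² = 0, so only ρ² E|w|² survives: the covariance is isotropic. -/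
lemma eulerMomentForm_two {x : ℝ} (h0 : 0 ≤ x) (hx : x ^ 2 ≤ 1 / 2) (u v : ℝ) :
    eulerMomentForm 2 x u v = (u ^ 2 + v ^ 2) * eulerVar x / 4 := by
  have h1 := integral_eulerLog_sq h0 ((lt_of_sq_le_half hx).trans (by norm_num))
  have hi2 : Integrable (fun z => (((u : ℂ) - v * Complex.I) * eulerLog x z) ^ 2)
      uniformUnitCircle := by
    have hm : Measurable (fun z => (((u : ℂ) - v * Complex.I) * eulerLog x z) ^ 2) := by fun_prop
    refine integrable_of_bounded_on_circle hm.aestronglyMeasurable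
      (C := (‖(u : ℂ) - v * Complex.I‖ * (4 * x)) ^ 2) fun z hz => ?_
    rw [norm_pow, norm_mul]
    gcongr
    exact norm_eulerLog_le h0 hx hz.le
  have hin : Integrable (fun z => ‖eulerLog x z‖ ^ 2) uniformUnitCircle := by
    have hm : Measurable (fun z => ‖eulerLog x z‖ ^ 2) := by fun_prop
    refine integrable_of_bounded_on_circle hm.aestronglyMeasurable
      (C := (4 * x) ^ 2) fun z hz => ?_
    rw [Real.norm_of_nonneg (by positivity)]
    gcongr
    exact norm_eulerLog_le h0 hx hz.le
  have hre : ∫ z, ((((u : ℂ) - v * Complex.I) * eulerLog x z) ^ 2).re ∂uniformUnitCircle = 0 := by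
    have h2 := integral_re hi2
    have h3 : ∫ z, (((u : ℂ) - v * Complex.I) * eulerLog x z) ^ 2 ∂uniformUnitCircle = 0 := by
      simp_rw [mul_pow]
      rw [integral_const_mul, h1, mul_zero]
    rw [h3] at h2
    simpa using h2
  rw [eulerMomentForm_eq h0 hx]
  have : ∀ z, eulerLin x u v z ^ 2 / (2 : ℕ).factorial = (u ^ 2 + v ^ 2) / 4 * ‖eulerLog x z‖ ^ 2
      + 1 / 4 * ((((u : ℂ) - v * Complex.I) * eulerLog x z) ^ 2).re := by
    intro z
    rw [← Complex.normSq_eq_norm_sq, Complex.normSq_apply, eulerLin, sq (_ * _)]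
    simp
    ring
  simp_rw [this]
  have hri : Integrable (fun z => ((((u : ℂ) - v * Complex.I) * eulerLog x z) ^ 2).re)
      uniformUnitCircle := hi2.re
  rw [integral_add (hin.const_mul _) (hri.const_mul _), integral_const_mul, integral_const_mul,
    hre, eulerVar]
  ring

/-! ### Cumulants of one Euler factor -/

/-- The coefficient of `(i u) ^ i * (i v) ^ j`, `3 ≤ i + j ≤ 5`, in the Taylor expansion of the
logarithm of `eulerCharFun x` (a normalised joint cumulant). -/
def eulerCumulant (i j : ℕ) (x : ℝ) : ℝ :=
  eulerMoment i j x - 1 / 2 * ∑ p ∈ Finset.HasAntidiagonal.antidiagonal i,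
    ∑ q ∈ Finset.HasAntidiagonal.antidiagonal j,
      if 2 ≤ p.1 + q.1 ∧ 2 ≤ p.2 + q.2 then eulerMoment p.1 q.1 x * eulerMoment p.2 q.2 x else 0

/-- The homogeneous polynomial of degree `n` formed from the cumulants. -/
def eulerCumulantForm (n : ℕ) (x u v : ℝ) : ℝ :=
  ∑ m ∈ Finset.HasAntidiagonal.antidiagonal n, eulerCumulant m.1 m.2 x * (u ^ m.1 * v ^ m.2)

lemma eulerCumulantForm_three (x u v : ℝ) :
    eulerCumulantForm 3 x u v = eulerMomentForm 3 x u v := by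
  simp [eulerCumulantForm, eulerMomentForm, eulerCumulant, Finset.Nat.antidiagonal_succ]

lemma eulerCumulantForm_four (x u v : ℝ) :
    eulerCumulantForm 4 x u v = eulerMomentForm 4 x u v - eulerMomentForm 2 x u v ^ 2 / 2 := by
  simp [eulerCumulantForm, eulerMomentForm, eulerCumulant, Finset.Nat.antidiagonal_succ]
  ring

lemma eulerCumulantForm_five (x u v : ℝ) :
    eulerCumulantForm 5 x u v = eulerMomentForm 5 x u v
      - eulerMomentForm 2 x u v * eulerMomentForm 3 x u v := by
  simp [eulerCumulantForm, eulerMomentForm, eulerCumulant, Finset.Nat.antidiagonal_succ]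
  ring

/-- The part of degrees `3`, `4`, `5` of the logarithm of `eulerCharFun x`. -/
def eulerCumulantSum (x u v : ℝ) : ℂ :=
  ∑ k ∈ Finset.Icc 3 5, Complex.I ^ k * (eulerCumulantForm k x u v : ℝ)

lemma norm_log_one_add_sub_quadratic_le {w : ℂ} (hw : ‖w‖ ≤ 1 / 4) :
    ‖Complex.log (1 + w) - (w - w ^ 2 / 2)‖ ≤ ‖w‖ ^ 3 := by
  have h := Complex.norm_log_sub_logTaylor_le 2 (z := w) (by linarith)
  have h2 : Complex.logTaylor 3 w = w - w ^ 2 / 2 := by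
    simp [Complex.logTaylor, Finset.sum_range_succ]
    ring
  rw [h2] at h
  refine h.trans ?_
  have h3 : (1 - ‖w‖)⁻¹ ≤ 4 / 3 := by
    rw [inv_le_comm₀ (by linarith) (by norm_num)]
    linarith
  have h4 : 0 ≤ ‖w‖ ^ 3 := by positivity
  have h5 : ‖w‖ ^ 3 * (1 - ‖w‖)⁻¹ ≤ ‖w‖ ^ 3 * (4 / 3) := by gcongr
  norm_num at h5 ⊢
  linarith

/-- Put s = 4ρx and w = φ - 1. As the first moment vanishes, w = O(s²), so log(1 + w) = w - w²/2 up
to O(s⁶). In degrees at most 5, w² contributes only the square of the second moment form and its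
product with the third, which are exactly the corrections contained in the cumulants. -/
lemma norm_log_eulerCharFun_sub_le {x u v ρ : ℝ} (h0 : 0 ≤ x) (hx : x ^ 2 ≤ 1 / 2) (hρ : 0 ≤ ρ)
    (h : u ^ 2 + v ^ 2 = ρ ^ 2) (hs : 4 * ρ * x ≤ 1 / 4) :
    ‖eulerCharFun x u v - 1‖ ≤ 1 / 4 ∧
    ‖Complex.log (eulerCharFun x u v) - (((-(ρ ^ 2 * eulerVar x / 4) : ℝ) : ℂ)
      + eulerCumulantSum x u v)‖ ≤ 16 * (4 * ρ * x) ^ 6 := by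
  set s := 4 * ρ * x with hsdef
  have hs0 : 0 ≤ s := by positivity
  have hT := norm_eulerCharFun_sub_le h0 hx hρ h (hs.trans (by norm_num)) (n := 6) (by norm_num)
  rw [← hsdef] at hT
  have hc : ∀ n, ‖((eulerMomentForm n x u v : ℝ) : ℂ)‖ ≤ s ^ n := fun n => by
    rw [Complex.norm_real]; exact abs_eulerMomentForm_le h0 hx hρ h n
  have hc2 := hc 2
  have hc3 := hc 3
  have hc4 := hc 4
  have hc5 := hc 5
  have e2 : eulerMomentForm 2 x u v = ρ ^ 2 * eulerVar x / 4 := by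
    rw [eulerMomentForm_two h0 hx, h]
  simp only [Finset.sum_range_succ, Finset.sum_range_zero, eulerMomentForm_zero h0 hx,
    eulerMomentForm_one h0 hx] at hT
  rw [← e2]
  simp only [eulerCumulantSum, show Finset.Icc 3 5 = ({3, 4, 5} : Finset ℕ) from rfl]
  rw [Finset.sum_insert (by decide), Finset.sum_insert (by decide), Finset.sum_singleton,
    eulerCumulantForm_three, eulerCumulantForm_four, eulerCumulantForm_five]
  push_cast
  set φ := eulerCharFun x u v
  generalize hg2 : ((eulerMomentForm 2 x u v : ℝ) : ℂ) = c2 at *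
  generalize hg3 : ((eulerMomentForm 3 x u v : ℝ) : ℂ) = c3 at *
  generalize hg4 : ((eulerMomentForm 4 x u v : ℝ) : ℂ) = c4 at *
  generalize hg5 : ((eulerMomentForm 5 x u v : ℝ) : ℂ) = c5 at *
  have hI2 : Complex.I ^ 2 = -1 := Complex.I_sq
  have hI3 : Complex.I ^ 3 = -Complex.I := Complex.I_pow_three
  have hI4 : Complex.I ^ 4 = 1 := Complex.I_pow_four
  have hI5 : Complex.I ^ 5 = Complex.I := by rw [pow_succ, hI4, one_mul]
  rw [hI3, pow_zero, one_mul, pow_one]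
  set I := Complex.I
  have hnI : ‖I‖ = 1 := Complex.norm_I
  set A : ℂ := -I * c3 + c4 + I * c5 with hA
  have hw : ‖(φ - 1) - (-c2 + A)‖ ≤ s ^ 6 := by
    refine le_trans (le_of_eq ?_) hT
    congr 1
    rw [hI2, hI3, hI4, hI5]
    push_cast
    ring
  set R : ℂ := (φ - 1) - (-c2 + A) with hR
  have hwe : φ - 1 = -c2 + A + R := by rw [hR]; ring
  have p3 : s ^ 3 ≤ s ^ 2 * (1 / 4) := by nlinarith [sq_nonneg s]
  have p4 : s ^ 4 ≤ s ^ 3 * (1 / 4) := by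
    have : 0 ≤ s ^ 3 := by positivity
    nlinarith
  have p5 : s ^ 5 ≤ s ^ 4 * (1 / 4) := by
    have : 0 ≤ s ^ 4 := by positivity
    nlinarith
  have p6 : s ^ 6 ≤ s ^ 5 * (1 / 4) := by
    have : 0 ≤ s ^ 5 := by positivity
    nlinarith
  have q2 : s ^ 2 ≤ 1 / 16 := by nlinarith
  have q0 : 0 ≤ s ^ 6 := by positivity
  have hA' : ‖A‖ ≤ 2 * s ^ 3 := by
    have : ‖A‖ ≤ ‖c3‖ + ‖c4‖ + ‖c5‖ := by
      refine (norm_add₃_le).trans (le_of_eq ?_)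
      simp [hnI]
    linarith
  have hwn : ‖φ - 1‖ ≤ 2 * s ^ 2 := by
    rw [hwe]
    refine (norm_add₃_le).trans ?_
    rw [norm_neg]
    linarith
  have hw4 : ‖φ - 1‖ ≤ 1 / 4 := by linarith
  refine ⟨hw4, ?_⟩
  have hlog := norm_log_one_add_sub_quadratic_le hw4
  rw [add_sub_cancel] at hlog
  have hw3 : ‖φ - 1‖ ^ 3 ≤ 8 * s ^ 6 := by
    calc ‖φ - 1‖ ^ 3 ≤ (2 * s ^ 2) ^ 3 := by gcongr
      _ = _ := by ring
  have hI2' : I * I = -1 := Complex.I_mul_I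
  -- The pieces are bounded by 8, 1, 2, 2, 2 and 1 times s⁶, which add up to the 16 of the
  -- conclusion.
  have hdec : Complex.log φ - (-c2 + (-I * c3 + (c4 - c2 ^ 2 / 2 + I * (c5 - c2 * c3))))
      = (Complex.log φ - (φ - 1 - (φ - 1) ^ 2 / 2)) + R
        + (-(A ^ 2) / 2 + c2 * (c4 + I * c5) - (-c2 + A) * R - R ^ 2 / 2) := by
    rw [hwe, hA]
    ring
  have e1 : ‖-(A ^ 2) / 2‖ ≤ 2 * s ^ 6 := by
    rw [norm_div, norm_neg, norm_pow]
    have : ‖A‖ ^ 2 ≤ (2 * s ^ 3) ^ 2 := by gcongr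
    norm_num
    nlinarith
  have e2 : ‖c2 * (c4 + I * c5)‖ ≤ 2 * s ^ 6 := by
    rw [norm_mul]
    have : ‖c4 + I * c5‖ ≤ 2 * s ^ 4 := by
      refine (norm_add_le _ _).trans ?_
      rw [norm_mul, hnI]
      have : 0 ≤ s ^ 4 := by positivity
      linarith
    calc ‖c2‖ * ‖c4 + I * c5‖ ≤ s ^ 2 * (2 * s ^ 4) := by gcongr
      _ = _ := by ring
  have e3 : ‖(-c2 + A) * R‖ ≤ 2 * s ^ 6 := by
    rw [norm_mul]
    have : ‖-c2 + A‖ ≤ 2 := by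
      refine (norm_add_le _ _).trans ?_
      rw [norm_neg]
      linarith
    gcongr
  have e4 : ‖R ^ 2 / 2‖ ≤ s ^ 6 := by
    rw [norm_div, norm_pow]
    have hR1 : ‖R‖ ≤ 1 := by linarith
    norm_num
    nlinarith [norm_nonneg R]
  have hlog' := hlog.trans hw3
  have goal : ‖Complex.log φ - (-c2 + (-I * c3 + (c4 - c2 ^ 2 / 2 + I * (c5 - c2 * c3))))‖
      ≤ 16 * s ^ 6 := by
    rw [hdec]
    have t1 := norm_add₃_le (a := Complex.log φ - (φ - 1 - (φ - 1) ^ 2 / 2)) (b := R)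
      (c := -(A ^ 2) / 2 + c2 * (c4 + I * c5) - (-c2 + A) * R - R ^ 2 / 2)
    have t2 := norm_sub_le (-(A ^ 2) / 2 + c2 * (c4 + I * c5) - (-c2 + A) * R) (R ^ 2 / 2)
    have t3 := norm_sub_le (-(A ^ 2) / 2 + c2 * (c4 + I * c5)) ((-c2 + A) * R)
    have t4 := norm_add_le (-(A ^ 2) / 2) (c2 * (c4 + I * c5))
    linarith
  refine le_trans (le_of_eq ?_) goal
  congr 1

lemma norm_eulerCharFun_le_one (x u v : ℝ) : ‖eulerCharFun x u v‖ ≤ 1 := by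
  refine (norm_integral_le_of_norm_le_const (C := 1) ?_).trans (by simp)
  refine Eventually.of_forall fun z => ?_
  rw [mul_comm, Complex.norm_exp_ofReal_mul_I]

/-- The quadratic term lowers the modulus by at least ρ²x²/4. The threshold 1/512 makes the cubic
error 64(ρx)³ at most half of this. -/
lemma norm_eulerCharFun_le_exp {x u v ρ : ℝ} (h0 : 0 ≤ x) (hx : x ^ 2 ≤ 1 / 2) (hρ : 0 ≤ ρ)
    (h : u ^ 2 + v ^ 2 = ρ ^ 2) (hs : ρ * x ≤ 1 / 512) :
    ‖eulerCharFun x u v‖ ≤ Real.exp (-(ρ ^ 2 * x ^ 2 / 8)) := by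
  have hs0 : 0 ≤ ρ * x := by positivity
  have hT := norm_eulerCharFun_sub_le h0 hx hρ h (by linarith) (n := 3) (by norm_num)
  simp only [Finset.sum_range_succ, Finset.sum_range_zero, eulerMomentForm_zero h0 hx,
    eulerMomentForm_one h0 hx, eulerMomentForm_two h0 hx, h] at hT
  have e : (0 : ℂ) + Complex.I ^ 0 * ((1 : ℝ) : ℂ) + Complex.I ^ 1 * ((0 : ℝ) : ℂ)
      + Complex.I ^ 2 * ((ρ ^ 2 * eulerVar x / 4 : ℝ) : ℂ)
      = ((1 - ρ ^ 2 * eulerVar x / 4 : ℝ) : ℂ) := by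
    rw [Complex.I_sq]
    push_cast
    ring
  rw [e] at hT
  have hV := sq_le_eulerVar h0 hx
  have hV' := eulerVar_le h0 hx
  have h1 : ρ ^ 2 * eulerVar x ≤ ρ ^ 2 * (16 * x ^ 2) := by gcongr
  have h1' : ρ ^ 2 * x ^ 2 ≤ ρ ^ 2 * eulerVar x := by gcongr
  have h2 : ‖((1 - ρ ^ 2 * eulerVar x / 4 : ℝ) : ℂ)‖ = 1 - ρ ^ 2 * eulerVar x / 4 := by
    rw [Complex.norm_real, Real.norm_of_nonneg]
    nlinarith
  have h3 := norm_sub_norm_le (eulerCharFun x u v) ((1 - ρ ^ 2 * eulerVar x / 4 : ℝ) : ℂ)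
  rw [h2] at h3
  have h4 : (4 * ρ * x) ^ 3 ≤ ρ ^ 2 * x ^ 2 / 8 := by
    have : (4 * ρ * x) ^ 3 = 64 * (ρ * x) ^ 2 * (ρ * x) := by ring
    rw [this]
    nlinarith [sq_nonneg (ρ * x)]
  have h5 := Real.add_one_le_exp (-(ρ ^ 2 * x ^ 2 / 8))
  linarith

/-! ### Size and Lipschitz bounds for moments and cumulants -/

/-- `F x z = O(x ^ n)` with a matching Lipschitz bound in `x`, uniformly in `|z| = 1`. -/
def EulerLip (n : ℕ) (F : ℝ → ℂ → ℝ) : Prop :=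
  ∃ K, 0 ≤ K ∧ ∀ z : ℂ, ‖z‖ = 1 →
    (∀ x, 0 ≤ x → x ^ 2 ≤ 1 / 2 → |F x z| ≤ K * x ^ n) ∧
    ∀ x x', 0 ≤ x' → x' ≤ x → x ^ 2 ≤ 1 / 2 → |F x z - F x' z| * x ≤ K * x ^ n * (x - x')

namespace EulerLip

lemma const (c : ℝ) : EulerLip 0 fun _ _ => c := by
  refine ⟨|c|, abs_nonneg c, fun z _ => ⟨fun x _ _ => by simp, fun x x' h0 h _ => ?_⟩⟩
  simp only [sub_self, abs_zero, zero_mul, pow_zero, mul_one]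
  exact mul_nonneg (abs_nonneg _) (by linarith)

/-- The Leibniz rule for differences. Carrying the factor x on the left of the Lipschitz bound
avoids the exponent n - 1, so that exponents simply add. -/
lemma mul {n m : ℕ} {F G : ℝ → ℂ → ℝ} (hF : EulerLip n F) (hG : EulerLip m G) :
    EulerLip (n + m) fun x z => F x z * G x z := by
  obtain ⟨K, hK, hF⟩ := hF
  obtain ⟨J, hJ, hG⟩ := hG
  refine ⟨2 * K * J, by positivity, fun z hz => ⟨fun x h0 hx => ?_, fun x x' h0 h hx => ?_⟩⟩
  · have h1 := (hF z hz).1 x h0 hx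
    have h2 := (hG z hz).1 x h0 hx
    rw [abs_mul]
    calc |F x z| * |G x z| ≤ (K * x ^ n) * (J * x ^ m) := by gcongr
      _ ≤ 2 * ((K * x ^ n) * (J * x ^ m)) := by
          have : 0 ≤ (K * x ^ n) * (J * x ^ m) := by positivity
          linarith
      _ = _ := by ring
  · have hx0 : 0 ≤ x := h0.trans h
    have hx' : x' ^ 2 ≤ 1 / 2 := by nlinarith
    have h1 := (hF z hz).1 x' h0 hx'
    have h1' : |F x' z| ≤ K * x ^ n := h1.trans (by gcongr)
    have h2 := (hG z hz).1 x hx0 hx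
    have h3 := (hF z hz).2 x x' h0 h hx
    have h4 := (hG z hz).2 x x' h0 h hx
    have h5 : F x z * G x z - F x' z * G x' z
        = (F x z - F x' z) * G x z + F x' z * (G x z - G x' z) := by ring
    have h6 : 0 ≤ x - x' := by linarith
    calc |F x z * G x z - F x' z * G x' z| * x
        ≤ (|F x z - F x' z| * |G x z| + |F x' z| * |G x z - G x' z|) * x := by
          rw [h5, ← abs_mul, ← abs_mul]
          gcongr
          exact abs_add_le _ _
      _ = (|F x z - F x' z| * x) * |G x z| + |F x' z| * (|G x z - G x' z| * x) := by ring
      _ ≤ (K * x ^ n * (x - x')) * (J * x ^ m) + (K * x ^ n) * (J * x ^ m * (x - x')) := by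
          gcongr
      _ = _ := by ring

lemma add {n : ℕ} {F G : ℝ → ℂ → ℝ} (hF : EulerLip n F) (hG : EulerLip n G) :
    EulerLip n fun x z => F x z + G x z := by
  obtain ⟨K, hK, hF⟩ := hF
  obtain ⟨J, hJ, hG⟩ := hG
  refine ⟨K + J, by positivity, fun z hz => ⟨fun x h0 hx => ?_, fun x x' h0 h hx => ?_⟩⟩
  · have h1 := (hF z hz).1 x h0 hx
    have h2 := (hG z hz).1 x h0 hx
    have := abs_add_le (F x z) (G x z)
    linarith
  · have h3 := (hF z hz).2 x x' h0 h hx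
    have h4 := (hG z hz).2 x x' h0 h hx
    have hx0 : 0 ≤ x := h0.trans h
    have h5 : F x z + G x z - (F x' z + G x' z) = (F x z - F x' z) + (G x z - G x' z) := by ring
    rw [h5]
    calc _ ≤ (|F x z - F x' z| + |G x z - G x' z|) * x := by gcongr; exact abs_add_le _ _
      _ ≤ _ := by linarith

lemma weaken {n m : ℕ} {F : ℝ → ℂ → ℝ} (hF : EulerLip m F) (hnm : n ≤ m) : EulerLip n F := by
  obtain ⟨K, hK, hF⟩ := hF
  have hp : ∀ x : ℝ, 0 ≤ x → x ^ 2 ≤ 1 / 2 → x ^ m ≤ x ^ n := fun x h0 hx =>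
    pow_le_pow_of_le_one h0 (by nlinarith) hnm
  refine ⟨K, hK, fun z hz => ⟨fun x h0 hx => ?_, fun x x' h0 h hx => ?_⟩⟩
  · exact ((hF z hz).1 x h0 hx).trans (by gcongr K * ?_; exact hp x h0 hx)
  · refine ((hF z hz).2 x x' h0 h hx).trans ?_
    have : 0 ≤ x - x' := by linarith
    gcongr K * ?_ * _
    exact hp x (h0.trans h) hx

lemma const_mul {n : ℕ} {F : ℝ → ℂ → ℝ} (hF : EulerLip n F) (c : ℝ) :
    EulerLip n fun x z => c * F x z := by
  simpa using (EulerLip.const c).mul hF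

lemma pow {F : ℝ → ℂ → ℝ} (hF : EulerLip 1 F) (n : ℕ) : EulerLip n fun x z => F x z ^ n := by
  induction n with
  | zero => simpa using EulerLip.const 1
  | succ n ih => simpa only [pow_succ] using ih.mul hF

lemma zero (n : ℕ) : EulerLip n fun _ _ => 0 := by
  refine ⟨0, le_rfl, fun z _ => ⟨fun x _ _ => by simp, fun x x' _ _ _ => by simp⟩⟩

lemma sum {ι : Type*} {n : ℕ} (s : Finset ι) {F : ι → ℝ → ℂ → ℝ}
    (hF : ∀ i ∈ s, EulerLip n (F i)) : EulerLip n fun x z => ∑ i ∈ s, F i x z := by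
  classical
  induction s using Finset.induction_on with
  | empty => simpa using zero n
  | insert a s ha ih =>
    simp only [Finset.sum_insert ha]
    exact (hF a (by simp)).add (ih fun i hi => hF i (by simp [hi]))

lemma re_eulerLog : EulerLip 1 fun x z => (eulerLog x z).re := by
  refine ⟨4, by norm_num, fun z hz => ⟨fun x h0 hx => ?_, fun x x' h0 h hx => ?_⟩⟩
  · rw [pow_one]
    exact (Complex.abs_re_le_norm _).trans (norm_eulerLog_le h0 hx hz.le)
  · have hx' : x' ^ 2 ≤ 1 / 2 := by nlinarith
    have h1 := norm_eulerLog_sub_le (h0.trans h) hx h0 hx' hz.le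
    rw [abs_of_nonneg (by linarith : 0 ≤ x - x')] at h1
    have h2 := (Complex.abs_re_le_norm _).trans h1
    rw [Complex.sub_re] at h2
    have := h0.trans h
    calc _ ≤ (4 * (x - x')) * x := by gcongr
      _ = _ := by ring

lemma im_eulerLog : EulerLip 1 fun x z => (eulerLog x z).im := by
  refine ⟨4, by norm_num, fun z hz => ⟨fun x h0 hx => ?_, fun x x' h0 h hx => ?_⟩⟩
  · rw [pow_one]
    exact (Complex.abs_im_le_norm _).trans (norm_eulerLog_le h0 hx hz.le)
  · have hx' : x' ^ 2 ≤ 1 / 2 := by nlinarith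
    have h1 := norm_eulerLog_sub_le (h0.trans h) hx h0 hx' hz.le
    rw [abs_of_nonneg (by linarith : 0 ≤ x - x')] at h1
    have h2 := (Complex.abs_im_le_norm _).trans h1
    rw [Complex.sub_im] at h2
    have := h0.trans h
    calc _ ≤ (4 * (x - x')) * x := by gcongr
      _ = _ := by ring

lemma eulerMoment (i j : ℕ) : EulerLip (i + j) fun x _ => eulerMoment i j x := by
  obtain ⟨K, hK, hF⟩ := (re_eulerLog.pow i).mul (im_eulerLog.pow j)
  have hf : (1 : ℝ) ≤ i.factorial * j.factorial := by
    exact_mod_cast Nat.mul_pos i.factorial_pos j.factorial_pos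
  have hb : ∀ y C : ℝ, |y| ≤ C → |y / (i.factorial * j.factorial)| ≤ C := by
    intro y C h
    rw [abs_div, abs_of_pos (by linarith : (0 : ℝ) < i.factorial * j.factorial)]
    exact (div_le_self (abs_nonneg _) hf).trans h
  refine ⟨K, hK, fun _ _ => ⟨fun x h0 hx => ?_, fun x x' h0 h hx => ?_⟩⟩
  · apply hb
    rw [← Real.norm_eq_abs]
    refine (norm_integral_le_of_norm_le_const (C := K * x ^ (i + j)) ?_).trans (by simp)
    filter_upwards [ae_norm_eq_one_uniformUnitCircle] with z hz using (hF z hz).1 x h0 hx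
  · have hx0 := h0.trans h
    have hx' : x' ^ 2 ≤ 1 / 2 := by nlinarith
    simp only [_root_.eulerMoment]
    -- Writing x as |x| moves the factor inside the absolute value. The rewriting replaces every x,
    -- which is why integrability is then needed at |x|.
    rw [← sub_div, ← abs_of_nonneg hx0, ← abs_mul,
      div_mul_eq_mul_div]
    apply hb
    rw [← integral_sub (integrable_eulerLog_pow (abs_nonneg x) (by rwa [sq_abs]) i j)
      (integrable_eulerLog_pow h0 hx' i j), ← integral_mul_const, ← Real.norm_eq_abs (∫ _, _ ∂_),
      abs_of_nonneg hx0]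
    refine (norm_integral_le_of_norm_le_const (C := K * x ^ (i + j) * (x - x')) ?_).trans (by simp)
    filter_upwards [ae_norm_eq_one_uniformUnitCircle] with z hz
    rw [norm_mul, Real.norm_eq_abs, Real.norm_of_nonneg hx0]
    exact (hF z hz).2 x x' h0 h hx

lemma eulerCumulant {i j : ℕ} (hij : 3 ≤ i + j) : EulerLip 3 fun x _ => eulerCumulant i j x := by
  have h1 : EulerLip 3 fun x _ => ∑ p ∈ Finset.HasAntidiagonal.antidiagonal i,
      ∑ q ∈ Finset.HasAntidiagonal.antidiagonal j,
      if 2 ≤ p.1 + q.1 ∧ 2 ≤ p.2 + q.2 then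
        _root_.eulerMoment p.1 q.1 x * _root_.eulerMoment p.2 q.2 x else 0 := by
    refine EulerLip.sum _ fun p _ => EulerLip.sum _ fun q _ => ?_
    by_cases h : 2 ≤ p.1 + q.1 ∧ 2 ≤ p.2 + q.2
    · simp only [if_pos h]
      exact ((EulerLip.eulerMoment p.1 q.1).mul (EulerLip.eulerMoment p.2 q.2)).weaken (by omega)
    · simp only [if_neg h]
      exact EulerLip.zero 3
  have h2 := ((EulerLip.eulerMoment i j).weaken hij).add (h1.const_mul (-(1 / 2)))
  simpa only [_root_.eulerCumulant, sub_eq_add_neg, neg_mul] using h2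

end EulerLip

/-- One constant for the finitely many cumulants, obtained by adding the individual ones. The factor
x is cancelled from the Lipschitz bound, with x = 0 treated apart. -/
lemma exists_eulerCumulant_bound : ∃ K, 0 ≤ K ∧ ∀ i j : ℕ, 3 ≤ i + j → i + j ≤ 5 →
    (∀ x, 0 ≤ x → x ^ 2 ≤ 1 / 2 → |eulerCumulant i j x| ≤ K * x ^ 3) ∧
    ∀ x x', 0 ≤ x' → x' ≤ x → x ^ 2 ≤ 1 / 2 →
      |eulerCumulant i j x - eulerCumulant i j x'| ≤ K * x ^ 2 * (x - x') := by
  have h : ∀ i j : ℕ, ∃ K, 0 ≤ K ∧ (3 ≤ i + j →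
    (∀ x, 0 ≤ x → x ^ 2 ≤ 1 / 2 → |eulerCumulant i j x| ≤ K * x ^ 3) ∧
    ∀ x x', 0 ≤ x' → x' ≤ x → x ^ 2 ≤ 1 / 2 →
      |eulerCumulant i j x - eulerCumulant i j x'| ≤ K * x ^ 2 * (x - x')) := by
    intro i j
    by_cases hij : 3 ≤ i + j
    · obtain ⟨K, hK, hF⟩ := EulerLip.eulerCumulant hij
      refine ⟨K, hK, fun _ => ⟨(hF 1 (by simp)).1, fun x x' h0 h hx => ?_⟩⟩
      rcases (h0.trans h).eq_or_lt with h1 | h1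
      · have : x' = 0 := by linarith
        simp [this, ← h1]
      · have := (hF 1 (by simp)).2 x x' h0 h hx
        have h2 : K * x ^ 3 * (x - x') = K * x ^ 2 * (x - x') * x := by ring
        rw [h2] at this
        exact le_of_mul_le_mul_right this h1
    · exact ⟨0, le_rfl, fun h => absurd h hij⟩
  choose K hK hF using h
  have hle : ∀ i j : ℕ, i + j ≤ 5 → K i j ≤ ∑ a ∈ Finset.range 6, ∑ b ∈ Finset.range 6, K a b := by
    intro i j hij
    refine le_trans ?_ (Finset.single_le_sum (f := fun a => ∑ b ∈ Finset.range 6, K a b)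
      (fun a _ => Finset.sum_nonneg fun b _ => hK a b) (Finset.mem_range.2 (by omega : i < 6)))
    exact Finset.single_le_sum (f := fun b => K i b) (fun b _ => hK i b)
      (Finset.mem_range.2 (by omega : j < 6))
  refine ⟨∑ a ∈ Finset.range 6, ∑ b ∈ Finset.range 6, K a b,
    Finset.sum_nonneg fun a _ => Finset.sum_nonneg fun b _ => hK a b,
    fun i j h3 h5 => ⟨fun x h0 hx => ?_, fun x x' h0 h hx => ?_⟩⟩
  · exact ((hF i j h3).1 x h0 hx).trans (by gcongr; exact hle i j h5)
  · refine ((hF i j h3).2 x x' h0 h hx).trans ?_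
    have : 0 ≤ x - x' := by linarith
    gcongr
    exact hle i j h5

/-! ### Prime weights and the series ψ -/

/-- The weight `p ^ (-σ)`. -/
def primeWeight (σ : ℝ) (p : Nat.Primes) : ℝ := ((p : ℕ) : ℝ) ^ (-σ)

lemma two_le_prime (p : Nat.Primes) : (2 : ℝ) ≤ ((p : ℕ) : ℝ) := by exact_mod_cast p.2.two_le

lemma primeWeight_pos (σ : ℝ) (p : Nat.Primes) : 0 < primeWeight σ p :=
  Real.rpow_pos_of_pos (by linarith [two_le_prime p]) _

lemma primeWeight_pow (σ : ℝ) (p : Nat.Primes) (n : ℕ) :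
    primeWeight σ p ^ n = ((p : ℕ) : ℝ) ^ (-(n * σ)) := by
  rw [primeWeight, ← Real.rpow_mul_natCast (by positivity)]
  ring_nf

lemma primeWeight_anti {σ τ : ℝ} (h : σ ≤ τ) (p : Nat.Primes) :
    primeWeight τ p ≤ primeWeight σ p :=
  Real.rpow_le_rpow_of_exponent_le (by linarith [two_le_prime p]) (by linarith)

lemma primeWeight_sq_le {σ : ℝ} (h : 1 / 2 ≤ σ) (p : Nat.Primes) :
    primeWeight σ p ^ 2 ≤ 1 / 2 := by
  have h2 := two_le_prime p
  calc primeWeight σ p ^ 2 ≤ primeWeight (1 / 2) p ^ 2 := by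
        have := (primeWeight_pos σ p).le
        gcongr
        exact primeWeight_anti h p
    _ = ((p : ℕ) : ℝ)⁻¹ := by rw [primeWeight_pow, ← Real.rpow_neg_one]; norm_num
    _ ≤ 1 / 2 := by rw [one_div]; gcongr

lemma summable_primeWeight_pow {σ : ℝ} {n : ℕ} (h : 1 < n * σ) :
    Summable fun p => primeWeight σ p ^ n := by
  simp_rw [primeWeight_pow]
  exact Nat.Primes.summable_rpow.2 (by linarith)

lemma summable_primeWeight_pow_three {σ : ℝ} (h : 1 / 2 ≤ σ) :
    Summable fun p => primeWeight σ p ^ 3 :=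
  summable_primeWeight_pow (by push_cast; linarith)

/-- Changing σ costs a factor (σ - 1/2) log p. Since log p ≤ 4p^{1/4}, the resulting p^{-3/2} log p
is still dominated by the summable p^{-5/4}. -/
lemma primeWeight_sub_le {σ : ℝ} (h : 1 / 2 ≤ σ) (p : Nat.Primes) :
    primeWeight (1 / 2) p ^ 2 * (primeWeight (1 / 2) p - primeWeight σ p)
      ≤ 4 * (σ - 1 / 2) * ((p : ℕ) : ℝ) ^ (-(5 / 4) : ℝ) := by
  have h2 := two_le_prime p
  have hp : (0 : ℝ) < ((p : ℕ) : ℝ) := by linarith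
  have h1 : primeWeight σ p = primeWeight (1 / 2) p * ((p : ℕ) : ℝ) ^ (-(σ - 1 / 2)) := by
    rw [primeWeight, primeWeight, ← Real.rpow_add hp]
    ring_nf
  have h3 : 1 - (σ - 1 / 2) * Real.log (p : ℕ) ≤ ((p : ℕ) : ℝ) ^ (-(σ - 1 / 2)) := by
    rw [Real.rpow_def_of_pos hp]
    have := Real.add_one_le_exp (Real.log (p : ℕ) * -(σ - 1 / 2))
    linarith
  have h4 : Real.log (p : ℕ) ≤ 4 * ((p : ℕ) : ℝ) ^ (1 / 4 : ℝ) := by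
    have := Real.log_le_rpow_div hp.le (ε := 1 / 4) (by norm_num)
    linarith
  have hw := primeWeight_pos (1 / 2) p
  have hσ : 0 ≤ σ - 1 / 2 := by linarith
  calc primeWeight (1 / 2) p ^ 2 * (primeWeight (1 / 2) p - primeWeight σ p)
      = primeWeight (1 / 2) p ^ 3 * (1 - ((p : ℕ) : ℝ) ^ (-(σ - 1 / 2))) := by rw [h1]; ring
    _ ≤ primeWeight (1 / 2) p ^ 3 * ((σ - 1 / 2) * (4 * ((p : ℕ) : ℝ) ^ (1 / 4 : ℝ))) := by
        gcongr
        nlinarith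
    _ = 4 * (σ - 1 / 2) * (primeWeight (1 / 2) p ^ 3 * ((p : ℕ) : ℝ) ^ (1 / 4 : ℝ)) := by ring
    _ = _ := by
        rw [primeWeight_pow, ← Real.rpow_add hp]
        norm_num

lemma summable_prime_rpow_five_quarters :
    Summable fun p : Nat.Primes => ((p : ℕ) : ℝ) ^ (-(5 / 4) : ℝ) :=
  Nat.Primes.summable_rpow.2 (by norm_num)

lemma psiTerm_eq (σ : ℝ) (p : Nat.Primes) (k : ℕ+) :
    psiTerm σ (p, k) = (primeWeight σ p ^ (k : ℕ) / (k : ℕ)) ^ 2 := by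
  rw [psiTerm, div_pow, ← pow_mul, primeWeight_pow, one_div, mul_comm, ← div_eq_mul_inv]
  push_cast
  ring_nf

lemma hasSum_psiTerm {σ : ℝ} (h : 1 / 2 ≤ σ) (p : Nat.Primes) :
    HasSum (fun k : ℕ+ => psiTerm σ (p, k)) (eulerVar (primeWeight σ p)) := by
  have h1 := hasSum_eulerVar (primeWeight_pos σ p).le (primeWeight_sq_le h p)
  have h2 := (PNat.coe_injective.hasSum_iff (f := fun n : ℕ => (primeWeight σ p ^ n / n) ^ 2)
    (a := eulerVar (primeWeight σ p)) ?_).2 h1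
  · convert h2 using 2 with k
    exact psiTerm_eq σ p k
  · intro n hn
    have : n = 0 := by
      by_contra h0
      exact hn ⟨⟨n, Nat.pos_of_ne_zero h0⟩, rfl⟩
    simp [this]

lemma psiTerm_nonneg (σ : ℝ) (q : Nat.Primes × ℕ+) : 0 ≤ psiTerm σ q := by
  rw [show q = (q.1, q.2) from rfl, psiTerm_eq]
  positivity

lemma summable_eulerVar {σ : ℝ} (h : 1 / 2 < σ) :
    Summable fun p => eulerVar (primeWeight σ p) := by
  refine Summable.of_nonneg_of_le (fun p => eulerVar_nonneg _)
    (fun p => eulerVar_le (primeWeight_pos σ p).le (primeWeight_sq_le h.le p)) ?_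
  exact (summable_primeWeight_pow (by push_cast; linarith)).mul_left 16

lemma summable_psiTerm {σ : ℝ} (h : 1 / 2 < σ) : Summable (psiTerm σ) := by
  refine (summable_prod_of_nonneg (psiTerm_nonneg σ)).2
    ⟨fun p => (hasSum_psiTerm h.le p).summable, ?_⟩
  simp_rw [fun p => (hasSum_psiTerm h.le p).tsum_eq]
  exact summable_eulerVar h

lemma hasSum_psi {σ : ℝ} (h : 1 / 2 < σ) :
    HasSum (fun p => eulerVar (primeWeight σ p)) (psi σ) := by
  rw [psi, (summable_psiTerm h).tsum_prod]
  simp_rw [fun p => (hasSum_psiTerm h.le p).tsum_eq]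
  exact (summable_eulerVar h).hasSum

/-! ### Comparison of ψ(σ) with log ζ(2σ) -/

lemma eulerVar_le_add {x : ℝ} (h0 : 0 ≤ x) (hx : x ^ 2 ≤ 1 / 2) :
    eulerVar x ≤ x ^ 2 + 2 * x ^ 4 := by
  have h1 := hasSum_eulerVar h0 hx
  have hx1 : x ^ 2 < 1 := by linarith
  have hg := ((hasSum_geometric_of_lt_one (sq_nonneg x) hx1).mul_left (x ^ 4))
  have h2 : (∑' n : ℕ, (x ^ (n + 2) / ((n + 2 : ℕ) : ℝ)) ^ 2) ≤ x ^ 4 * (1 - x ^ 2)⁻¹ := by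
    rw [← hg.tsum_eq]
    refine ((summable_nat_add_iff 2).2 h1.summable).tsum_le_tsum (fun n => ?_) hg.summable
    rw [div_pow]
    refine (div_le_self (by positivity) ?_).trans (le_of_eq (by ring))
    push_cast
    nlinarith [(Nat.cast_nonneg n : (0 : ℝ) ≤ n)]
  have h3 := h1.summable.sum_add_tsum_nat_add 2
  rw [h1.tsum_eq] at h3
  simp only [Finset.sum_range_succ, Finset.sum_range_zero] at h3
  have h4 : (1 - x ^ 2)⁻¹ ≤ 2 := by
    rw [inv_le_comm₀ (by linarith) (by norm_num)]
    linarith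
  have h5 : x ^ 4 * (1 - x ^ 2)⁻¹ ≤ x ^ 4 * 2 := by gcongr
  norm_num at h3 h2
  linarith

lemma neg_log_one_sub_bounds {t : ℝ} (_h0 : 0 ≤ t) (h : t ≤ 1 / 2) :
    t ≤ -Real.log (1 - t) ∧ -Real.log (1 - t) ≤ t + 2 * t ^ 2 := by
  constructor
  · have := Real.log_le_sub_one_of_pos (by linarith : 0 < 1 - t)
    linarith
  · have := Real.one_sub_inv_le_log_of_pos (by linarith : 0 < 1 - t)
    have h2 : (1 - t)⁻¹ ≤ 1 + t + 2 * t ^ 2 := by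
      rw [inv_le_iff_one_le_mul₀ (by linarith)]
      nlinarith [mul_nonneg (sq_nonneg t) (by linarith : 0 ≤ 1 - 2 * t)]
    linarith

lemma log_re_riemannZeta_eq_tsum {s : ℝ} (hs : 1 < s) :
    Real.log (riemannZeta s).re
      = ∑' p : Nat.Primes, -Real.log (1 - ((p : ℕ) : ℝ) ^ (-s)) := by
  have h := riemannZeta_eulerProduct_exp_log (s := s) (by simpa using hs)
  have h1 : ∀ p : Nat.Primes, -Complex.log (1 - ((p : ℕ) : ℂ) ^ (-(s : ℂ)))
      = ((-Real.log (1 - ((p : ℕ) : ℝ) ^ (-s)) : ℝ) : ℂ) := by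
    intro p
    have h2 := two_le_prime p
    have h3 : ((p : ℕ) : ℝ) ^ (-s) ≤ 1 :=
      Real.rpow_le_one_of_one_le_of_nonpos (by linarith) (by linarith)
    rw [Complex.ofReal_neg, Complex.ofReal_log (by linarith), Complex.ofReal_sub,
      Complex.ofReal_cpow (by positivity)]
    push_cast
    rfl
  simp_rw [h1] at h
  rw [← Complex.ofReal_tsum, ← Complex.ofReal_exp] at h
  rw [← h, Complex.ofReal_re, Real.log_exp]

/-- For each prime, both the variance and -log(1 - p^{-2σ}) lie between x² and x² + 2x⁴ with x =
p^{-σ}, and x⁴ is at most p⁻², which is summable uniformly in σ. -/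
lemma exists_psi_sub_log_zeta_le : ∃ C, ∀ σ : ℝ, 1 / 2 < σ →
    |psi σ - Real.log (riemannZeta ((2 * σ : ℝ) : ℂ)).re| ≤ C := by
  refine ⟨∑' p, 2 * primeWeight (1 / 2) p ^ 4, fun σ hσ => ?_⟩
  have hs4 : Summable fun p => 2 * primeWeight (1 / 2) p ^ 4 :=
    (summable_primeWeight_pow (by norm_num)).mul_left 2
  rw [log_re_riemannZeta_eq_tsum (by linarith)]
  have hpw : ∀ p : Nat.Primes, ((p : ℕ) : ℝ) ^ (-(2 * σ)) = primeWeight σ p ^ 2 := by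
    intro p
    rw [primeWeight_pow]
    norm_num
  simp_rw [hpw]
  have hb : ∀ p, |eulerVar (primeWeight σ p) - -Real.log (1 - primeWeight σ p ^ 2)|
      ≤ 2 * primeWeight (1 / 2) p ^ 4 := by
    intro p
    have hx0 := (primeWeight_pos σ p).le
    have hx := primeWeight_sq_le hσ.le p
    have h1 := sq_le_eulerVar hx0 hx
    have h2 := eulerVar_le_add hx0 hx
    obtain ⟨h3, h4⟩ := neg_log_one_sub_bounds (sq_nonneg (primeWeight σ p)) hx
    have h5 : primeWeight σ p ^ 4 ≤ primeWeight (1 / 2) p ^ 4 := by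
      gcongr
      exact primeWeight_anti hσ.le p
    rw [abs_le]
    constructor <;> nlinarith
  have hsd : Summable fun p => eulerVar (primeWeight σ p) - -Real.log (1 - primeWeight σ p ^ 2) :=
    Summable.of_norm_bounded hs4 hb
  have hsl : Summable fun p => -Real.log (1 - primeWeight σ p ^ 2) := by
    simpa using (hasSum_psi hσ).summable.sub hsd
  rw [← (hasSum_psi hσ).tsum_eq, ← (hasSum_psi hσ).summable.tsum_sub hsl, ← Real.norm_eq_abs]
  exact tsum_of_norm_bounded hs4.hasSum hb

/-- Dividing out the pole leaves `riemannZeta₁`, whose real part is continuous and nonzero on [1,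
3]: it is 1 at s = 1, and beyond that ζ has positive real part. Hence its logarithm is bounded by
compactness. -/
lemma exists_psi_add_log_le : ∃ C, ∀ σ : ℝ, 1 / 2 < σ → σ ≤ 3 / 2 →
    |psi σ + Real.log (2 * σ - 1)| ≤ C := by
  obtain ⟨C, hC⟩ := exists_psi_sub_log_zeta_le
  have hcont : ContinuousOn (fun s : ℝ => Real.log (riemannZeta₁ s).re) (Set.Icc 1 3) := by
    refine ContinuousOn.log ?_ fun s hs => ?_
    · exact (Complex.continuous_re.comp
        (differentiable_riemannZeta₁.continuous.comp Complex.continuous_ofReal)).continuousOn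
    · rcases hs.1.eq_or_lt with h | h
      · simp [← h]
      · have h1 := riemannZeta_re_pos_of_one_lt h
        have h2 : (riemannZeta s).re = (s - 1)⁻¹ * (riemannZeta₁ s).re := by
          have : (s : ℂ) ≠ 1 := by exact_mod_cast h.ne'
          rw [riemannZeta_eq_inv_sub_mul this]
          rw [← Complex.ofReal_one, ← Complex.ofReal_sub, ← Complex.ofReal_inv,
            Complex.re_ofReal_mul]
        intro h3
        rw [h2, h3, mul_zero] at h1
        exact lt_irrefl _ h1
  obtain ⟨D, hD⟩ := isCompact_Icc.exists_bound_of_continuousOn hcont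
  refine ⟨C + D, fun σ h1 h2 => ?_⟩
  have h3 := hC σ h1
  have h4 := hD (2 * σ) ⟨by linarith, by linarith⟩
  rw [Real.norm_eq_abs] at h4
  have h5 := log_riemannZeta_eq_neg_log_sub_add_ofReal (s := 2 * σ) (by linarith)
  rw [h5] at h3
  have h6 : psi σ + Real.log (2 * σ - 1)
      = (psi σ - (-Real.log (2 * σ - 1) + Real.log (riemannZeta₁ ((2 * σ : ℝ) : ℂ)).re))
        + Real.log (riemannZeta₁ ((2 * σ : ℝ) : ℂ)).re := by ring
  rw [h6]
  exact (abs_add_le _ _).trans (add_le_add h3 h4)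

lemma two_le_log_of_ten_le {T : ℝ} (hT : 10 ≤ T) : 2 ≤ Real.log T := by
  rw [Real.le_log_iff_exp_le (by linarith)]
  have h := Real.exp_one_lt_d9
  have h2 : Real.exp 2 = Real.exp 1 * Real.exp 1 := by rw [← Real.exp_add]; norm_num
  nlinarith [Real.exp_pos 1]

lemma sigmaT_mem {θ T : ℝ} (hθ : 0 < θ) (hT : 10 ≤ T) :
    1 / 2 < sigmaT θ T ∧ sigmaT θ T ≤ 3 / 2 := by
  have hl := two_le_log_of_ten_le hT
  have h1 : 1 ≤ Real.log T ^ θ := Real.one_le_rpow (by linarith) hθ.le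
  have h2 : 1 / Real.log T ^ θ ≤ 1 := by rw [div_le_one (by linarith)]; exact h1
  have h3 : 0 < 1 / Real.log T ^ θ := by positivity
  unfold sigmaT
  constructor <;> linarith

lemma exists_psi_sigmaT_sub_le {θ : ℝ} (hθ : 0 < θ) : ∃ C : ℝ, ∀ T : ℝ, 10 ≤ T →
    |psi (sigmaT θ T) - θ * Real.log (Real.log T)| ≤ C := by
  obtain ⟨C, hC⟩ := exists_psi_add_log_le
  refine ⟨C + Real.log 2, fun T hT => ?_⟩
  obtain ⟨h1, h2⟩ := sigmaT_mem hθ hT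
  have hl := two_le_log_of_ten_le hT
  have h3 := hC _ h1 h2
  have h4 : Real.log (2 * sigmaT θ T - 1) = Real.log 2 - θ * Real.log (Real.log T) := by
    have : 2 * sigmaT θ T - 1 = 2 / Real.log T ^ θ := by unfold sigmaT; ring
    rw [this, Real.log_div (by norm_num) (by positivity), Real.log_rpow (by linarith)]
  rw [h4] at h3
  have h5 : psi (sigmaT θ T) - θ * Real.log (Real.log T)
      = psi (sigmaT θ T) + (Real.log 2 - θ * Real.log (Real.log T)) - Real.log 2 := by ring
  rw [h5]
  refine (abs_sub _ _).trans (add_le_add h3 ?_)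
  rw [abs_of_pos (Real.log_pos (by norm_num))]

/-! ### Almost sure convergence -/

lemma mem_primesLT {N : ℕ} {p : Nat.Primes} : p ∈ primesLT N ↔ (p : ℕ) < N :=
  Finset.mem_subtype.trans Finset.mem_range

lemma tendsto_primesLT : Tendsto primesLT atTop atTop := by
  refine tendsto_atTop_finset_of_monotone (fun N M h p hp => ?_) fun p => ⟨p + 1, ?_⟩
  · rw [mem_primesLT] at *
    omega
  · rw [mem_primesLT]
    omega

lemma primesLT_succ_of_not_prime {N : ℕ} (hN : ¬ N.Prime) : primesLT (N + 1) = primesLT N := by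
  ext p
  rw [mem_primesLT, mem_primesLT]
  have : (p : ℕ) ≠ N := fun h => hN (h ▸ p.2)
  omega

lemma primesLT_succ_of_prime (p : Nat.Primes) :
    primesLT ((p : ℕ) + 1) = insert p (primesLT p) := by
  ext q
  rw [Finset.mem_insert, mem_primesLT, mem_primesLT, Nat.lt_succ_iff_lt_or_eq, or_comm]
  exact or_congr_left (Nat.Primes.coe_nat_inj q p)

section Convergence

variable {Ω : Type*} [mΩ : MeasurableSpace Ω] {P : Measure Ω} [IsProbabilityMeasure P]

/-- The filtration generated by `Z p`, `p < N`. -/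
def primeFiltration (Z : Nat.Primes → Ω → ℝ) (hm : ∀ p, Measurable (Z p)) : Filtration ℕ mΩ where
  seq N := ⨆ p ∈ {p : Nat.Primes | (p : ℕ) < N}, MeasurableSpace.comap (Z p) inferInstance
  mono' _ _ h := biSup_mono fun _ hp => lt_of_lt_of_le hp h
  le' _ := iSup₂_le fun p _ => (hm p).comap_le

lemma measurable_primeFiltration (Z : Nat.Primes → Ω → ℝ) (hm : ∀ p, Measurable (Z p)) {N : ℕ}
    {p : Nat.Primes} (hp : (p : ℕ) < N) : Measurable[primeFiltration Z hm N] (Z p) :=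
  (comap_measurable (Z p)).mono
    (le_biSup (fun p : Nat.Primes => MeasurableSpace.comap (Z p) inferInstance)
      (i := p) (s := {p : Nat.Primes | (p : ℕ) < N}) hp) le_rfl

/-- Time runs over all naturals: at a prime step the increment is independent of the past and
centred, and at any other step nothing changes. -/
lemma martingale_sum_primesLT {Z : Nat.Primes → Ω → ℝ} (hm : ∀ p, Measurable (Z p))
    (hi : ∀ p, Integrable (Z p) P) (hind : iIndepFun Z P) (h0 : ∀ p, ∫ ω, Z p ω ∂P = 0) :
    Martingale (fun N => ∑ p ∈ primesLT N, Z p) (primeFiltration Z hm) P := by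
  have hadp : ∀ N, StronglyMeasurable[primeFiltration Z hm N] (∑ p ∈ primesLT N, Z p) := by
    intro N
    refine Finset.stronglyMeasurable_sum _ fun p hp => ?_
    exact (measurable_primeFiltration Z hm (mem_primesLT.1 hp)).stronglyMeasurable
  have hint : ∀ N, Integrable (∑ p ∈ primesLT N, Z p) P := fun N =>
    integrable_finsetSum' _ fun p _ => hi p
  refine martingale_nat hadp hint fun N => ?_
  by_cases hN : N.Prime
  · obtain ⟨p, rfl⟩ : ∃ p : Nat.Primes, (p : ℕ) = N := ⟨⟨N, hN⟩, rfl⟩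
    rw [primesLT_succ_of_prime, Finset.sum_insert (by simp [mem_primesLT])]
    have h1 : P[Z p | primeFiltration Z hm p] =ᵐ[P] fun _ => ∫ ω, Z p ω ∂P := by
      refine condExp_indep_eq (hm p).comap_le ((primeFiltration Z hm).le _)
        (comap_measurable (Z p)).stronglyMeasurable ?_
      have := indep_iSup_of_disjoint (fun q => (hm q).comap_le) hind
        (S := {p}) (T := {q : Nat.Primes | (q : ℕ) < p}) (by simp)
      rwa [iSup_singleton] at this
    have h2 := condExp_add (hi p) (hint p) (primeFiltration Z hm p)
    rw [condExp_of_stronglyMeasurable ((primeFiltration Z hm).le p) (hadp p) (hint p)] at h2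
    filter_upwards [h1, h2] with ω h1 h2
    rw [h2, Pi.add_apply, h1, h0, zero_add]
  · rw [primesLT_succ_of_not_prime hN,
      condExp_of_stronglyMeasurable ((primeFiltration Z hm).le N) (hadp N) (hint N)]

lemma ae_exists_tendsto_sum_primesLT {Z : Nat.Primes → Ω → ℝ} (hm : ∀ p, Measurable (Z p))
    (hL : ∀ p, MemLp (Z p) 2 P) (hind : iIndepFun Z P) (h0 : ∀ p, ∫ ω, Z p ω ∂P = 0) {V : ℝ}
    (hV : ∀ s : Finset Nat.Primes, ∑ p ∈ s, ∫ ω, Z p ω ^ 2 ∂P ≤ V) :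
    ∀ᵐ ω ∂P, ∃ l, Tendsto (fun N => ∑ p ∈ primesLT N, Z p ω) atTop (𝓝 l) := by
  have hi : ∀ p, Integrable (Z p) P := fun p => (hL p).integrable (by norm_num)
  have hM := martingale_sum_primesLT hm hi hind h0
  have hb : ∀ N, eLpNorm (∑ p ∈ primesLT N, Z p) 1 P ≤ ((1 + V).toNNReal : ENNReal) := by
    intro N
    have hSi : Integrable (∑ p ∈ primesLT N, Z p) P := integrable_finsetSum' _ fun p _ => hi p
    have hS2 : MemLp (∑ p ∈ primesLT N, Z p) 2 P := memLp_finsetSum' _ fun p _ => hL p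
    have hS0 : ∫ ω, (∑ p ∈ primesLT N, Z p) ω ∂P = 0 := by
      simp_rw [Finset.sum_apply]
      rw [integral_finsetSum _ fun p _ => hi p]
      exact Finset.sum_eq_zero fun p _ => h0 p
    have hvar : ∫ ω, (∑ p ∈ primesLT N, Z p) ω ^ 2 ∂P ≤ V := by
      have h1 := IndepFun.variance_sum (s := primesLT N) (fun p _ => hL p)
        (fun p _ q _ hpq => hind.indepFun hpq)
      rw [variance_of_integral_eq_zero hS2.aemeasurable hS0] at h1
      rw [h1]
      refine le_trans (le_of_eq (Finset.sum_congr rfl fun p _ => ?_)) (hV (primesLT N))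
      exact variance_of_integral_eq_zero (hL p).aemeasurable (h0 p)
    rw [eLpNorm_one_eq_lintegral_enorm, ← ofReal_integral_norm_eq_lintegral_enorm hSi]
    refine ENNReal.ofReal_le_ofReal ?_
    -- The inequality |S| ≤ 1 + S² turns the variance bound into the L¹ bound required for
    -- martingale convergence.
    have h2 : ∫ ω, ‖(∑ p ∈ primesLT N, Z p) ω‖ ∂P
        ≤ ∫ ω, (1 + (∑ p ∈ primesLT N, Z p) ω ^ 2) ∂P := by
      refine integral_mono hSi.norm ((integrable_const _).add hS2.integrable_sq) fun ω => ?_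
      simp only [Real.norm_eq_abs]
      nlinarith [sq_abs ((∑ p ∈ primesLT N, Z p) ω), sq_nonneg (|(∑ p ∈ primesLT N, Z p) ω| - 1)]
    rw [integral_add (integrable_const _) hS2.integrable_sq] at h2
    simp only [integral_const, probReal_univ, smul_eq_mul, mul_one] at h2
    linarith
  have := hM.submartingale.exists_ae_tendsto_of_bdd hb
  simpa using this

end Convergence

namespace IsUniformOnCircleFamily

variable {Ω : Type*} [MeasurableSpace Ω] {P : Measure Ω}
  {X : Nat.Primes → Ω → ℂ}

lemma integral_comp {E : Type*} [NormedAddCommGroup E] [NormedSpace ℝ E]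
    (hX : IsUniformOnCircleFamily P X) (p : Nat.Primes) {f : ℂ → E}
    (hf : AEStronglyMeasurable f uniformUnitCircle) :
    ∫ ω, f (X p ω) ∂P = ∫ z, f z ∂uniformUnitCircle := by
  rw [← hX.law p] at hf ⊢
  rw [integral_map (hX.measurable p).aemeasurable hf]

lemma ae_norm_eq_one (hX : IsUniformOnCircleFamily P X) : ∀ᵐ ω ∂P, ∀ p, ‖X p ω‖ = 1 := by
  rw [ae_all_iff]
  intro p
  have := ae_norm_eq_one_uniformUnitCircle
  rw [← hX.law p] at this
  exact ae_of_ae_map (hX.measurable p).aemeasurable this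

end IsUniformOnCircleFamily

lemma partialLogRandomZeta_eq {Ω : Type*} (σ : ℝ) (X : Nat.Primes → Ω → ℂ) (N : ℕ) (ω : Ω) :
    partialLogRandomZeta σ X N ω = ∑ p ∈ primesLT N, eulerLog (primeWeight σ p) (X p ω) := by
  unfold partialLogRandomZeta eulerLog primeWeight
  refine Finset.sum_congr rfl fun p _ => ?_
  rw [Real.rpow_neg (by positivity), Complex.ofReal_inv, div_eq_mul_inv]

lemma exp_partialLogRandomZeta {Ω : Type*} {σ : ℝ} (hσ : 1 / 2 < σ) {X : Nat.Primes → Ω → ℂ}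
    {ω : Ω} (hω : ∀ p, ‖X p ω‖ = 1) (N : ℕ) :
    Complex.exp (partialLogRandomZeta σ X N ω) = partialRandomZeta σ X N ω := by
  rw [partialLogRandomZeta_eq, partialRandomZeta, Complex.exp_sum]
  refine Finset.prod_congr rfl fun p _ => ?_
  have h1 := one_sub_mem_slitPlane (primeWeight_pos σ p).le
    ((lt_of_sq_le_half (primeWeight_sq_le hσ.le p)).trans (by norm_num)) (hω p).le
  rw [eulerLog, Complex.exp_neg, Complex.exp_log (Complex.slitPlane_ne_zero h1), primeWeight,
    Real.rpow_neg (by positivity), Complex.ofReal_inv, div_eq_mul_inv]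

lemma measurable_partialLogRandomZeta {Ω : Type*} [MeasurableSpace Ω] {P : Measure Ω}
    {X : Nat.Primes → Ω → ℂ} (hX : IsUniformOnCircleFamily P X) (σ : ℝ) (N : ℕ) :
    Measurable (partialLogRandomZeta σ X N) := by
  have : partialLogRandomZeta σ X N
      = fun ω => ∑ p ∈ primesLT N, eulerLog (primeWeight σ p) (X p ω) :=
    funext fun ω => partialLogRandomZeta_eq σ X N ω
  rw [this]
  exact Finset.measurable_fun_sum _ fun p _ => (measurable_eulerLog _).comp (hX.measurable p)

lemma integral_exp_partialLogRandomZeta {Ω : Type*} [MeasurableSpace Ω] {P : Measure Ω}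
    {X : Nat.Primes → Ω → ℂ} (hX : IsUniformOnCircleFamily P X) (σ u v : ℝ) (N : ℕ) :
    ∫ ω, Complex.exp (Complex.I * ((u * (partialLogRandomZeta σ X N ω).re
        + v * (partialLogRandomZeta σ X N ω).im : ℝ) : ℂ)) ∂P
      = ∏ p ∈ primesLT N, eulerCharFun (primeWeight σ p) u v := by
  have hm : ∀ p, Measurable fun z : ℂ =>
      Complex.exp (Complex.I * (eulerLin (primeWeight σ p) u v z : ℝ)) := fun p => by fun_prop
  have h1 := iIndepFun.integral_fun_prod_comp (𝕜 := ℂ) (X := fun p : primesLT N => X p)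
    (hX.indep.precomp (g := ((↑) : primesLT N → Nat.Primes)) Subtype.val_injective)
    (f := fun p z => Complex.exp (Complex.I * (eulerLin (primeWeight σ p) u v z : ℝ)))
    (fun p => (hX.measurable p).aemeasurable) (fun p => (hm p).aestronglyMeasurable)
  simp_rw [fun p : Nat.Primes => hX.integral_comp p (hm p).aestronglyMeasurable] at h1
  rw [Finset.prod_coe_sort (primesLT N) fun p => ∫ z,
    Complex.exp (Complex.I * (eulerLin (primeWeight σ p) u v z : ℝ)) ∂uniformUnitCircle] at h1
  refine Eq.trans ?_ h1
  congr 1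
  ext ω
  rw [Finset.prod_coe_sort (primesLT N) fun p =>
    Complex.exp (Complex.I * (eulerLin (primeWeight σ p) u v (X p ω) : ℝ)), ← Complex.exp_sum,
    partialLogRandomZeta_eq, ← Finset.mul_sum, ← Complex.ofReal_sum, Complex.re_sum,
    Complex.im_sum, Finset.mul_sum, Finset.mul_sum, ← Finset.sum_add_distrib]
  rfl

section RandomZeta

variable {Ω : Type*} [MeasurableSpace Ω] {P : Measure Ω} [IsProbabilityMeasure P]
  {X : Nat.Primes → Ω → ℂ}

/-- Intended for f the real or the imaginary part, because the martingale argument is real-valued.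
The variances are dominated by the terms of ψ(σ). -/
lemma ae_exists_tendsto_sum_comp_eulerLog (hX : IsUniformOnCircleFamily P X) {σ : ℝ}
    (hσ : 1 / 2 < σ) {f : ℂ → ℝ} (hf : Measurable f) (hf1 : ∀ z, |f z| ≤ ‖z‖)
    (hf0 : ∀ x, 0 ≤ x → x ^ 2 ≤ 1 / 2 → ∫ z, f (eulerLog x z) ∂uniformUnitCircle = 0) :
    ∀ᵐ ω ∂P, ∃ l, Tendsto
      (fun N => ∑ p ∈ primesLT N, f (eulerLog (primeWeight σ p) (X p ω))) atTop (𝓝 l) := by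
  have hx0 := fun p => (primeWeight_pos σ p).le
  have hx := primeWeight_sq_le hσ.le
  have hmf : ∀ p, Measurable fun z => f (eulerLog (primeWeight σ p) z) := fun p =>
    hf.comp (measurable_eulerLog _)
  have hmf2 : ∀ p, Measurable fun z => f (eulerLog (primeWeight σ p) z) ^ 2 := fun p =>
    (hmf p).pow_const 2
  have hm : ∀ p, Measurable fun ω => f (eulerLog (primeWeight σ p) (X p ω)) := fun p =>
    (hmf p).comp (hX.measurable p)
  have hle : ∀ p z, ‖z‖ = 1 → |f (eulerLog (primeWeight σ p) z)| ≤ 4 * primeWeight σ p :=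
    fun p z hz => (hf1 _).trans (norm_eulerLog_le (hx0 p) (hx p) hz.le)
  refine ae_exists_tendsto_sum_primesLT (V := ∑' p, eulerVar (primeWeight σ p)) hm (fun p => ?_) ?_
    (fun p => ?_) fun s => ?_
  · refine MemLp.of_bound (hm p).aestronglyMeasurable (4 * primeWeight σ p) ?_
    filter_upwards [hX.ae_norm_eq_one] with ω hω using hle p _ (hω p)
  · exact hX.indep.comp (fun p z => f (eulerLog (primeWeight σ p) z)) hmf
  · rw [hX.integral_comp p (hmf p).aestronglyMeasurable]
    exact hf0 _ (hx0 p) (hx p)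
  · refine le_trans (Finset.sum_le_sum fun p _ => ?_)
      ((summable_eulerVar hσ).sum_le_tsum s fun p _ => eulerVar_nonneg _)
    rw [hX.integral_comp p (hmf2 p).aestronglyMeasurable, eulerVar]
    refine integral_mono ?_ ?_ fun z => ?_
    · refine integrable_of_bounded_on_circle (hmf2 p).aestronglyMeasurable
        (C := (4 * primeWeight σ p) ^ 2) fun z hz => ?_
      rw [norm_pow, Real.norm_eq_abs]
      gcongr
      exact hle p z hz
    · refine integrable_of_bounded_on_circle
        ((measurable_eulerLog _).norm.pow_const 2).aestronglyMeasurable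
        (C := (4 * primeWeight σ p) ^ 2) fun z hz => ?_
      rw [norm_pow, norm_norm]
      gcongr
      exact norm_eulerLog_le (hx0 p) (hx p) hz.le
    · rw [← sq_abs]
      gcongr
      exact hf1 _

lemma ae_tendsto_partialLogRandomZeta (hX : IsUniformOnCircleFamily P X) {σ : ℝ}
    (hσ : 1 / 2 < σ) :
    ∀ᵐ ω ∂P, Tendsto (fun N => partialLogRandomZeta σ X N ω) atTop (𝓝 (logRandomZeta σ X ω)) := by
  have hre := ae_exists_tendsto_sum_comp_eulerLog hX hσ (f := Complex.re) Complex.measurable_re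
    Complex.abs_re_le_norm fun x h0 hx => by
      have h := integral_re (integrable_eulerLog h0 hx)
      rw [integral_eulerLog h0 ((lt_of_sq_le_half hx).trans (by norm_num))] at h
      simpa using h
  have him := ae_exists_tendsto_sum_comp_eulerLog hX hσ (f := Complex.im) Complex.measurable_im
    Complex.abs_im_le_norm fun x h0 hx => by
      have h := integral_im (integrable_eulerLog h0 hx)
      rw [integral_eulerLog h0 ((lt_of_sq_le_half hx).trans (by norm_num))] at h
      simpa using h
  filter_upwards [hre, him] with ω ⟨a, ha⟩ ⟨b, hb⟩
  refine tendsto_nhds_limUnder ⟨(a : ℂ) + b * Complex.I, ?_⟩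
  have h1 := (Complex.continuous_ofReal.tendsto a).comp ha
  have h2 := (Complex.continuous_ofReal.tendsto b).comp hb
  refine (h1.add (h2.mul_const Complex.I)).congr fun N => ?_
  rw [partialLogRandomZeta_eq, Function.comp_apply, Function.comp_apply]
  conv_rhs => rw [← Complex.re_add_im (∑ p ∈ primesLT N, eulerLog (primeWeight σ p) (X p ω))]
  rw [Complex.re_sum, Complex.im_sum]

lemma randomZeta_wellDefined (hX : IsUniformOnCircleFamily P X) {σ : ℝ} (hσ : 1 / 2 < σ) :
    ∀ᵐ ω ∂P,
      Tendsto (fun N => partialLogRandomZeta σ X N ω) atTop (𝓝 (logRandomZeta σ X ω)) ∧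
      Tendsto (fun N => partialRandomZeta σ X N ω) atTop (𝓝 (randomZeta σ X ω)) ∧
      Complex.exp (logRandomZeta σ X ω) = randomZeta σ X ω := by
  filter_upwards [ae_tendsto_partialLogRandomZeta hX hσ, hX.ae_norm_eq_one] with ω h1 h2
  have h3 : Tendsto (fun N => partialRandomZeta σ X N ω) atTop
      (𝓝 (Complex.exp (logRandomZeta σ X ω))) := by
    refine ((Complex.continuous_exp.tendsto _).comp h1).congr fun N => ?_
    exact exp_partialLogRandomZeta hσ h2 N
  have h4 : randomZeta σ X ω = Complex.exp (logRandomZeta σ X ω) := h3.limUnder_eq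
  exact ⟨h1, h4 ▸ h3, h4.symm⟩

lemma aemeasurable_logRandomZeta (hX : IsUniformOnCircleFamily P X) {σ : ℝ} (hσ : 1 / 2 < σ) :
    AEMeasurable (logRandomZeta σ X) P :=
  aemeasurable_of_tendsto_metrizable_ae atTop
    (fun N => (measurable_partialLogRandomZeta hX σ N).aemeasurable)
    (ae_tendsto_partialLogRandomZeta hX hσ)

/-- The characteristic function of `log ζ(σ, X)` is the product of those of its summands. -/
lemma tendsto_prod_eulerCharFun (hX : IsUniformOnCircleFamily P X) {σ : ℝ} (hσ : 1 / 2 < σ)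
    (u v : ℝ) :
    Tendsto (fun N => ∏ p ∈ primesLT N, eulerCharFun (primeWeight σ p) u v) atTop
      (𝓝 (∫ ω, Complex.exp (Complex.I * ((u * (logRandomZeta σ X ω).re
        + v * (logRandomZeta σ X ω).im : ℝ) : ℂ)) ∂P)) := by
  simp_rw [← integral_exp_partialLogRandomZeta hX]
  refine tendsto_integral_of_dominated_convergence (fun _ => 1) (fun N => ?_) (integrable_const _)
    (fun N => ?_) ?_
  · have := measurable_partialLogRandomZeta hX σ N
    have hm : Measurable fun ω => Complex.exp (Complex.I *
      ((u * (partialLogRandomZeta σ X N ω).re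
        + v * (partialLogRandomZeta σ X N ω).im : ℝ) : ℂ)) := by fun_prop
    exact hm.aestronglyMeasurable
  · refine Eventually.of_forall fun ω => ?_
    rw [mul_comm, Complex.norm_exp_ofReal_mul_I]
  · filter_upwards [ae_tendsto_partialLogRandomZeta hX hσ] with ω hω
    have hc : Continuous fun w : ℂ =>
      Complex.exp (Complex.I * ((u * w.re + v * w.im : ℝ) : ℂ)) := by fun_prop
    exact (hc.tendsto _).comp hω

end RandomZeta

/-! ### Total cumulants and the expansion near the origin -/

/-- The sum over all primes of the cumulants `eulerCumulant i j (p ^ (-σ))`. -/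
def totalCumulant (i j : ℕ) (σ : ℝ) : ℝ := ∑' p, eulerCumulant i j (primeWeight σ p)

/-- The homogeneous polynomial of degree `k` formed from the total cumulants. -/
def totalCumulantForm (k : ℕ) (σ u v : ℝ) : ℝ :=
  ∑ m ∈ Finset.HasAntidiagonal.antidiagonal k, totalCumulant m.1 m.2 σ * (u ^ m.1 * v ^ m.2)

/-- The sum of the homogeneous parts of degrees `3`, `4`, `5`. -/
def totalCumulantSum (σ u v : ℝ) : ℂ :=
  ∑ k ∈ Finset.Icc 3 5, Complex.I ^ k * (totalCumulantForm k σ u v : ℝ)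

lemma hasSum_totalCumulant {i j : ℕ} (h3 : 3 ≤ i + j) (h5 : i + j ≤ 5) {σ : ℝ} (hσ : 1 / 2 ≤ σ) :
    HasSum (fun p => eulerCumulant i j (primeWeight σ p)) (totalCumulant i j σ) := by
  obtain ⟨K, -, hK⟩ := exists_eulerCumulant_bound
  refine Summable.hasSum (Summable.of_norm_bounded
    ((summable_primeWeight_pow_three hσ).mul_left K) fun p => ?_)
  exact (hK i j h3 h5).1 _ (primeWeight_pos σ p).le (primeWeight_sq_le hσ p)

lemma hasSum_eulerCumulantSum {σ : ℝ} (hσ : 1 / 2 ≤ σ) (u v : ℝ) :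
    HasSum (fun p => eulerCumulantSum (primeWeight σ p) u v) (totalCumulantSum σ u v) := by
  refine hasSum_sum fun k hk => HasSum.mul_left _ (Complex.hasSum_ofReal.2 ?_)
  rw [Finset.mem_Icc] at hk
  refine hasSum_sum fun m hm => HasSum.mul_right _ ?_
  rw [Finset.HasAntidiagonal.mem_antidiagonal] at hm
  exact hasSum_totalCumulant (by omega) (by omega) hσ

/-- The bound O(x³) gives uniform convergence down to σ = 1/2. The Lipschitz bound then lets the
cumulants at σ be replaced by those at 1/2, which removes the dependence on T from the coefficients.
-/
lemma exists_totalCumulant_bound : ∃ K, 0 ≤ K ∧ ∀ i j : ℕ, 3 ≤ i + j → i + j ≤ 5 →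
    ∀ σ : ℝ, 1 / 2 ≤ σ → |totalCumulant i j σ| ≤ K ∧
      |totalCumulant i j σ - totalCumulant i j (1 / 2)| ≤ K * (σ - 1 / 2) := by
  obtain ⟨K, hK0, hK⟩ := exists_eulerCumulant_bound
  set A := ∑' p, primeWeight (1 / 2) p ^ 3
  set B := ∑' p : Nat.Primes, ((p : ℕ) : ℝ) ^ (-(5 / 4) : ℝ)
  have hA : 0 ≤ A := tsum_nonneg fun p => pow_nonneg (primeWeight_pos _ p).le _
  have hB : 0 ≤ B := tsum_nonneg fun p => by positivity
  refine ⟨K * A + 4 * K * B, by positivity, fun i j h3 h5 σ hσ => ⟨?_, ?_⟩⟩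
  · have h1 := tsum_of_norm_bounded (f := fun p => eulerCumulant i j (primeWeight σ p))
      ((summable_primeWeight_pow_three le_rfl).hasSum.mul_left K) fun p => by
        refine ((hK i j h3 h5).1 _ (primeWeight_pos σ p).le (primeWeight_sq_le hσ p)).trans ?_
        have := (primeWeight_pos σ p).le
        gcongr
        exact primeWeight_anti hσ p
    refine h1.trans ?_
    have : 0 ≤ 4 * K * B := by positivity
    linarith
  · have h1 := tsum_of_norm_bounded
      (f := fun p => eulerCumulant i j (primeWeight (1 / 2) p)
        - eulerCumulant i j (primeWeight σ p))
      (summable_prime_rpow_five_quarters.hasSum.mul_left (4 * K * (σ - 1 / 2))) fun p => by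
        refine ((hK i j h3 h5).2 _ _ (primeWeight_pos σ p).le (primeWeight_anti hσ p)
          (primeWeight_sq_le le_rfl p)).trans ?_
        have := primeWeight_sub_le hσ p
        calc _ = K * (primeWeight (1 / 2) p ^ 2 * (primeWeight (1 / 2) p - primeWeight σ p)) := by
              ring
          _ ≤ K * (4 * (σ - 1 / 2) * ((p : ℕ) : ℝ) ^ (-(5 / 4) : ℝ)) := by gcongr
          _ = _ := by ring
    rw [((hasSum_totalCumulant h3 h5 le_rfl).sub (hasSum_totalCumulant h3 h5 hσ)).tsum_eq,
      Real.norm_eq_abs, abs_sub_comm] at h1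
    refine h1.trans ?_
    have h2 : 0 ≤ σ - 1 / 2 := by linarith
    have : 0 ≤ K * A * (σ - 1 / 2) := by positivity
    nlinarith

lemma abs_le_of_sq_add_sq {u v ρ : ℝ} (hρ : 0 ≤ ρ) (h : u ^ 2 + v ^ 2 = ρ ^ 2) :
    |u| ≤ ρ ∧ |v| ≤ ρ :=
  ⟨abs_le_of_sq_le_sq (by nlinarith [sq_nonneg v]) hρ,
    abs_le_of_sq_le_sq (by nlinarith [sq_nonneg u]) hρ⟩

lemma abs_monomial_le {u v ρ : ℝ} (hρ : 0 ≤ ρ) (h : u ^ 2 + v ^ 2 = ρ ^ 2) (i j : ℕ) :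
    |u ^ i * v ^ j| ≤ ρ ^ (i + j) := by
  obtain ⟨hu, hv⟩ := abs_le_of_sq_add_sq hρ h
  rw [abs_mul, abs_pow, abs_pow, pow_add]
  gcongr

/-- Three degrees with at most six monomials each account for 18. The coefficients are arbitrary so
that differences of total cumulants are covered too. -/
lemma norm_cumulantForm_sum_le {c : ℕ → ℕ → ℝ} {b R u v : ℝ} (hb : 0 ≤ b) (hR : 0 ≤ R)
    (hc : ∀ i j, 3 ≤ i + j → i + j ≤ 5 → |c i j| ≤ b)
    (hmon : ∀ i j, 3 ≤ i + j → i + j ≤ 5 → |u ^ i * v ^ j| ≤ R) :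
    ‖∑ k ∈ Finset.Icc 3 5, Complex.I ^ k * ((∑ m ∈ Finset.HasAntidiagonal.antidiagonal k,
      c m.1 m.2 * (u ^ m.1 * v ^ m.2) : ℝ) : ℂ)‖ ≤ 18 * b * R := by
  have h1 : ∀ k ∈ Finset.Icc 3 5, ‖Complex.I ^ k *
      ((∑ m ∈ Finset.HasAntidiagonal.antidiagonal k,
        c m.1 m.2 * (u ^ m.1 * v ^ m.2) : ℝ) : ℂ)‖ ≤ 6 * b * R := by
    intro k hk
    rw [Finset.mem_Icc] at hk
    rw [norm_mul, norm_pow, Complex.norm_I, one_pow, one_mul, Complex.norm_real,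
      Real.norm_eq_abs]
    refine (Finset.abs_sum_le_sum_abs _ _).trans ?_
    refine (Finset.sum_le_card_nsmul _ _ (b * R) fun m hm => ?_).trans ?_
    · rw [Finset.HasAntidiagonal.mem_antidiagonal] at hm
      rw [abs_mul]
      have h2 := hmon m.1 m.2 (by omega) (by omega)
      have := hc m.1 m.2 (by omega) (by omega)
      gcongr
    · rw [Finset.Nat.card_antidiagonal, nsmul_eq_mul]
      have h3 : ((k + 1 : ℕ) : ℝ) ≤ 6 := by exact_mod_cast (by omega : k + 1 ≤ 6)
      have : 0 ≤ b * R := by positivity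
      nlinarith
  refine (norm_sum_le _ _).trans ((Finset.sum_le_card_nsmul _ _ _ h1).trans (le_of_eq ?_))
  rw [nsmul_eq_mul]
  norm_num
  ring

lemma exists_totalCumulantSum_growth : ∃ K, 0 ≤ K ∧ ∀ u v ρ : ℝ, 0 ≤ ρ → u ^ 2 + v ^ 2 = ρ ^ 2 →
    ‖totalCumulantSum (1 / 2) u v‖ ≤ K * (1 + ρ) ^ 6 := by
  obtain ⟨K, hK0, hK⟩ := exists_totalCumulant_bound
  refine ⟨18 * K, by positivity, fun u v ρ hρ h => ?_⟩
  refine norm_cumulantForm_sum_le (c := fun i j => totalCumulant i j (1 / 2)) hK0 (by positivity)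
    (fun i j h3 h5 => (hK i j h3 h5 (1 / 2) le_rfl).1) fun i j _ h5 => ?_
  calc |u ^ i * v ^ j| ≤ ρ ^ (i + j) := abs_monomial_le hρ h i j
    _ ≤ (1 + ρ) ^ (i + j) := by gcongr; linarith
    _ ≤ (1 + ρ) ^ 6 := pow_le_pow_right₀ (by linarith) (by omega)

lemma exists_totalCumulantSum_bound : ∃ K, 0 ≤ K ∧ ∀ σ u v ρ : ℝ, 1 / 2 ≤ σ → 0 ≤ ρ → ρ ≤ 1 →
    u ^ 2 + v ^ 2 = ρ ^ 2 → ‖totalCumulantSum σ u v‖ ≤ K * ρ ^ 3 ∧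
      ‖totalCumulantSum σ u v - totalCumulantSum (1 / 2) u v‖ ≤ K * (σ - 1 / 2) := by
  obtain ⟨K, hK0, hK⟩ := exists_totalCumulant_bound
  refine ⟨18 * K, by positivity, fun σ u v ρ hσ hρ hρ1 h => ?_⟩
  have hmon : ∀ i j, 3 ≤ i + j → i + j ≤ 5 → |u ^ i * v ^ j| ≤ ρ ^ 3 := fun i j h3 _ =>
    (abs_monomial_le hρ h i j).trans (pow_le_pow_of_le_one hρ hρ1 h3)
  have hρ3 : 0 ≤ ρ ^ 3 := by positivity
  constructor
  · exact norm_cumulantForm_sum_le (c := fun i j => totalCumulant i j σ) hK0 hρ3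
      (fun i j h3 h5 => (hK i j h3 h5 σ hσ).1) hmon
  · have hσ0 : 0 ≤ σ - 1 / 2 := by linarith
    have h1 := norm_cumulantForm_sum_le
      (c := fun i j => totalCumulant i j σ - totalCumulant i j (1 / 2)) (b := K * (σ - 1 / 2))
      (by positivity) hρ3 (fun i j h3 h5 => (hK i j h3 h5 σ hσ).2) hmon
    have h2 : totalCumulantSum σ u v - totalCumulantSum (1 / 2) u v
        = ∑ k ∈ Finset.Icc 3 5, Complex.I ^ k * ((∑ m ∈ Finset.HasAntidiagonal.antidiagonal k,
          (totalCumulant m.1 m.2 σ - totalCumulant m.1 m.2 (1 / 2)) * (u ^ m.1 * v ^ m.2) : ℝ) : ℂ)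
        := by
      simp only [totalCumulantSum, totalCumulantForm]
      rw [← Finset.sum_sub_distrib]
      refine Finset.sum_congr rfl fun k _ => ?_
      rw [← mul_sub, ← Complex.ofReal_sub, ← Finset.sum_sub_distrib]
      simp only [sub_mul]
    rw [h2]
    refine h1.trans ?_
    have h3 : ρ ^ 3 ≤ 1 := pow_le_one₀ hρ hρ1
    have h4 : 0 ≤ 18 * (K * (σ - 1 / 2)) := by positivity
    nlinarith

/-- Here S is the cumulant part, of size ρ³, and E the error, of size ρ⁶ + (σ - 1/2). The quadratic
loss in S is thus of the same order ρ⁶, so the expansion can stop at the linear term. -/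
lemma norm_exp_add_sub_one_sub_le {S E : ℂ} {K : ℝ} (hS : ‖S‖ ≤ K) (hE : ‖E‖ ≤ K) :
    ‖Complex.exp (S + E) - (1 + S)‖ ≤ Real.exp (2 * K) * (‖E‖ + ‖S‖ ^ 2) := by
  have h1 := Complex.norm_exp_sub_sum_le_norm_mul_exp E 1
  have h2 := Complex.norm_exp_sub_sum_le_norm_mul_exp S 2
  simp only [Finset.sum_range_succ, Finset.sum_range_zero] at h1 h2
  norm_num at h1 h2
  have h3 : Complex.exp (S + E) - (1 + S)
      = Complex.exp S * (Complex.exp E - 1) + (Complex.exp S - (1 + S)) := by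
    rw [Complex.exp_add]; ring
  have hK : 0 ≤ K := (norm_nonneg _).trans hS
  have h4 : ‖Complex.exp S‖ ≤ Real.exp K :=
    (Complex.norm_exp_le_exp_norm S).trans (Real.exp_le_exp.2 hS)
  rw [h3]
  calc _ ≤ ‖Complex.exp S‖ * ‖Complex.exp E - 1‖ + ‖Complex.exp S - (1 + S)‖ := by
        rw [← norm_mul]; exact norm_add_le _ _
    _ ≤ Real.exp K * (‖E‖ * Real.exp K) + ‖S‖ ^ 2 * Real.exp (2 * K) := by
        gcongr
        · exact h1.trans (by gcongr)
        · refine h2.trans ?_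
          gcongr
          linarith
    _ = _ := by
        rw [two_mul, Real.exp_add]; ring

/-- Expansion of the characteristic function of `log ζ(σ, X)` near the origin. -/
lemma exists_charFun_expansion : ∃ K, 0 ≤ K ∧ ∀ (σ u v ρ : ℝ) (Φ : ℂ), 1 / 2 < σ → σ ≤ 3 / 2 →
    0 ≤ ρ → ρ ≤ 1 / 12 → u ^ 2 + v ^ 2 = ρ ^ 2 →
    Tendsto (fun N => ∏ p ∈ primesLT N, eulerCharFun (primeWeight σ p) u v) atTop (𝓝 Φ) →
    ‖Φ - (Real.exp (-(ρ ^ 2 * psi σ / 4)) : ℝ) * (1 + totalCumulantSum (1 / 2) u v)‖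
      ≤ K * Real.exp (-(ρ ^ 2 * psi σ / 4)) * (ρ ^ 6 + (σ - 1 / 2)) := by
  obtain ⟨K, hK0, hK⟩ := exists_totalCumulantSum_bound
  set A := 16 * 4 ^ 6 * ∑' p, primeWeight (1 / 2) p ^ 3 with hA
  have hA0 : 0 ≤ A := mul_nonneg (by norm_num)
    (tsum_nonneg fun p => pow_nonneg (primeWeight_pos _ p).le _)
  refine ⟨Real.exp (2 * (A + K)) * (A + K + K ^ 2), by positivity,
    fun σ u v ρ Φ hσ hσ2 hρ hρ2 h hΦ => ?_⟩
  have hx0 := fun p => (primeWeight_pos σ p).le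
  have hx := primeWeight_sq_le hσ.le
  -- The weights are below 5/7, and 4 · (1/12) · (5/7) = 5/21: this is what the range ρ ≤ 1/12 is
  -- for.
  have hs : ∀ p, 4 * ρ * primeWeight σ p ≤ 1 / 4 := fun p => by
    have := lt_of_sq_le_half (hx p)
    nlinarith [hx0 p]
  have hlog := fun p => norm_log_eulerCharFun_sub_le (hx0 p) (hx p) hρ h (hs p)
  set main : Nat.Primes → ℂ := fun p => ((-(ρ ^ 2 * eulerVar (primeWeight σ p) / 4) : ℝ) : ℂ)
      + eulerCumulantSum (primeWeight σ p) u v with hmain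
  have hmainsum : HasSum main (((-(ρ ^ 2 * psi σ / 4) : ℝ) : ℂ) + totalCumulantSum σ u v) :=
    (Complex.hasSum_ofReal.2 (((hasSum_psi hσ).mul_left (ρ ^ 2)).div_const 4).neg).add
      (hasSum_eulerCumulantSum hσ.le u v)
  have herr : ∀ p, ‖Complex.log (eulerCharFun (primeWeight σ p) u v) - main p‖
      ≤ 16 * 4 ^ 6 * ρ ^ 6 * primeWeight (1 / 2) p ^ 3 := by
    intro p
    refine (hlog p).2.trans ?_
    -- A summable majorant p^{-3/2} that does not depend on σ.
    have h1 : primeWeight σ p ^ 6 ≤ primeWeight (1 / 2) p ^ 3 := by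
      have h2 : primeWeight σ p ^ 6 ≤ primeWeight σ p ^ 3 :=
        pow_le_pow_of_le_one (hx0 p) (by linarith [lt_of_sq_le_half (hx p)]) (by norm_num)
      refine h2.trans ?_
      have := hx0 p
      gcongr
      exact primeWeight_anti hσ.le p
    calc 16 * (4 * ρ * primeWeight σ p) ^ 6 = 16 * 4 ^ 6 * ρ ^ 6 * primeWeight σ p ^ 6 := by ring
      _ ≤ _ := by gcongr
  have hbs : Summable fun p => 16 * 4 ^ 6 * ρ ^ 6 * primeWeight (1 / 2) p ^ 3 :=
    (summable_primeWeight_pow_three le_rfl).mul_left _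
  have hes := (Summable.of_norm_bounded hbs herr).hasSum
  set E := ∑' p, (Complex.log (eulerCharFun (primeWeight σ p) u v) - main p)
  have hE : ‖E‖ ≤ A * ρ ^ 6 := by
    refine (tsum_of_norm_bounded hbs.hasSum herr).trans (le_of_eq ?_)
    rw [tsum_mul_left, hA]
    ring
  have hlogsum := hmainsum.add hes
  simp only [add_sub_cancel] at hlogsum
  have hlim := (Complex.continuous_exp.tendsto _).comp (hlogsum.comp tendsto_primesLT)
  have hΦ' : Φ = Complex.exp (((-(ρ ^ 2 * psi σ / 4) : ℝ) : ℂ) + totalCumulantSum σ u v + E) := by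
    refine tendsto_nhds_unique hΦ (hlim.congr fun N => ?_)
    simp only [Function.comp_apply]
    rw [Complex.exp_sum]
    -- A vanishing factor would lie at distance 1 from 1, against the bound 1/4.
    refine Finset.prod_congr rfl fun p _ => Complex.exp_log fun h0 => ?_
    have := (hlog p).1
    rw [h0] at this
    norm_num at this
  obtain ⟨hS1, -⟩ := hK (1 / 2) u v ρ le_rfl hρ (by linarith) h
  obtain ⟨-, hS2⟩ := hK σ u v ρ hσ.le hρ (by linarith) h
  set S := totalCumulantSum (1 / 2) u v
  set E' := E + (totalCumulantSum σ u v - S) with hE'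
  have hp6 : ρ ^ 6 ≤ 1 := pow_le_one₀ hρ (by linarith)
  have hp3 : ρ ^ 3 ≤ 1 := pow_le_one₀ hρ (by linarith)
  have hE'n : ‖E'‖ ≤ A * ρ ^ 6 + K * (σ - 1 / 2) := (norm_add_le _ _).trans (add_le_add hE hS2)
  have hE'1 : ‖E'‖ ≤ A + K := by nlinarith
  have hS1' : ‖S‖ ≤ A + K := by nlinarith
  have hfin := norm_exp_add_sub_one_sub_le hS1' hE'1
  have hdec : Φ - (Real.exp (-(ρ ^ 2 * psi σ / 4)) : ℝ) * (1 + S)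
      = (Real.exp (-(ρ ^ 2 * psi σ / 4)) : ℝ) * (Complex.exp (S + E') - (1 + S)) := by
    rw [hΦ', mul_sub, Complex.ofReal_exp, ← Complex.exp_add, hE']
    congr 2
    ring
  rw [hdec, norm_mul, Complex.norm_real, Real.norm_of_nonneg (Real.exp_pos _).le]
  have hsq : ‖S‖ ^ 2 ≤ K ^ 2 * ρ ^ 6 := by
    calc ‖S‖ ^ 2 ≤ (K * ρ ^ 3) ^ 2 := by gcongr
      _ = _ := by ring
  have hsum : ‖E'‖ + ‖S‖ ^ 2 ≤ (A + K + K ^ 2) * (ρ ^ 6 + (σ - 1 / 2)) := by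
    have h1 : 0 ≤ ρ ^ 6 := by positivity
    have h2 : 0 ≤ σ - 1 / 2 := by linarith
    nlinarith [mul_nonneg hK0 h1, mul_nonneg hA0 h2, mul_nonneg (sq_nonneg K) h2]
  calc _ ≤ Real.exp (-(ρ ^ 2 * psi σ / 4)) * (Real.exp (2 * (A + K))
        * ((A + K + K ^ 2) * (ρ ^ 6 + (σ - 1 / 2)))) := by
        gcongr
        exact hfin.trans (by gcongr)
    _ = _ := by ring

/-! ### Decay of the characteristic function -/

/-- Comparison with the full harmonic sum is enough: a logarithm of ρ is affordable as long as ρ is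
at most a power of ψ. -/
lemma sum_prime_inv_le_of_le {M : ℝ} (hM : 0 ≤ M) (s : Finset Nat.Primes)
    (hs : ∀ p ∈ s, ((p : ℕ) : ℝ) ≤ M) :
    ∑ p ∈ s, (((p : ℕ) : ℝ))⁻¹ ≤ 1 + Real.log (1 + M) := by
  have h1 : ∑ p ∈ s, (((p : ℕ) : ℝ))⁻¹ ≤ ((harmonic ⌊M⌋₊ : ℚ) : ℝ) := by
    rw [harmonic_eq_sum_Icc]
    push_cast
    rw [← Finset.sum_image (s := s) (g := fun p : Nat.Primes => (p : ℕ))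
      (f := fun n : ℕ => ((n : ℝ))⁻¹) (fun p _ q _ h => Nat.Primes.coe_nat_injective h)]
    refine Finset.sum_le_sum_of_subset_of_nonneg (fun n hn => ?_) fun n _ _ => by positivity
    obtain ⟨p, hp, rfl⟩ := Finset.mem_image.1 hn
    exact Finset.mem_Icc.2 ⟨p.2.one_le, Nat.le_floor (hs p hp)⟩
  refine h1.trans ((harmonic_le_one_add_log _).trans ?_)
  rcases Nat.eq_zero_or_pos ⌊M⌋₊ with h0 | h0
  · rw [h0, Nat.cast_zero, Real.log_zero]
    linarith [Real.log_nonneg (by linarith : 1 ≤ 1 + M)]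
  · have := Nat.floor_le hM
    gcongr
    linarith

/-- Gaussian decay of the characteristic function of `log ζ(σ, X)`. -/
lemma exists_charFun_decay : ∃ D, ∀ (σ u v ρ : ℝ) (Φ : ℂ), 1 / 2 < σ →
    0 ≤ ρ → u ^ 2 + v ^ 2 = ρ ^ 2 →
    Tendsto (fun N => ∏ p ∈ primesLT N, eulerCharFun (primeWeight σ p) u v) atTop (𝓝 Φ) →
    ‖Φ‖ ≤ Real.exp (-(ρ ^ 2 / 8 * (psi σ - D - Real.log (1 + (512 * ρ) ^ 2)))) := by
  classical
  -- The series bounds the excess of ψ over ∑ p^{-2σ}; the 1 comes from the harmonic sum.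
  refine ⟨(∑' p, 2 * primeWeight (1 / 2) p ^ 4) + 1, fun σ u v ρ Φ hσ hρ h hΦ => ?_⟩
  have hx0 := fun p => (primeWeight_pos σ p).le
  have hx := primeWeight_sq_le hσ.le
  have hs4 : Summable fun p => 2 * primeWeight (1 / 2) p ^ 4 :=
    (summable_primeWeight_pow (by norm_num)).mul_left 2
  have hs2 : Summable fun p => primeWeight σ p ^ 2 :=
    summable_primeWeight_pow (by push_cast; linarith)
  have hpsi : psi σ ≤ (∑' p, primeWeight σ p ^ 2) + ∑' p, 2 * primeWeight (1 / 2) p ^ 4 := by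
    rw [← (hasSum_psi hσ).tsum_eq, ← hs2.tsum_add hs4]
    refine (summable_eulerVar hσ).tsum_le_tsum (fun p => ?_) (hs2.add hs4)
    refine (eulerVar_le_add (hx0 p) (hx p)).trans ?_
    have := hx0 p
    gcongr
    exact primeWeight_anti hσ.le p
  have hfin : ∀ N, ‖∏ p ∈ primesLT N, eulerCharFun (primeWeight σ p) u v‖
      ≤ Real.exp (-(ρ ^ 2 / 8 * (∑ p ∈ primesLT N, primeWeight σ p ^ 2
        - (1 + Real.log (1 + (512 * ρ) ^ 2))))) := by
    intro N
    -- Only primes with ρ p^{-σ} ≤ 1/512 contribute decay. The others satisfy p ≤ (512ρ)²; their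
    -- factors are bounded by 1, and the variance lost is logarithmic.
    set s := (primesLT N).filter fun p => ρ * primeWeight σ p ≤ 1 / 512
    set t := (primesLT N).filter fun p => ¬ ρ * primeWeight σ p ≤ 1 / 512
    have hsplit : ∑ p ∈ primesLT N, primeWeight σ p ^ 2
        = ∑ p ∈ s, primeWeight σ p ^ 2 + ∑ p ∈ t, primeWeight σ p ^ 2 :=
      (Finset.sum_filter_add_sum_filter_not _ _ _).symm
    have hcast : ∀ p : Nat.Primes, primeWeight (1 / 2) p ^ 2 = (((p : ℕ) : ℝ))⁻¹ := by
      intro p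
      rw [primeWeight_pow, ← Real.rpow_neg_one]
      norm_num
    have hle : ∀ p : Nat.Primes, primeWeight σ p ^ 2 ≤ (((p : ℕ) : ℝ))⁻¹ := by
      intro p
      rw [← hcast]
      have := hx0 p
      gcongr
      exact primeWeight_anti hσ.le p
    have ht : ∑ p ∈ t, primeWeight σ p ^ 2 ≤ 1 + Real.log (1 + (512 * ρ) ^ 2) := by
      refine (Finset.sum_le_sum fun p _ => hle p).trans
        (sum_prime_inv_le_of_le (by positivity) t fun p hp => ?_)
      have h1 : 1 / 512 < ρ * primeWeight σ p := not_le.1 (Finset.mem_filter.1 hp).2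
      have h2 : 1 < (512 * ρ) ^ 2 * primeWeight σ p ^ 2 := by
        rw [← mul_pow]
        exact one_lt_pow₀ (by linarith) (by norm_num)
      have h3 : 1 ≤ (512 * ρ) ^ 2 * (((p : ℕ) : ℝ))⁻¹ :=
        h2.le.trans (by gcongr; exact hle p)
      rwa [← div_eq_mul_inv, one_le_div (by linarith [two_le_prime p])] at h3
    have h1 : ‖∏ p ∈ primesLT N, eulerCharFun (primeWeight σ p) u v‖
        ≤ ∏ p ∈ s, Real.exp (-(ρ ^ 2 * primeWeight σ p ^ 2 / 8)) := by
      rw [norm_prod, ← Finset.prod_filter_mul_prod_filter_not (primesLT N)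
        (fun p => ρ * primeWeight σ p ≤ 1 / 512)]
      have h2 : ∏ p ∈ t, ‖eulerCharFun (primeWeight σ p) u v‖ ≤ 1 :=
        Finset.prod_le_one (fun p _ => norm_nonneg _) fun p _ => norm_eulerCharFun_le_one _ u v
      have h3 : ∏ p ∈ s, ‖eulerCharFun (primeWeight σ p) u v‖
          ≤ ∏ p ∈ s, Real.exp (-(ρ ^ 2 * primeWeight σ p ^ 2 / 8)) :=
        Finset.prod_le_prod (fun p _ => norm_nonneg _) fun p hp =>
          norm_eulerCharFun_le_exp (hx0 p) (hx p) hρ h (Finset.mem_filter.1 hp).2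
      refine (mul_le_of_le_one_right (Finset.prod_nonneg fun p _ => norm_nonneg _) h2).trans h3
    refine h1.trans ?_
    rw [← Real.exp_sum, Real.exp_le_exp, Finset.sum_neg_distrib, neg_le_neg_iff, ← Finset.sum_div,
      ← Finset.mul_sum, hsplit, mul_div_right_comm]
    gcongr
    linarith
  have hlim : Tendsto (fun N => Real.exp (-(ρ ^ 2 / 8 * (∑ p ∈ primesLT N, primeWeight σ p ^ 2
        - (1 + Real.log (1 + (512 * ρ) ^ 2)))))) atTop
      (𝓝 (Real.exp (-(ρ ^ 2 / 8 * ((∑' p, primeWeight σ p ^ 2)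
        - (1 + Real.log (1 + (512 * ρ) ^ 2))))))) := by
    have h1 : Tendsto (fun N => ∑ p ∈ primesLT N, primeWeight σ p ^ 2) atTop
      (𝓝 (∑' p, primeWeight σ p ^ 2)) := hs2.hasSum.comp tendsto_primesLT
    exact (Real.continuous_exp.tendsto _).comp ((h1.sub_const _).const_mul _).neg
  refine (le_of_tendsto_of_tendsto' hΦ.norm hlim hfin).trans ?_
  rw [Real.exp_le_exp, neg_le_neg_iff]
  refine mul_le_mul_of_nonneg_left ?_ (by positivity)
  linarith

/-! ### Gaussian kernels and smoothed indicators -/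

/-- The centred Gaussian density `δ⁻¹ exp (-π x² / δ²)`. -/
def gaussKernel (δ x : ℝ) : ℝ := δ⁻¹ * Real.exp (-(Real.pi * x ^ 2 / δ ^ 2))

@[fun_prop]
lemma continuous_gaussKernel (δ : ℝ) : Continuous (gaussKernel δ) := by
  unfold gaussKernel
  fun_prop

lemma gaussKernel_nonneg {δ : ℝ} (hδ : 0 < δ) (x : ℝ) : 0 ≤ gaussKernel δ x := by
  unfold gaussKernel
  positivity

lemma gaussKernel_le {δ : ℝ} (hδ : 0 < δ) (x : ℝ) : gaussKernel δ x ≤ δ⁻¹ := by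
  unfold gaussKernel
  refine mul_le_of_le_one_right (by positivity) (Real.exp_le_one_iff.2 ?_)
  have : 0 ≤ Real.pi * x ^ 2 / δ ^ 2 := by positivity
  linarith

lemma gaussKernel_eq (δ : ℝ) :
    gaussKernel δ = fun x => δ⁻¹ * Real.exp (-(Real.pi / δ ^ 2) * x ^ 2) := by
  ext x
  rw [gaussKernel]
  ring_nf

lemma integrable_gaussKernel {δ : ℝ} (hδ : 0 < δ) : Integrable (gaussKernel δ) := by
  rw [gaussKernel_eq]
  exact (integrable_exp_neg_mul_sq (by positivity)).const_mul _

lemma integral_gaussKernel {δ : ℝ} (hδ : 0 < δ) : ∫ x, gaussKernel δ x = 1 := by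
  rw [gaussKernel_eq, integral_const_mul, integral_gaussian, div_div_cancel₀ Real.pi_ne_zero,
    Real.sqrt_sq hδ.le, inv_mul_cancel₀ hδ.ne']

/-- Half of the exponent is spent on |x| ≥ η and the other half is integrated. With e^{-z} ≤ 1/z and
√2 ≤ 3/2 the constant is 3/π < 1. -/
lemma setIntegral_gaussKernel_le {δ η : ℝ} (hδ : 0 < δ) (hη : 0 < η) {S : Set ℝ}
    (hS : MeasurableSet S) (h : ∀ x ∈ S, η ≤ |x|) :
    ∫ x in S, gaussKernel δ x ≤ δ ^ 2 / η ^ 2 := by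
  have hi : Integrable fun x : ℝ => Real.exp (-(Real.pi * η ^ 2 / (2 * δ ^ 2)))
      * (δ⁻¹ * Real.exp (-(Real.pi / (2 * δ ^ 2)) * x ^ 2)) :=
    ((integrable_exp_neg_mul_sq (by positivity)).const_mul _).const_mul _
  have h1 : ∫ x in S, gaussKernel δ x ≤ ∫ x in S, Real.exp (-(Real.pi * η ^ 2 / (2 * δ ^ 2)))
      * (δ⁻¹ * Real.exp (-(Real.pi / (2 * δ ^ 2)) * x ^ 2)) := by
    refine setIntegral_mono_on (integrable_gaussKernel hδ).integrableOn hi.integrableOn hS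
      fun x hx => ?_
    rw [mul_left_comm, ← Real.exp_add, gaussKernel]
    gcongr
    have h2 : η ^ 2 ≤ x ^ 2 := by
      rw [← sq_abs x]
      have := h x hx
      gcongr
    have h3 : -(Real.pi * η ^ 2 / (2 * δ ^ 2)) + -(Real.pi / (2 * δ ^ 2)) * x ^ 2
      = -(Real.pi * x ^ 2 / δ ^ 2) + Real.pi / (2 * δ ^ 2) * (x ^ 2 - η ^ 2) := by
      field_simp
      ring
    rw [h3]
    have : 0 ≤ Real.pi / (2 * δ ^ 2) * (x ^ 2 - η ^ 2) :=
      mul_nonneg (by positivity) (by linarith)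
    linarith
  refine h1.trans ((setIntegral_le_integral hi (Eventually.of_forall fun x => by positivity)).trans
    ?_)
  rw [integral_const_mul, integral_const_mul, integral_gaussian]
  have h4 : Real.pi / (Real.pi / (2 * δ ^ 2)) = 2 * δ ^ 2 := div_div_cancel₀ Real.pi_ne_zero
  rw [h4, Real.sqrt_mul (by norm_num), Real.sqrt_sq hδ.le, mul_left_comm δ⁻¹,
    inv_mul_cancel₀ hδ.ne', mul_one]
  set z := Real.pi * η ^ 2 / (2 * δ ^ 2) with hz
  have hz0 : 0 < z := by positivity
  have h5 : Real.exp (-z) ≤ z⁻¹ := by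
    rw [Real.exp_neg]
    gcongr
    linarith [Real.add_one_le_exp z]
  have h6 : √2 ≤ 3 / 2 := by
    rw [Real.sqrt_le_left (by norm_num)]
    norm_num
  calc Real.exp (-z) * √2 ≤ z⁻¹ * (3 / 2) := by gcongr
    _ = δ ^ 2 / η ^ 2 * (3 / Real.pi) := by rw [hz]; field_simp
    _ ≤ δ ^ 2 / η ^ 2 := by
        refine mul_le_of_le_one_right (by positivity) ?_
        rw [div_le_one Real.pi_pos]
        exact Real.pi_gt_three.le

lemma gaussKernel_eq_fourier {δ : ℝ} (hδ : 0 < δ) (x : ℝ) :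
    ((gaussKernel δ x : ℝ) : ℂ) = ∫ s : ℝ, Complex.exp (-(2 * Real.pi * Complex.I * (s * x)))
      * Complex.exp (-(Real.pi * δ ^ 2 * s ^ 2)) := by
  have hb : 0 < ((δ : ℂ) ^ 2).re := by
    rw [← Complex.ofReal_pow, Complex.ofReal_re]
    positivity
  have h := congr_fun (fourier_gaussian_pi hb) x
  rw [Real.fourier_real_eq_integral_exp_smul] at h
  have h1 : ((δ : ℂ) ^ 2) ^ (1 / 2 : ℂ) = δ := by
    rw [← Complex.ofReal_pow]
    have : (1 / 2 : ℂ) = ((1 / 2 : ℝ) : ℂ) := by push_cast; rfl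
    rw [this, ← Complex.ofReal_cpow (by positivity), ← Real.sqrt_eq_rpow, Real.sqrt_sq hδ.le]
  rw [h1] at h
  rw [gaussKernel]
  push_cast
  refine Eq.trans ?_ (h.symm.trans ?_)
  · rw [one_div]
    congr 2
    ring
  · congr 1
    ext s
    rw [smul_eq_mul]
    congr 2
    · push_cast
      ring
    · ring

/-- Smoothing of the indicator function of `[a, b]`. -/
def smoothIndicator (δ a b u : ℝ) : ℝ := ∫ x in Set.Ioc a b, gaussKernel δ (x - u)

lemma smoothIndicator_eq (δ a b u : ℝ) :
    smoothIndicator δ a b u = ∫ x in Set.Ioc (a - u) (b - u), gaussKernel δ x := by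
  rw [smoothIndicator]
  have h : MeasurePreserving (fun x : ℝ => x - u) volume volume :=
    measurePreserving_sub_right volume u
  have := h.setIntegral_preimage_emb (measurableEmbedding_subRight u) (gaussKernel δ)
    (Set.Ioc (a - u) (b - u))
  rw [← this]
  congr 2
  ext x
  simp

lemma smoothIndicator_nonneg {δ : ℝ} (hδ : 0 < δ) (a b u : ℝ) : 0 ≤ smoothIndicator δ a b u :=
  integral_nonneg fun _ => gaussKernel_nonneg hδ _

lemma smoothIndicator_le_one {δ : ℝ} (hδ : 0 < δ) (a b u : ℝ) : smoothIndicator δ a b u ≤ 1 := by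
  rw [smoothIndicator_eq, ← integral_gaussKernel hδ]
  exact setIntegral_le_integral (integrable_gaussKernel hδ)
    (Eventually.of_forall fun x => gaussKernel_nonneg hδ x)

lemma smoothIndicator_le_of_notMem {δ η : ℝ} (hδ : 0 < δ) (hη : 0 < η) {a b u : ℝ}
    (h : u ∉ Set.Icc (a - η) (b + η)) : smoothIndicator δ a b u ≤ δ ^ 2 / η ^ 2 := by
  rw [smoothIndicator_eq]
  refine setIntegral_gaussKernel_le hδ hη measurableSet_Ioc fun x hx => ?_
  rw [le_abs]
  rw [Set.mem_Icc, not_and_or, not_le, not_le] at h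
  rcases h with h | h
  · left
    linarith [hx.1]
  · right
    linarith [hx.2]

lemma one_sub_le_smoothIndicator {δ η : ℝ} (hδ : 0 < δ) (hη : 0 < η) {a b u : ℝ}
    (h : u ∈ Set.Icc (a + η) (b - η)) : 1 - δ ^ 2 / η ^ 2 ≤ smoothIndicator δ a b u := by
  have h1 := integral_add_compl (measurableSet_Ioc (a := a - u) (b := b - u))
    (integrable_gaussKernel hδ)
  rw [integral_gaussKernel hδ] at h1
  have h2 := setIntegral_gaussKernel_le hδ hη
    (measurableSet_Ioc (a := a - u) (b := b - u)).compl fun x hx => by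
      rw [le_abs]
      rw [Set.mem_compl_iff, Set.mem_Ioc, not_and_or, not_lt, not_le] at hx
      rcases hx with hx | hx
      · right
        linarith [h.1]
      · left
        linarith [h.2]
  rw [smoothIndicator_eq]
  linarith

/-! ### Fourier inversion and the smoothing inequality -/

/-- The pairing phase `exp (2 π i (s x + t y))`. -/
def planeChar (ξ z : ℝ × ℝ) : ℂ :=
  Complex.exp (2 * Real.pi * Complex.I * ((ξ.1 * z.1 + ξ.2 * z.2 : ℝ) : ℂ))

lemma norm_planeChar (ξ z : ℝ × ℝ) : ‖planeChar ξ z‖ = 1 := by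
  have : 2 * Real.pi * Complex.I * ((ξ.1 * z.1 + ξ.2 * z.2 : ℝ) : ℂ)
      = ((2 * Real.pi * (ξ.1 * z.1 + ξ.2 * z.2) : ℝ) : ℂ) * Complex.I := by
    push_cast
    ring
  rw [planeChar, this, Complex.norm_exp_ofReal_mul_I]

@[fun_prop]
lemma Continuous.planeChar {α : Type*} [TopologicalSpace α] {f g : α → ℝ × ℝ} (hf : Continuous f)
    (hg : Continuous g) : Continuous fun a => planeChar (f a) (g a) := by
  unfold _root_.planeChar
  fun_prop

/-- The Fourier transform of a measure on the plane. -/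
def planeCharFun (μ : Measure (ℝ × ℝ)) (ξ : ℝ × ℝ) : ℂ := ∫ q, planeChar ξ q ∂μ

/-- The density of the convolution of `μ` with a centred Gaussian. -/
def smoothDensity (μ : Measure (ℝ × ℝ)) (δ : ℝ) (z : ℝ × ℝ) : ℝ :=
  ∫ q, gaussKernel δ (z.1 - q.1) * gaussKernel δ (z.2 - q.2) ∂μ

/-- The Gaussian weight `exp (-π δ² (s² + t²))`. -/
def planeGauss (δ : ℝ) (ξ : ℝ × ℝ) : ℝ := Real.exp (-(Real.pi * δ ^ 2 * (ξ.1 ^ 2 + ξ.2 ^ 2)))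

@[fun_prop]
lemma continuous_planeGauss (δ : ℝ) : Continuous (planeGauss δ) := by
  unfold planeGauss
  fun_prop

lemma planeGauss_eq (δ : ℝ) (ξ : ℝ × ℝ) :
    planeGauss δ ξ = Real.exp (-(Real.pi * δ ^ 2) * ξ.1 ^ 2)
      * Real.exp (-(Real.pi * δ ^ 2) * ξ.2 ^ 2) := by
  rw [planeGauss, ← Real.exp_add]
  ring_nf

lemma planeGauss_pos (δ : ℝ) (ξ : ℝ × ℝ) : 0 < planeGauss δ ξ := Real.exp_pos _

lemma integrable_planeGauss {δ : ℝ} (hδ : 0 < δ) : Integrable (planeGauss δ) := by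
  have h := integrable_exp_neg_mul_sq (b := Real.pi * δ ^ 2) (by positivity)
  exact (h.mul_prod h).congr (Eventually.of_forall fun ξ => (planeGauss_eq δ ξ).symm)

lemma gaussKernel_mul_eq_integral {δ : ℝ} (hδ : 0 < δ) (z q : ℝ × ℝ) :
    ((gaussKernel δ (z.1 - q.1) * gaussKernel δ (z.2 - q.2) : ℝ) : ℂ)
      = ∫ ξ : ℝ × ℝ, planeChar (-ξ) z * planeGauss δ ξ * planeChar ξ q := by
  rw [Complex.ofReal_mul, gaussKernel_eq_fourier hδ, gaussKernel_eq_fourier hδ,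
    ← integral_prod_mul]
  refine integral_congr_ae (Eventually.of_forall fun ξ => ?_)
  simp only [planeChar, planeGauss]
  rw [Complex.ofReal_exp, ← Complex.exp_add, ← Complex.exp_add, ← Complex.exp_add,
    ← Complex.exp_add, ← Complex.exp_add]
  congr 1
  push_cast
  simp only [Prod.fst_neg, Prod.snd_neg]
  push_cast
  ring

lemma smoothDensity_eq_integral (μ : Measure (ℝ × ℝ)) [IsProbabilityMeasure μ] {δ : ℝ}
    (hδ : 0 < δ) (z : ℝ × ℝ) :
    ((smoothDensity μ δ z : ℝ) : ℂ)
      = ∫ ξ : ℝ × ℝ, planeChar (-ξ) z * (planeCharFun μ ξ * planeGauss δ ξ) := by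
  rw [smoothDensity, ← integral_complex_ofReal]
  simp_rw [gaussKernel_mul_eq_integral hδ z]
  rw [integral_integral_swap]
  · refine integral_congr_ae (Eventually.of_forall fun ξ => ?_)
    simp only [planeCharFun]
    rw [integral_const_mul]
    ring
  · have hc : Continuous (Function.uncurry fun (q ξ : ℝ × ℝ) =>
        planeChar (-ξ) z * planeGauss δ ξ * planeChar ξ q) := by
      unfold Function.uncurry
      fun_prop
    refine Integrable.mono' (g := fun w : (ℝ × ℝ) × (ℝ × ℝ) => 1 * planeGauss δ w.2) ?_
      hc.aestronglyMeasurable (Eventually.of_forall fun w => ?_)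
    · exact (integrable_const (1 : ℝ)).mul_prod (integrable_planeGauss hδ)
    · simp only [Function.uncurry]
      rw [norm_mul, norm_mul, norm_planeChar, norm_planeChar, Complex.norm_real,
        Real.norm_of_nonneg (planeGauss_pos _ _).le, mul_one]

/-- Fourier inversion bounds the difference of densities by the L¹ distance of their transforms; the
weight integrates to π². -/
lemma abs_smoothDensity_sub_le (μ : Measure (ℝ × ℝ)) [IsProbabilityMeasure μ] {δ ε : ℝ}
    (hδ : 0 < δ) {G : ℝ × ℝ → ℝ} {H : ℝ × ℝ → ℂ} (hH : Integrable H)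
    (hG : ∀ z, ((G z : ℝ) : ℂ) = ∫ ξ, planeChar (-ξ) z * H ξ)
    (hε : ∀ ξ, ‖planeCharFun μ ξ * planeGauss δ ξ - H ξ‖
      ≤ ε * ((1 + ξ.1 ^ 2)⁻¹ * (1 + ξ.2 ^ 2)⁻¹)) (z : ℝ × ℝ) :
    |smoothDensity μ δ z - G z| ≤ ε * Real.pi ^ 2 := by
  have hcf : AEStronglyMeasurable (planeCharFun μ) (volume : Measure (ℝ × ℝ)) := by
    have hc : Continuous (Function.uncurry planeChar) := by
      unfold Function.uncurry
      fun_prop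
    exact (hc.stronglyMeasurable.integral_prod_right (ν := μ)).aestronglyMeasurable
  have hcf1 : ∀ ξ, ‖planeCharFun μ ξ‖ ≤ 1 := fun ξ =>
    (norm_integral_le_of_norm_le_const (C := 1)
      (Eventually.of_forall fun q => (norm_planeChar ξ q).le)).trans (by simp)
  have hint1 : Integrable fun ξ => planeCharFun μ ξ * (planeGauss δ ξ : ℂ) := by
    refine (integrable_planeGauss hδ).mono'
      (hcf.mul (Complex.continuous_ofReal.comp (continuous_planeGauss δ)).aestronglyMeasurable)
      (Eventually.of_forall fun ξ => ?_)
    rw [norm_mul, Complex.norm_real, Real.norm_of_nonneg (planeGauss_pos _ _).le]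
    exact mul_le_of_le_one_left (planeGauss_pos _ _).le (hcf1 ξ)
  have hph : ∀ F : ℝ × ℝ → ℂ, Integrable F → Integrable fun ξ => planeChar (-ξ) z * F ξ := by
    intro F hF
    have hc : Continuous fun ξ => planeChar (-ξ) z := by fun_prop
    exact hF.bdd_mul (c := 1) hc.aestronglyMeasurable
      (Eventually.of_forall fun ξ => (norm_planeChar _ z).le)
  have hw : Integrable fun ξ : ℝ × ℝ => (1 + ξ.1 ^ 2)⁻¹ * (1 + ξ.2 ^ 2)⁻¹ :=
    integrable_inv_one_add_sq.mul_prod integrable_inv_one_add_sq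
  have hwi : ∫ ξ : ℝ × ℝ, (1 + ξ.1 ^ 2)⁻¹ * (1 + ξ.2 ^ 2)⁻¹ = Real.pi ^ 2 := by
    rw [sq, ← integral_univ_inv_one_add_sq]
    exact integral_prod_mul (fun x : ℝ => (1 + x ^ 2)⁻¹) fun x : ℝ => (1 + x ^ 2)⁻¹
  rw [← Real.norm_eq_abs, ← Complex.norm_real, Complex.ofReal_sub, smoothDensity_eq_integral μ hδ,
    hG, ← integral_sub (hph _ hint1) (hph _ hH), ← hwi, ← integral_const_mul]
  refine norm_integral_le_of_norm_le (hw.const_mul ε) (Eventually.of_forall fun ξ => ?_)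
  rw [← mul_sub, norm_mul, norm_planeChar, one_mul]
  exact hε ξ

lemma continuous_smoothDensity_integrand (δ : ℝ) :
    Continuous fun w : (ℝ × ℝ) × (ℝ × ℝ) =>
      gaussKernel δ (w.1.1 - w.2.1) * gaussKernel δ (w.1.2 - w.2.2) := by fun_prop

lemma integrable_smoothDensity_integrand (μ : Measure (ℝ × ℝ)) [IsProbabilityMeasure μ] {δ : ℝ}
    (hδ : 0 < δ) (ν : Measure (ℝ × ℝ)) [IsFiniteMeasure ν] :
    Integrable (fun w : (ℝ × ℝ) × (ℝ × ℝ) =>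
      gaussKernel δ (w.1.1 - w.2.1) * gaussKernel δ (w.1.2 - w.2.2)) (ν.prod μ) := by
  refine Integrable.of_bound (continuous_smoothDensity_integrand δ).aestronglyMeasurable
    (δ⁻¹ * δ⁻¹) (Eventually.of_forall fun w => ?_)
  have h1 := gaussKernel_nonneg hδ (w.1.1 - w.2.1)
  have h2 := gaussKernel_nonneg hδ (w.1.2 - w.2.2)
  rw [Real.norm_of_nonneg (by positivity)]
  gcongr
  · exact gaussKernel_le hδ _
  · exact gaussKernel_le hδ _

lemma isFiniteMeasure_restrict_rectangle (a b c d : ℝ) :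
    IsFiniteMeasure ((volume : Measure (ℝ × ℝ)).restrict (Set.Ioc a b ×ˢ Set.Ioc c d)) := by
  refine ⟨?_⟩
  rw [Measure.restrict_apply_univ, Measure.volume_eq_prod, Measure.prod_prod]
  exact ENNReal.mul_lt_top (by simp) (by simp)

lemma setIntegral_smoothDensity (μ : Measure (ℝ × ℝ)) [IsProbabilityMeasure μ] {δ : ℝ}
    (hδ : 0 < δ) (a b c d : ℝ) :
    ∫ z in Set.Ioc a b ×ˢ Set.Ioc c d, smoothDensity μ δ z
      = ∫ q, smoothIndicator δ a b q.1 * smoothIndicator δ c d q.2 ∂μ := by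
  have := isFiniteMeasure_restrict_rectangle a b c d
  simp only [smoothDensity]
  rw [integral_integral_swap (integrable_smoothDensity_integrand μ hδ _)]
  refine integral_congr_ae (Eventually.of_forall fun q => ?_)
  exact setIntegral_prod_mul (fun x => gaussKernel δ (x - q.1)) (fun y => gaussKernel δ (y - q.2))
    (Set.Ioc a b) (Set.Ioc c d)

lemma integrable_smoothDensity (μ : Measure (ℝ × ℝ)) [IsProbabilityMeasure μ] {δ : ℝ}
    (hδ : 0 < δ) (a b c d : ℝ) :
    IntegrableOn (smoothDensity μ δ) (Set.Ioc a b ×ˢ Set.Ioc c d) := by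
  have := isFiniteMeasure_restrict_rectangle a b c d
  exact (integrable_smoothDensity_integrand μ hδ
    ((volume : Measure (ℝ × ℝ)).restrict (Set.Ioc a b ×ˢ Set.Ioc c d))).integral_prod_left

lemma measureReal_rectangle {a b c d : ℝ} (hab : a ≤ b) (hcd : c ≤ d) :
    (volume : Measure (ℝ × ℝ)).real (Set.Ioc a b ×ˢ Set.Ioc c d) = (b - a) * (d - c) := by
  rw [Measure.volume_eq_prod, measureReal_prod_prod]
  simp [hab, hcd]

lemma integrableOn_rectangle {G : ℝ × ℝ → ℝ} (hG : Continuous G) (a b c d : ℝ) :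
    IntegrableOn G (Set.Ioc a b ×ˢ Set.Ioc c d) :=
  (hG.continuousOn.integrableOn_compact (isCompact_Icc.prod isCompact_Icc)).mono_set
    (Set.prod_mono Set.Ioc_subset_Icc_self Set.Ioc_subset_Icc_self)

lemma measure_rectangle_lt_top (a b c d : ℝ) :
    (volume : Measure (ℝ × ℝ)) (Set.Ioc a b ×ˢ Set.Ioc c d) < ⊤ := by
  rw [Measure.volume_eq_prod, Measure.prod_prod]
  exact ENNReal.mul_lt_top (by simp) (by simp)

lemma abs_setIntegral_rectangle_sub_le {f G : ℝ × ℝ → ℝ} {κ a b c d : ℝ} (hab : a ≤ b)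
    (hcd : c ≤ d) (hf : IntegrableOn f (Set.Ioc a b ×ˢ Set.Ioc c d))
    (hG : IntegrableOn G (Set.Ioc a b ×ˢ Set.Ioc c d)) (h : ∀ z, |f z - G z| ≤ κ) :
    |(∫ z in Set.Ioc a b ×ˢ Set.Ioc c d, f z) - ∫ z in Set.Ioc a b ×ˢ Set.Ioc c d, G z|
      ≤ κ * ((b - a) * (d - c)) := by
  rw [← integral_sub hf hG, ← measureReal_rectangle hab hcd, ← Real.norm_eq_abs]
  exact norm_setIntegral_le_of_norm_le_const (measure_rectangle_lt_top a b c d) fun z _ => h z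

lemma abs_setIntegral_rectangle_enlarge_le {G : ℝ × ℝ → ℝ} (hG : Continuous G) {M : ℝ}
    (hM : ∀ z, |G z| ≤ M) {a b c d a' b' c' d' : ℝ} (hab : a ≤ b) (hcd : c ≤ d) (ha : a' ≤ a)
    (hb : b ≤ b') (hc : c' ≤ c) (hd : d ≤ d') :
    |(∫ z in Set.Ioc a' b' ×ˢ Set.Ioc c' d', G z) - ∫ z in Set.Ioc a b ×ˢ Set.Ioc c d, G z|
      ≤ M * ((b' - a') * (d' - c') - (b - a) * (d - c)) := by
  have hm : MeasurableSet (Set.Ioc a b ×ˢ Set.Ioc c d) := measurableSet_Ioc.prod measurableSet_Ioc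
  have hsub : Set.Ioc a b ×ˢ Set.Ioc c d ⊆ Set.Ioc a' b' ×ˢ Set.Ioc c' d' :=
    Set.prod_mono (Set.Ioc_subset_Ioc ha hb) (Set.Ioc_subset_Ioc hc hd)
  have hfin := measure_rectangle_lt_top a' b' c' d'
  rw [← setIntegral_sdiff hm (integrableOn_rectangle hG a' b' c' d') hsub,
    ← measureReal_rectangle hab hcd, ← measureReal_rectangle (by linarith) (by linarith),
    ← measureReal_sdiff hsub hm hfin.ne, ← Real.norm_eq_abs]
  exact norm_setIntegral_le_of_norm_le_const
    ((measure_mono Set.sdiff_subset).trans_lt hfin) fun z _ => hM z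

/-- A Fourier-analytic smoothing inequality for the measure of a rectangle. -/
lemma abs_measureReal_rectangle_sub_le (μ : Measure (ℝ × ℝ)) [IsProbabilityMeasure μ]
    {δ ε η M a b c d : ℝ} (hδ : 0 < δ) (hη : 0 < η) (hη1 : η ≤ 1) (hM0 : 0 ≤ M)
    (hab : 2 * η ≤ b - a) (hcd : 2 * η ≤ d - c) {G : ℝ × ℝ → ℝ} {H : ℝ × ℝ → ℂ}
    (hGc : Continuous G) (hM : ∀ z, |G z| ≤ M) (hH : Integrable H)
    (hG : ∀ z, ((G z : ℝ) : ℂ) = ∫ ξ, planeChar (-ξ) z * H ξ)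
    (hε : ∀ ξ, ‖planeCharFun μ ξ * planeGauss δ ξ - H ξ‖
      ≤ ε * ((1 + ξ.1 ^ 2)⁻¹ * (1 + ξ.2 ^ 2)⁻¹)) :
    |μ.real (Set.Icc a b ×ˢ Set.Icc c d) - ∫ z in Set.Ioc a b ×ˢ Set.Ioc c d, G z|
      ≤ ε * Real.pi ^ 2 * ((b - a + 2) * (d - c + 2)) + 2 * (δ ^ 2 / η ^ 2)
        + M * η * (2 * (b - a + (d - c)) + 4) := by
  set R := Set.Icc a b ×ˢ Set.Icc c d with hR
  have hRm : MeasurableSet R := measurableSet_Icc.prod measurableSet_Icc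
  set τ := δ ^ 2 / η ^ 2 with hτ
  have hτ0 : 0 ≤ τ := by positivity
  have hεp := abs_smoothDensity_sub_le μ hδ hH hG hε
  have hε0 : 0 ≤ ε := by
    have := (norm_nonneg _).trans (hε 0)
    simpa using this
  have hind : ∫ q, R.indicator (fun _ => (1 : ℝ)) q ∂μ = μ.real R := by
    rw [integral_indicator_const _ hRm]
    simp
  have hindi : Integrable (R.indicator fun _ => (1 : ℝ)) μ := (integrable_const 1).indicator hRm
  have hsi : ∀ a b c d : ℝ, Integrable
      (fun q : ℝ × ℝ => smoothIndicator δ a b q.1 * smoothIndicator δ c d q.2) μ := by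
    intro a b c d
    have := isFiniteMeasure_restrict_rectangle a b c d
    have h := (integrable_smoothDensity_integrand μ hδ
      ((volume : Measure (ℝ × ℝ)).restrict (Set.Ioc a b ×ˢ Set.Ioc c d))).integral_prod_right
    refine h.congr (Eventually.of_forall fun q => ?_)
    exact setIntegral_prod_mul (fun x => gaussKernel δ (x - q.1))
      (fun y => gaussKernel δ (y - q.2)) (Set.Ioc a b) (Set.Ioc c d)
  have h0 := fun a b u => smoothIndicator_nonneg hδ a b u
  have h1 := fun a b u => smoothIndicator_le_one hδ a b u
  -- On R both smoothed indicators of the enlarged sides are at least 1 - τ, so their product is at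
  -- least 1 - 2τ.
  have hup : μ.real R ≤ (∫ z in Set.Ioc (a - η) (b + η) ×ˢ Set.Ioc (c - η) (d + η),
      smoothDensity μ δ z) + 2 * τ := by
    rw [setIntegral_smoothDensity μ hδ, ← hind]
    have h2 : ∫ q, R.indicator (fun _ => (1 : ℝ)) q ∂μ
        ≤ ∫ q : ℝ × ℝ, (smoothIndicator δ (a - η) (b + η) q.1
          * smoothIndicator δ (c - η) (d + η) q.2 + 2 * τ) ∂μ := by
      refine integral_mono hindi ((hsi _ _ _ _).add (integrable_const _)) fun q => ?_
      have hx := h0 (a - η) (b + η) q.1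
      have hy := h0 (c - η) (d + η) q.2
      by_cases hq : q ∈ R
      · rw [Set.indicator_of_mem hq]
        have hx1 := h1 (a - η) (b + η) q.1
        have hy1 := h1 (c - η) (d + η) q.2
        have hx2 := one_sub_le_smoothIndicator hδ hη (a := a - η) (b := b + η) (u := q.1)
          (by simpa using hq.1)
        have hy2 := one_sub_le_smoothIndicator hδ hη (a := c - η) (b := d + η) (u := q.2)
          (by simpa using hq.2)
        nlinarith [mul_nonneg (sub_nonneg.2 hx1) (sub_nonneg.2 hy1)]
      · rw [Set.indicator_of_notMem hq]
        positivity
    rw [integral_add (hsi _ _ _ _) (integrable_const _)] at h2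
    simpa using h2
  -- Outside R one of the two smoothed indicators of the shrunken sides is at most τ, and the other
  -- is at most 1.
  have hlow : (∫ z in Set.Ioc (a + η) (b - η) ×ˢ Set.Ioc (c + η) (d - η),
      smoothDensity μ δ z) - τ ≤ μ.real R := by
    rw [setIntegral_smoothDensity μ hδ, ← hind]
    have h2 : ∫ q : ℝ × ℝ, smoothIndicator δ (a + η) (b - η) q.1
          * smoothIndicator δ (c + η) (d - η) q.2 ∂μ
        ≤ ∫ q, (R.indicator (fun _ => (1 : ℝ)) q + τ) ∂μ := by
      refine integral_mono (hsi _ _ _ _) (hindi.add (integrable_const _)) fun q => ?_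
      have hx := h0 (a + η) (b - η) q.1
      have hy := h0 (c + η) (d - η) q.2
      have hx1 := h1 (a + η) (b - η) q.1
      have hy1 := h1 (c + η) (d - η) q.2
      by_cases hq : q ∈ R
      · simp only [Set.indicator_of_mem hq]
        nlinarith
      · simp only [Set.indicator_of_notMem hq, zero_add]
        rw [hR, Set.mem_prod, not_and_or] at hq
        rcases hq with hq | hq
        · have := smoothIndicator_le_of_notMem hδ hη (a := a + η) (b := b - η) (u := q.1)
            (by simpa using hq)
          nlinarith
        · have := smoothIndicator_le_of_notMem hδ hη (a := c + η) (b := d - η) (u := q.2)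
            (by simpa using hq)
          nlinarith
    rw [integral_add hindi (integrable_const _)] at h2
    simp only [integral_const, probReal_univ, smul_eq_mul, one_mul] at h2
    linarith
  have e1 := (abs_le.1 (abs_setIntegral_rectangle_sub_le (a := a - η) (b := b + η) (c := c - η)
    (d := d + η) (by linarith) (by linarith) (integrable_smoothDensity μ hδ _ _ _ _)
    (integrableOn_rectangle hGc _ _ _ _) hεp)).2
  have e2 := (abs_le.1 (abs_setIntegral_rectangle_sub_le (a := a + η) (b := b - η) (c := c + η)
    (d := d - η) (by linarith) (by linarith) (integrable_smoothDensity μ hδ _ _ _ _)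
    (integrableOn_rectangle hGc _ _ _ _) hεp)).1
  have e3 := (abs_le.1 (abs_setIntegral_rectangle_enlarge_le hGc hM (a := a) (b := b) (c := c)
    (d := d) (a' := a - η) (b' := b + η) (c' := c - η) (d' := d + η) (by linarith) (by linarith)
    (by linarith) (by linarith) (by linarith) (by linarith))).2
  have e4 := (abs_le.1 (abs_setIntegral_rectangle_enlarge_le hGc hM (a := a + η) (b := b - η)
    (c := c + η) (d := d - η) (a' := a) (b' := b) (c' := c) (d' := d) (by linarith) (by linarith)
    (by linarith) (by linarith) (by linarith) (by linarith))).2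
  have hεπ : 0 ≤ ε * Real.pi ^ 2 := by positivity
  have f1 : ε * Real.pi ^ 2 * ((b + η - (a - η)) * (d + η - (c - η)))
      ≤ ε * Real.pi ^ 2 * ((b - a + 2) * (d - c + 2)) := by
    gcongr <;> linarith
  have f2 : ε * Real.pi ^ 2 * ((b - η - (a + η)) * (d - η - (c + η)))
      ≤ ε * Real.pi ^ 2 * ((b - a + 2) * (d - c + 2)) := by
    gcongr <;> linarith
  have f3 : M * ((b + η - (a - η)) * (d + η - (c - η)) - (b - a) * (d - c))
      ≤ M * η * (2 * (b - a + (d - c)) + 4) := by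
    rw [mul_assoc]
    gcongr
    nlinarith
  have f4 : M * ((b - a) * (d - c) - (b - η - (a + η)) * (d - η - (c + η)))
      ≤ M * η * (2 * (b - a + (d - c)) + 4) := by
    rw [mul_assoc]
    gcongr
    nlinarith
  rw [abs_le]
  constructor <;> linarith

/-! ### Hermite polynomials and the Edgeworth density -/

/-- The Hermite polynomials attached to `exp (-π x²)`:
`(-d/dx)ⁿ exp (-π x²) = hermitePi n x * exp (-π x²)`. -/
def hermitePi : ℕ → Polynomial ℝ
  | 0 => 1
  | n + 1 => Polynomial.C (2 * Real.pi) * Polynomial.X * hermitePi n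
      - Polynomial.derivative (hermitePi n)

lemma natDegree_hermitePi_le (n : ℕ) : (hermitePi n).natDegree ≤ n := by
  induction n with
  | zero => simp [hermitePi]
  | succ n ih =>
    rw [hermitePi]
    refine (Polynomial.natDegree_sub_le _ _).trans (max_le ?_ ?_)
    · refine Polynomial.natDegree_mul_le.trans ?_
      have h1 := Polynomial.natDegree_C_mul_le (2 * Real.pi) (Polynomial.X : Polynomial ℝ)
      have h2 := Polynomial.natDegree_X_le (R := ℝ)
      omega
    · have := Polynomial.natDegree_derivative_le (hermitePi n)
      omega

lemma integrable_pow_mul_exp_neg_pi (n : ℕ) :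
    Integrable fun s : ℝ => s ^ n * Real.exp (-Real.pi * s ^ 2) := by
  have := integrable_rpow_mul_exp_neg_mul_sq (b := Real.pi) Real.pi_pos (s := n)
    (by linarith [(Nat.cast_nonneg n : (0 : ℝ) ≤ n)])
  simpa only [Real.rpow_natCast] using this

lemma integrable_ofReal_pow_mul_exp_neg_pi (n : ℕ) :
    Integrable fun s : ℝ => ((s ^ n * Real.exp (-Real.pi * s ^ 2) : ℝ) : ℂ) :=
  (integrable_pow_mul_exp_neg_pi n).ofReal

/-- The function `(2 π i s)ⁿ exp (-π s²)`. -/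
def monomialGauss (n : ℕ) (s : ℝ) : ℂ :=
  (2 * Real.pi * Complex.I * s) ^ n * (Real.exp (-Real.pi * s ^ 2) : ℝ)

lemma integrable_monomialGauss (n : ℕ) : Integrable (monomialGauss n) := by
  refine ((integrable_ofReal_pow_mul_exp_neg_pi n).const_mul
    ((2 * Real.pi * Complex.I) ^ n)).congr (Eventually.of_forall fun s => ?_)
  simp only [monomialGauss, mul_pow]
  push_cast
  ring

/-- Differentiating the Fourier integral in x brings down -2πis, while -d/dx acts on a polynomial
times the Gaussian by the recursion defining `hermitePi`. -/
lemma fourier_monomialGauss (n : ℕ) (x : ℝ) :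
    FourierTransform.fourier (monomialGauss n) x
      = (((hermitePi n).eval x * Real.exp (-Real.pi * x ^ 2) : ℝ) : ℂ) := by
  induction n generalizing x with
  | zero =>
    have h := congr_fun (fourier_gaussian_pi (b := 1) (by simp)) x
    have h0 : monomialGauss 0 = fun s : ℝ => Complex.exp (-Real.pi * 1 * s ^ 2) := by
      ext s
      simp [monomialGauss]
    rw [h0, h]
    simp [hermitePi]
  | succ n ih =>
    have hint : Integrable fun s : ℝ => s • monomialGauss n s := by
      refine ((integrable_ofReal_pow_mul_exp_neg_pi (n + 1)).const_mul
        ((2 * Real.pi * Complex.I) ^ n)).congr (Eventually.of_forall fun s => ?_)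
      simp only [monomialGauss, mul_pow, Complex.real_smul]
      push_cast
      ring
    have h1 := Real.hasDerivAt_fourier (integrable_monomialGauss n) hint x
    have h2 : (fun s : ℝ => (-2 * Real.pi * Complex.I * s) • monomialGauss n s)
        = fun s => -monomialGauss (n + 1) s := by
      ext s
      simp only [monomialGauss, smul_eq_mul]
      ring
    have h3 : FourierTransform.fourier (fun s => -monomialGauss (n + 1) s) x
        = -FourierTransform.fourier (monomialGauss (n + 1)) x := by
      rw [Real.fourier_real_eq_integral_exp_smul, Real.fourier_real_eq_integral_exp_smul,
        ← integral_neg]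
      simp only [smul_neg]
    rw [h2, h3] at h1
    have hfun : FourierTransform.fourier (monomialGauss n)
        = fun x : ℝ => (((hermitePi n).eval x * Real.exp (-Real.pi * x ^ 2) : ℝ) : ℂ) :=
      funext ih
    rw [hfun] at h1
    have h4 : HasDerivAt (fun x : ℝ => (hermitePi n).eval x * Real.exp (-Real.pi * x ^ 2))
        ((hermitePi n).derivative.eval x * Real.exp (-Real.pi * x ^ 2)
          + (hermitePi n).eval x * (Real.exp (-Real.pi * x ^ 2) * (-Real.pi * (2 * x)))) x := by
      refine ((hermitePi n).hasDerivAt x).mul (HasDerivAt.exp ?_)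
      simpa using (hasDerivAt_pow 2 x).const_mul (-Real.pi)
    have h5 := h1.unique h4.ofReal_comp
    rw [neg_eq_iff_eq_neg] at h5
    rw [h5, ← Complex.ofReal_neg, hermitePi]
    congr 1
    simp only [Polynomial.eval_sub, Polynomial.eval_mul, Polynomial.eval_C, Polynomial.eval_X]
    ring

lemma integral_planeChar_mul_monomialGauss (i j : ℕ) (z : ℝ × ℝ) :
    ∫ ξ : ℝ × ℝ, planeChar (-ξ) z * (monomialGauss i ξ.1 * monomialGauss j ξ.2)
      = (((hermitePi i).eval z.1 * (hermitePi j).eval z.2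
        * Real.exp (-Real.pi * (z.1 ^ 2 + z.2 ^ 2)) : ℝ) : ℂ) := by
  have h1 := fourier_monomialGauss i z.1
  have h2 := fourier_monomialGauss j z.2
  rw [Real.fourier_real_eq_integral_exp_smul] at h1 h2
  have h3 : Real.exp (-Real.pi * (z.1 ^ 2 + z.2 ^ 2))
      = Real.exp (-Real.pi * z.1 ^ 2) * Real.exp (-Real.pi * z.2 ^ 2) := by
    rw [← Real.exp_add]
    ring_nf
  have h4 : (((hermitePi i).eval z.1 * (hermitePi j).eval z.2
        * Real.exp (-Real.pi * (z.1 ^ 2 + z.2 ^ 2)) : ℝ) : ℂ)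
      = (((hermitePi i).eval z.1 * Real.exp (-Real.pi * z.1 ^ 2) : ℝ) : ℂ)
        * (((hermitePi j).eval z.2 * Real.exp (-Real.pi * z.2 ^ 2) : ℝ) : ℂ) := by
    rw [h3]
    push_cast
    ring
  rw [h4, ← h1, ← h2, ← integral_prod_mul]
  refine integral_congr_ae (Eventually.of_forall fun ξ => ?_)
  have h5 : planeChar (-ξ) z = Complex.exp (((-2 * Real.pi * ξ.1 * z.1 : ℝ) : ℂ) * Complex.I)
      * Complex.exp (((-2 * Real.pi * ξ.2 * z.2 : ℝ) : ℂ) * Complex.I) := by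
    rw [planeChar, ← Complex.exp_add]
    congr 1
    push_cast
    simp only [Prod.fst_neg, Prod.snd_neg]
    push_cast
    ring
  simp only [smul_eq_mul]
  rw [h5]
  ring

lemma integrable_monomialGauss_mul (i j : ℕ) :
    Integrable fun ξ : ℝ × ℝ => monomialGauss i ξ.1 * monomialGauss j ξ.2 :=
  (integrable_monomialGauss i).mul_prod (integrable_monomialGauss j)

/-- The Hermite product polynomial `hermitePi i (x) * hermitePi j (y)`. -/
def hermiteProd (i j : ℕ) : MvPolynomial (Fin 2) ℝ :=
  Polynomial.aeval (MvPolynomial.X 0) (hermitePi i)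
    * Polynomial.aeval (MvPolynomial.X 1) (hermitePi j)

lemma totalDegree_aeval_X_le (a : Fin 2) (p : Polynomial ℝ) :
    (Polynomial.aeval (MvPolynomial.X a : MvPolynomial (Fin 2) ℝ) p).totalDegree
      ≤ p.natDegree := by
  rw [Polynomial.aeval_eq_sum_range]
  refine MvPolynomial.totalDegree_finsetSum_le fun i hi => ?_
  refine (MvPolynomial.totalDegree_smul_le _ _).trans ?_
  rw [MvPolynomial.totalDegree_X_pow]
  exact Nat.lt_succ_iff.1 (Finset.mem_range.1 hi)

lemma totalDegree_hermiteProd_le (i j : ℕ) : (hermiteProd i j).totalDegree ≤ i + j := by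
  refine (MvPolynomial.totalDegree_mul _ _).trans (add_le_add ?_ ?_)
  · exact (totalDegree_aeval_X_le 0 _).trans (natDegree_hermitePi_le i)
  · exact (totalDegree_aeval_X_le 1 _).trans (natDegree_hermitePi_le j)

lemma eval_aeval_X (x y : ℝ) (a : Fin 2) (p : Polynomial ℝ) :
    MvPolynomial.eval ![x, y] (Polynomial.aeval (MvPolynomial.X a : MvPolynomial (Fin 2) ℝ) p)
      = p.eval (![x, y] a) := by
  rw [Polynomial.aeval_eq_sum_range, Polynomial.eval_eq_sum_range, map_sum]
  refine Finset.sum_congr rfl fun i _ => ?_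
  rw [MvPolynomial.smul_eval, map_pow, MvPolynomial.eval_X]

lemma eval_hermiteProd (i j : ℕ) (x y : ℝ) :
    MvPolynomial.eval ![x, y] (hermiteProd i j) = (hermitePi i).eval x * (hermitePi j).eval y := by
  rw [hermiteProd, map_mul, eval_aeval_X, eval_aeval_X]
  rfl

/-- The polynomials of the asymptotic expansion. -/
def edgeworthPoly (k : ℕ) : MvPolynomial (Fin 2) ℝ :=
  if k = 0 then 1 else if k ∈ Finset.Icc 3 5 then
    ∑ m ∈ Finset.HasAntidiagonal.antidiagonal k,
      (totalCumulant m.1 m.2 (1 / 2) / √Real.pi ^ k) • hermiteProd m.1 m.2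
  else 0

lemma edgeworthPoly_zero : edgeworthPoly 0 = 1 := if_pos rfl

lemma totalDegree_edgeworthPoly_le (k : ℕ) : (edgeworthPoly k).totalDegree ≤ k := by
  unfold edgeworthPoly
  split_ifs with h1 h2
  · simp
  · refine MvPolynomial.totalDegree_finsetSum_le fun m hm => ?_
    rw [Finset.HasAntidiagonal.mem_antidiagonal] at hm
    rw [← hm]
    exact (MvPolynomial.totalDegree_smul_le _ _).trans (totalDegree_hermiteProd_le _ _)
  · simp

/-- The density `∑ ψ ^ (-k / 2) g_k(x, y) exp (-π (x² + y²))`. -/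
def edgeworthDensity (ψ : ℝ) (z : ℝ × ℝ) : ℝ :=
  ∑ k ∈ Finset.range 6, 1 / √ψ ^ k *
    (MvPolynomial.eval ![z.1, z.2] (edgeworthPoly k) * Real.exp (-Real.pi * (z.1 ^ 2 + z.2 ^ 2)))

lemma continuous_eval_edgeworthPoly (k : ℕ) :
    Continuous fun z : ℝ × ℝ => MvPolynomial.eval ![z.1, z.2] (edgeworthPoly k) := by
  have h1 : Continuous fun z : ℝ × ℝ => ![z.1, z.2] := by
    refine continuous_pi fun i => ?_
    fin_cases i
    · exact continuous_fst
    · exact continuous_snd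
  exact (MvPolynomial.continuous_eval (edgeworthPoly k)).comp h1

lemma continuous_edgeworthDensity (ψ : ℝ) : Continuous (edgeworthDensity ψ) := by
  refine continuous_finsetSum _ fun k _ => continuous_const.mul ?_
  exact (continuous_eval_edgeworthPoly k).mul (by fun_prop)

/-- The Fourier transform of `g_k(x, y) exp (-π (x² + y²))`. -/
def edgeworthTerm (k : ℕ) (ξ : ℝ × ℝ) : ℂ :=
  if k = 0 then monomialGauss 0 ξ.1 * monomialGauss 0 ξ.2 else if k ∈ Finset.Icc 3 5 then
    ∑ m ∈ Finset.HasAntidiagonal.antidiagonal k,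
      ((totalCumulant m.1 m.2 (1 / 2) / √Real.pi ^ k : ℝ) : ℂ)
        * (monomialGauss m.1 ξ.1 * monomialGauss m.2 ξ.2)
  else 0

lemma integrable_edgeworthTerm (k : ℕ) : Integrable (edgeworthTerm k) := by
  unfold edgeworthTerm
  split_ifs with h1 h2
  · exact integrable_monomialGauss_mul 0 0
  · exact integrable_finsetSum _ fun m _ => (integrable_monomialGauss_mul m.1 m.2).const_mul _
  · exact integrable_zero _ _ _

lemma integrable_planeChar_mul {F : ℝ × ℝ → ℂ} (hF : Integrable F) (z : ℝ × ℝ) :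
    Integrable fun ξ => planeChar (-ξ) z * F ξ := by
  have hc : Continuous fun ξ => planeChar (-ξ) z := by fun_prop
  exact hF.bdd_mul (c := 1) hc.aestronglyMeasurable
    (Eventually.of_forall fun ξ => (norm_planeChar _ z).le)

lemma integral_edgeworthTerm (k : ℕ) (z : ℝ × ℝ) :
    ∫ ξ, planeChar (-ξ) z * edgeworthTerm k ξ
      = ((MvPolynomial.eval ![z.1, z.2] (edgeworthPoly k)
        * Real.exp (-Real.pi * (z.1 ^ 2 + z.2 ^ 2)) : ℝ) : ℂ) := by
  unfold edgeworthTerm edgeworthPoly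
  split_ifs with h1 h2
  · rw [integral_planeChar_mul_monomialGauss]
    simp [hermitePi]
  · simp only [Finset.mul_sum]
    rw [integral_finsetSum]
    · rw [map_sum, Finset.sum_mul, Complex.ofReal_sum]
      refine Finset.sum_congr rfl fun m _ => ?_
      have hcomm : ∀ ξ : ℝ × ℝ, planeChar (-ξ) z
          * (((totalCumulant m.1 m.2 (1 / 2) / √Real.pi ^ k : ℝ) : ℂ)
            * (monomialGauss m.1 ξ.1 * monomialGauss m.2 ξ.2))
          = ((totalCumulant m.1 m.2 (1 / 2) / √Real.pi ^ k : ℝ) : ℂ)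
            * (planeChar (-ξ) z * (monomialGauss m.1 ξ.1 * monomialGauss m.2 ξ.2)) :=
        fun ξ => mul_left_comm _ _ _
      simp only [hcomm]
      rw [integral_const_mul, integral_planeChar_mul_monomialGauss, MvPolynomial.smul_eval,
        eval_hermiteProd]
      push_cast
      ring
    · intro m _
      exact integrable_planeChar_mul ((integrable_monomialGauss_mul m.1 m.2).const_mul _) z
  · simp

/-- The Fourier transform of `edgeworthDensity ψ`. -/
def edgeworthFourier (ψ : ℝ) (ξ : ℝ × ℝ) : ℂ :=
  ∑ k ∈ Finset.range 6, ((1 / √ψ ^ k : ℝ) : ℂ) * edgeworthTerm k ξ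

lemma integrable_edgeworthFourier (ψ : ℝ) : Integrable (edgeworthFourier ψ) :=
  integrable_finsetSum _ fun k _ => (integrable_edgeworthTerm k).const_mul _

lemma edgeworthDensity_eq_integral (ψ : ℝ) (z : ℝ × ℝ) :
    ((edgeworthDensity ψ z : ℝ) : ℂ) = ∫ ξ, planeChar (-ξ) z * edgeworthFourier ψ ξ := by
  simp only [edgeworthFourier, Finset.mul_sum]
  rw [integral_finsetSum _ fun k _ =>
    integrable_planeChar_mul ((integrable_edgeworthTerm k).const_mul _) z, edgeworthDensity,
    Complex.ofReal_sum]
  refine Finset.sum_congr rfl fun k _ => ?_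
  simp only [mul_left_comm (planeChar _ _)]
  rw [integral_const_mul, integral_edgeworthTerm, Complex.ofReal_mul]

/-- Each term is bounded by the L¹ norm of its Fourier transform. The lower bound 1/8 for ψ is the
one supplied by the prime 2 when σ ≤ 3/2. -/
lemma exists_edgeworthDensity_bound : ∃ M, 0 ≤ M ∧ ∀ ψ : ℝ, 1 / 8 ≤ ψ → ∀ z,
    |edgeworthDensity ψ z| ≤ M := by
  refine ⟨∑ k ∈ Finset.range 6, 8 ^ k * ∫ ξ, ‖edgeworthTerm k ξ‖,
    Finset.sum_nonneg fun k _ => mul_nonneg (by positivity) (integral_nonneg fun _ => norm_nonneg _),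
    fun ψ hψ z => ?_⟩
  refine (Finset.abs_sum_le_sum_abs _ _).trans (Finset.sum_le_sum fun k _ => ?_)
  rw [abs_mul]
  have h1 : |MvPolynomial.eval ![z.1, z.2] (edgeworthPoly k)
      * Real.exp (-Real.pi * (z.1 ^ 2 + z.2 ^ 2))| ≤ ∫ ξ, ‖edgeworthTerm k ξ‖ := by
    rw [← Real.norm_eq_abs, ← Complex.norm_real, ← integral_edgeworthTerm]
    refine norm_integral_le_of_norm_le (integrable_edgeworthTerm k).norm
      (Eventually.of_forall fun ξ => ?_)
    rw [norm_mul, norm_planeChar, one_mul]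
  have h2 : |1 / √ψ ^ k| ≤ 8 ^ k := by
    have h3 : 1 / 8 ≤ √ψ := Real.le_sqrt_of_sq_le (by norm_num; linarith)
    rw [abs_of_nonneg (by positivity), one_div, ← inv_pow]
    gcongr
    rw [inv_le_comm₀ (by linarith) (by norm_num)]
    linarith
  gcongr

/-- By homogeneity, the powers of √ψ and √π in the coefficients are absorbed by rescaling the
frequency to the variables of the characteristic function of `log ζ(σ, X)`. -/
lemma edgeworthFourier_eq {ψ : ℝ} (hψ : 0 < ψ) (ξ : ℝ × ℝ) :
    edgeworthFourier ψ ξ = (planeGauss 1 ξ : ℝ) * (1 + totalCumulantSum (1 / 2)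
      (2 * Real.pi * ξ.1 / √(Real.pi * ψ)) (2 * Real.pi * ξ.2 / √(Real.pi * ψ))) := by
  have hI : Finset.range 6 = insert 0 (insert 1 (insert 2 (Finset.Icc 3 5))) := by decide
  have hg : ∀ i j, monomialGauss i ξ.1 * monomialGauss j ξ.2
      = (planeGauss 1 ξ : ℝ) * (Complex.I ^ (i + j)
        * (((2 * Real.pi * ξ.1) ^ i * (2 * Real.pi * ξ.2) ^ j : ℝ) : ℂ)) := by
    intro i j
    have : planeGauss 1 ξ = Real.exp (-Real.pi * ξ.1 ^ 2) * Real.exp (-Real.pi * ξ.2 ^ 2) := by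
      rw [planeGauss_eq]
      ring_nf
    rw [this, monomialGauss, monomialGauss, pow_add]
    push_cast
    simp only [mul_pow]
    ring
  rw [edgeworthFourier, hI, Finset.sum_insert (by decide), Finset.sum_insert (by decide),
    Finset.sum_insert (by decide)]
  have h0 : edgeworthTerm 0 ξ = (planeGauss 1 ξ : ℝ) := by
    rw [edgeworthTerm, if_pos rfl, hg]
    simp
  have h1 : edgeworthTerm 1 ξ = 0 := by rw [edgeworthTerm, if_neg (by decide), if_neg (by decide)]
  have h2 : edgeworthTerm 2 ξ = 0 := by rw [edgeworthTerm, if_neg (by decide), if_neg (by decide)]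
  rw [h0, h1, h2, totalCumulantSum, mul_add, Finset.mul_sum]
  simp only [pow_zero, div_one, Complex.ofReal_one, one_mul, mul_zero, zero_add, mul_one]
  congr 1
  refine Finset.sum_congr rfl fun k hk => ?_
  have hk0 : k ≠ 0 := by
    rw [Finset.mem_Icc] at hk
    omega
  rw [edgeworthTerm, if_neg hk0, if_pos hk, totalCumulantForm, Complex.ofReal_sum, Finset.mul_sum,
    Finset.mul_sum, Finset.mul_sum]
  refine Finset.sum_congr rfl fun m hm => ?_
  rw [Finset.HasAntidiagonal.mem_antidiagonal] at hm
  have hsq : √(Real.pi * ψ) = √Real.pi * √ψ := Real.sqrt_mul Real.pi_pos.le _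
  have e : 1 / √ψ ^ k * (totalCumulant m.1 m.2 (1 / 2) / √Real.pi ^ k)
      * ((2 * Real.pi * ξ.1) ^ m.1 * (2 * Real.pi * ξ.2) ^ m.2)
      = totalCumulant m.1 m.2 (1 / 2) * ((2 * Real.pi * ξ.1 / √(Real.pi * ψ)) ^ m.1
        * (2 * Real.pi * ξ.2 / √(Real.pi * ψ)) ^ m.2) := by
    have h3 : 0 < √Real.pi := Real.sqrt_pos.2 Real.pi_pos
    have h4 : 0 < √ψ := Real.sqrt_pos.2 hψ
    rw [hsq, div_pow, div_pow, ← hm]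
    field_simp
    ring
  rw [← e, hg, hm]
  push_cast
  ring

/-! ### Estimates in the separate frequency ranges -/

lemma exists_one_add_pow_mul_exp_le (m : ℕ) {c : ℝ} (hc : 0 < c) :
    ∃ C, 0 ≤ C ∧ ∀ N : ℝ, 0 ≤ N → Real.exp (-(c * N)) * (1 + N) ^ m ≤ C := by
  refine ⟨m.factorial * Real.exp c / c ^ m, by positivity, fun N hN => ?_⟩
  have h := Real.pow_div_factorial_le_exp (c * (1 + N)) (by positivity) m
  rw [mul_pow, mul_add, mul_one, Real.exp_add, div_le_iff₀ (by positivity)] at h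
  rw [le_div_iff₀ (by positivity)]
  have h2 : Real.exp (-(c * N)) * Real.exp (c * N) = 1 := by
    rw [← Real.exp_add]
    simp
  calc Real.exp (-(c * N)) * (1 + N) ^ m * c ^ m
      = Real.exp (-(c * N)) * (c ^ m * (1 + N) ^ m) := by ring
    _ ≤ Real.exp (-(c * N)) * (Real.exp c * Real.exp (c * N) * m.factorial) := by gcongr
    _ = (Real.exp (-(c * N)) * Real.exp (c * N)) * (m.factorial * Real.exp c) := by ring
    _ = _ := by rw [h2, one_mul]

/-- Since ψ = -log(2σ - 1) + O(1), the distance to 1/2 is exponentially small in ψ; the 6 is 3!. -/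
lemma exists_sigma_sub_half_le : ∃ L, 0 ≤ L ∧ ∀ σ : ℝ, 1 / 2 < σ → σ ≤ 3 / 2 → 0 < psi σ →
    σ - 1 / 2 ≤ L / psi σ ^ 3 := by
  obtain ⟨C, hC⟩ := exists_psi_add_log_le
  refine ⟨6 * Real.exp C, by positivity, fun σ h1 h2 hψ => ?_⟩
  have h3 := (abs_le.1 (hC σ h1 h2)).2
  have h4 : 2 * σ - 1 ≤ Real.exp (C - psi σ) := by
    rw [← Real.log_le_iff_le_exp (by linarith)]
    linarith
  have h5 := Real.pow_div_factorial_le_exp (psi σ) hψ.le 3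
  have h6 : Real.exp (C - psi σ) ≤ 6 * Real.exp C / psi σ ^ 3 := by
    rw [Real.exp_sub, div_le_div_iff₀ (Real.exp_pos _) (by positivity)]
    rw [div_le_iff₀ (by positivity)] at h5
    norm_num [Nat.factorial] at h5
    nlinarith [Real.exp_pos C]
  linarith

/-- For ρ ≤ ψ⁶ the loss in the decay estimate is at most half of ψ: ρ² is at most ψ¹², and the 13th
term of the exponential series of ψ/2 beats it. -/
lemma exists_log_growth (D : ℝ) : ∃ ψ₁, 1 ≤ ψ₁ ∧ ∀ ψ ρ : ℝ, ψ₁ ≤ ψ → 0 ≤ ρ → ρ ≤ ψ ^ 6 →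
    D + Real.log (1 + (512 * ρ) ^ 2) ≤ ψ / 2 := by
  set A : ℝ := Real.exp D * (1 + 512 ^ 2) * (2 ^ 13 * (13 : ℕ).factorial) with hA
  refine ⟨max 1 A, le_max_left _ _, fun ψ ρ h hρ hρψ => ?_⟩
  have hψ1 : 1 ≤ ψ := (le_max_left _ _).trans h
  have hψA : A ≤ ψ := (le_max_right _ _).trans h
  have h1 := Real.pow_div_factorial_le_exp (ψ / 2) (by linarith) 13
  have h2 : 1 + (512 * ρ) ^ 2 ≤ (1 + 512 ^ 2) * ψ ^ 12 := by
    have h3 : (512 * ρ) ^ 2 ≤ (512 * ψ ^ 6) ^ 2 := by gcongr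
    have h4 : 1 ≤ ψ ^ 12 := one_le_pow₀ hψ1
    nlinarith
  have h3 : Real.exp D * (1 + (512 * ρ) ^ 2) ≤ Real.exp (ψ / 2) := by
    refine le_trans ?_ h1
    rw [le_div_iff₀ (by positivity), div_pow, le_div_iff₀ (by positivity)]
    calc Real.exp D * (1 + (512 * ρ) ^ 2) * (13 : ℕ).factorial * 2 ^ 13
        ≤ Real.exp D * ((1 + 512 ^ 2) * ψ ^ 12) * (13 : ℕ).factorial * 2 ^ 13 := by gcongr
      _ = A * ψ ^ 12 := by rw [hA]; ring
      _ ≤ ψ * ψ ^ 12 := by gcongr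
      _ = ψ ^ 13 := by ring
  have h5 := Real.log_le_log (by positivity) h3
  rwa [Real.log_mul (Real.exp_pos _).ne' (by positivity), Real.log_exp, Real.log_exp] at h5

/-- Here 4πN ≥ ψ¹³, so the exponent N/ψ¹⁰ of the smoothing factor already grows like ψ³. Of the N¹⁰
in e^{-t} ≤ 10!/t¹⁰, eight powers absorb ψ¹⁰³ and two supply the weight. -/
lemma exists_far_bound : ∃ C, 0 ≤ C ∧ ∀ ψ ρ N : ℝ, 1 ≤ ψ → ψ ^ 6 ≤ ρ →
    ρ ^ 2 * ψ = 4 * Real.pi * N →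
    Real.exp (-(Real.pi * N / ψ ^ 10)) ≤ C / ψ ^ 3 / (1 + N) ^ 2 := by
  have hπ := Real.pi_pos
  set B : ℝ := (1 + 4 * Real.pi) ^ 2 * (4 * Real.pi) ^ 8 / Real.pi ^ 10 with hB
  refine ⟨(10 : ℕ).factorial * B, by positivity, fun ψ ρ N hψ hρ h => ?_⟩
  have hN13 : ψ ^ 13 ≤ 4 * Real.pi * N := by
    rw [← h]
    calc ψ ^ 13 = (ψ ^ 6) ^ 2 * ψ := by ring
      _ ≤ ρ ^ 2 * ψ := by gcongr
  have hψ13 : 1 ≤ ψ ^ 13 := one_le_pow₀ hψ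
  have hN : 0 < N := by
    by_contra hN
    have : 4 * Real.pi * N ≤ 0 := mul_nonpos_of_nonneg_of_nonpos (by positivity) (not_lt.1 hN)
    linarith
  have hq : 1 + N ≤ (1 + 4 * Real.pi) * N := by linarith
  have h1 := Real.pow_div_factorial_le_exp (Real.pi * N / ψ ^ 10) (by positivity) 10
  have h2 : Real.exp (-(Real.pi * N / ψ ^ 10))
      ≤ (10 : ℕ).factorial * ψ ^ 100 / (Real.pi ^ 10 * N ^ 10) := by
    rw [Real.exp_neg, inv_le_comm₀ (Real.exp_pos _) (by positivity)]
    refine le_trans (le_of_eq ?_) h1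
    rw [inv_div]
    field_simp
  refine h2.trans ?_
  have h3 : ψ ^ 104 ≤ (4 * Real.pi) ^ 8 * N ^ 8 := by
    calc ψ ^ 104 = (ψ ^ 13) ^ 8 := by ring
      _ ≤ (4 * Real.pi * N) ^ 8 := by gcongr
      _ = _ := by ring
  have h4 : ψ ^ 103 ≤ (4 * Real.pi) ^ 8 * N ^ 8 :=
    (pow_le_pow_right₀ hψ (by norm_num)).trans h3
  rw [div_div, div_le_div_iff₀ (by positivity) (by positivity)]
  have h5 : (1 + N) ^ 2 ≤ (1 + 4 * Real.pi) ^ 2 * N ^ 2 := by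
    rw [← mul_pow]
    gcongr
  calc (10 : ℕ).factorial * ψ ^ 100 * (ψ ^ 3 * (1 + N) ^ 2)
      = (10 : ℕ).factorial * (ψ ^ 103 * (1 + N) ^ 2) := by ring
    _ ≤ (10 : ℕ).factorial * ((4 * Real.pi) ^ 8 * N ^ 8 * ((1 + 4 * Real.pi) ^ 2 * N ^ 2)) := by
        gcongr
    _ = (10 : ℕ).factorial * B * (Real.pi ^ 10 * N ^ 10) := by
        rw [hB]
        field_simp

/-- Comparison near the origin, after smoothing by a Gaussian of variance `O(ψ⁻³)`. -/
lemma small_frequency_bound {K₁ K₂ L C₅ ψ ρ N g s : ℝ} {Φ S : ℂ} (hK₁ : 0 ≤ K₁) (hK₂ : 0 ≤ K₂)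
    (hL : 0 ≤ L) (hψ : 1 ≤ ψ) (hρ : 0 ≤ ρ) (hρ1 : ρ ≤ 1) (hN : 0 ≤ N)
    (hρN : ρ ^ 2 * ψ = 4 * Real.pi * N) (hg0 : 0 ≤ g) (hg1 : g ≤ 1)
    (hg : 1 - g ≤ Real.pi * N / ψ ^ 3)
    (hΦ : ‖Φ - (Real.exp (-(Real.pi * N)) : ℝ) * (1 + S)‖
      ≤ K₁ * Real.exp (-(Real.pi * N)) * (ρ ^ 6 + s)) (hs : s ≤ L / ψ ^ 3)
    (hS : ‖S‖ ≤ K₂ * (1 + ρ) ^ 6)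
    (hC : Real.exp (-(Real.pi * N)) * (1 + N) ^ 5 ≤ C₅) :
    ‖Φ * (g : ℂ) - (Real.exp (-(Real.pi * N)) : ℝ) * (1 + S)‖
      ≤ (K₁ * (4 * Real.pi) ^ 3 + K₁ * L + Real.pi * (1 + 64 * K₂)) * C₅ / ψ ^ 3
        / (1 + N) ^ 2 := by
  have hπ := Real.pi_pos
  set e := Real.exp (-(Real.pi * N))
  have he : 0 < e := Real.exp_pos _
  have hψ3 : 0 < ψ ^ 3 := by positivity
  have hρ6 : ρ ^ 6 = (4 * Real.pi) ^ 3 * N ^ 3 / ψ ^ 3 := by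
    rw [eq_div_iff hψ3.ne']
    calc ρ ^ 6 * ψ ^ 3 = (ρ ^ 2 * ψ) ^ 3 := by ring
      _ = _ := by rw [hρN]; ring
  have hS1 : ‖1 + S‖ ≤ 1 + 64 * K₂ := by
    refine (norm_add_le _ _).trans ?_
    rw [norm_one]
    have : (1 + ρ) ^ 6 ≤ 2 ^ 6 := by gcongr; linarith
    nlinarith
  -- The error of the expansion, damped by g, plus the effect 1 - g of the smoothing on the main
  -- term.
  have hdec : Φ * (g : ℂ) - (e : ℂ) * (1 + S)
      = (Φ - (e : ℂ) * (1 + S)) * (g : ℂ) - ((1 - g : ℝ) : ℂ) * ((e : ℂ) * (1 + S)) := by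
    push_cast
    ring
  have hsum : ‖Φ * (g : ℂ) - (e : ℂ) * (1 + S)‖
      ≤ K₁ * e * (ρ ^ 6 + s) + (Real.pi * N / ψ ^ 3) * (e * (1 + 64 * K₂)) := by
    rw [hdec]
    refine (norm_sub_le _ _).trans (add_le_add ?_ ?_)
    · rw [norm_mul, Complex.norm_real, Real.norm_of_nonneg hg0]
      exact (mul_le_of_le_one_right (norm_nonneg _) hg1).trans hΦ
    · rw [norm_mul, norm_mul, Complex.norm_real, Complex.norm_real, Real.norm_of_nonneg he.le,
        Real.norm_of_nonneg (by linarith)]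
      gcongr
  have hN3 : N ^ 3 ≤ (1 + N) ^ 3 := by gcongr; linarith
  have hN1 : N ≤ (1 + N) ^ 3 := by nlinarith [sq_nonneg N, pow_nonneg hN 3]
  have h13 : 1 ≤ (1 + N) ^ 3 := one_le_pow₀ (by linarith)
  have hmid : K₁ * e * (ρ ^ 6 + s) + (Real.pi * N / ψ ^ 3) * (e * (1 + 64 * K₂))
      ≤ (K₁ * (4 * Real.pi) ^ 3 + K₁ * L + Real.pi * (1 + 64 * K₂)) / ψ ^ 3
        * (e * (1 + N) ^ 3) := by
    calc _ ≤ K₁ * e * ((4 * Real.pi) ^ 3 * N ^ 3 / ψ ^ 3 + L / ψ ^ 3)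
          + (Real.pi * N / ψ ^ 3) * (e * (1 + 64 * K₂)) := by rw [hρ6]; gcongr
      _ = e / ψ ^ 3 * (K₁ * ((4 * Real.pi) ^ 3 * N ^ 3) + K₁ * L * 1
          + Real.pi * N * (1 + 64 * K₂)) := by ring
      _ ≤ e / ψ ^ 3 * (K₁ * ((4 * Real.pi) ^ 3 * (1 + N) ^ 3) + K₁ * L * (1 + N) ^ 3
          + Real.pi * (1 + N) ^ 3 * (1 + 64 * K₂)) := by gcongr
      _ = _ := by ring
  refine hsum.trans (hmid.trans ?_)
  have hq : 0 < (1 + N) ^ 2 := by positivity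
  rw [le_div_iff₀ hq]
  calc _ = (K₁ * (4 * Real.pi) ^ 3 + K₁ * L + Real.pi * (1 + 64 * K₂)) / ψ ^ 3
        * (e * (1 + N) ^ 5) := by ring
    _ ≤ (K₁ * (4 * Real.pi) ^ 3 + K₁ * L + Real.pi * (1 + 64 * K₂)) / ψ ^ 3 * C₅ := by gcongr
    _ = _ := by ring

/-- Away from the origin N is at least a multiple of ψ, so the saving ψ⁻³ can be bought with three
powers of 1 + N, which the Gaussian decay pays for. -/
lemma one_le_of_frequency_gt {ψ ρ N : ℝ} (hψ : 1 ≤ ψ) (hρ : 1 / 12 ≤ ρ) (hN : 0 ≤ N)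
    (hρN : ρ ^ 2 * ψ = 4 * Real.pi * N) : 1 ≤ 12 ^ 6 * (4 * Real.pi) ^ 3 * (1 + N) ^ 3 / ψ ^ 3 := by
  have hπ := Real.pi_pos
  rw [le_div_iff₀ (by positivity), one_mul]
  have h1 : 1 ≤ 12 * ρ := by linarith
  calc ψ ^ 3 ≤ (12 * ρ) ^ 6 * ψ ^ 3 := le_mul_of_one_le_left (by positivity) (one_le_pow₀ h1)
    _ = 12 ^ 6 * (ρ ^ 2 * ψ) ^ 3 := by ring
    _ = 12 ^ 6 * (4 * Real.pi) ^ 3 * N ^ 3 := by rw [hρN]; ring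
    _ ≤ 12 ^ 6 * (4 * Real.pi) ^ 3 * (1 + N) ^ 3 := by gcongr; linarith

/-- The main term is negligible away from the origin. -/
lemma large_frequency_main_bound {K₂ C₈ ψ ρ N : ℝ} {S : ℂ} (hK₂ : 0 ≤ K₂) (hψ : 1 ≤ ψ)
    (hρ : 1 / 12 ≤ ρ) (hN : 0 ≤ N) (hρN : ρ ^ 2 * ψ = 4 * Real.pi * N)
    (hS : ‖S‖ ≤ K₂ * (1 + ρ) ^ 6)
    (hC : Real.exp (-(Real.pi * N)) * (1 + N) ^ 8 ≤ C₈) :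
    ‖((Real.exp (-(Real.pi * N)) : ℝ) : ℂ) * (1 + S)‖
      ≤ (12 ^ 6 * (4 * Real.pi) ^ 3) * (1 + K₂ * (8 * (4 * Real.pi) ^ 3)) * C₈ / ψ ^ 3
        / (1 + N) ^ 2 := by
  have hπ := Real.pi_pos
  have hπ3 := Real.pi_gt_three
  set e := Real.exp (-(Real.pi * N))
  have he : 0 < e := Real.exp_pos _
  have h1 := one_le_of_frequency_gt hψ hρ hN hρN
  have h13 : 1 ≤ (1 + N) ^ 3 := one_le_pow₀ (by linarith)
  have hρ2 : ρ ^ 2 ≤ 4 * Real.pi * N := by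
    rw [← hρN]
    exact le_mul_of_one_le_right (sq_nonneg ρ) hψ
  have h2 : (1 + ρ) ^ 6 ≤ 8 * (4 * Real.pi) ^ 3 * (1 + N) ^ 3 := by
    calc (1 + ρ) ^ 6 = ((1 + ρ) ^ 2) ^ 3 := by ring
      _ ≤ (2 * (4 * Real.pi * (1 + N))) ^ 3 := by
          gcongr
          nlinarith [sq_nonneg (1 - ρ)]
      _ = _ := by ring
  have hS1 : ‖1 + S‖ ≤ (1 + K₂ * (8 * (4 * Real.pi) ^ 3)) * (1 + N) ^ 3 := by
    refine (norm_add_le _ _).trans ?_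
    rw [norm_one]
    calc 1 + ‖S‖ ≤ (1 + N) ^ 3 + K₂ * (8 * (4 * Real.pi) ^ 3 * (1 + N) ^ 3) := by
          refine add_le_add h13 (hS.trans ?_)
          gcongr
      _ = _ := by ring
  rw [norm_mul, Complex.norm_real, Real.norm_of_nonneg he.le, le_div_iff₀ (by positivity)]
  -- The eight powers of 1 + N: three from S, two from the weight, three exchanged for ψ⁻³.
  calc e * ‖1 + S‖ * (1 + N) ^ 2
      ≤ e * ((1 + K₂ * (8 * (4 * Real.pi) ^ 3)) * (1 + N) ^ 3) * (1 + N) ^ 2 * 1 := by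
        rw [mul_one]
        gcongr
    _ ≤ e * ((1 + K₂ * (8 * (4 * Real.pi) ^ 3)) * (1 + N) ^ 3) * (1 + N) ^ 2
        * (12 ^ 6 * (4 * Real.pi) ^ 3 * (1 + N) ^ 3 / ψ ^ 3) := by gcongr
    _ = (12 ^ 6 * (4 * Real.pi) ^ 3) * (1 + K₂ * (8 * (4 * Real.pi) ^ 3)) / ψ ^ 3
        * (e * (1 + N) ^ 8) := by ring
    _ ≤ (12 ^ 6 * (4 * Real.pi) ^ 3) * (1 + K₂ * (8 * (4 * Real.pi) ^ 3)) / ψ ^ 3 * C₈ := by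
        gcongr
    _ = _ := by ring

lemma medium_frequency_bound {C₅ ψ ρ N x : ℝ} (hψ : 1 ≤ ψ) (hρ : 1 / 12 ≤ ρ) (hN : 0 ≤ N)
    (hρN : ρ ^ 2 * ψ = 4 * Real.pi * N) (hx : x ≤ Real.exp (-(Real.pi / 4 * N)))
    (hC : Real.exp (-(Real.pi / 4 * N)) * (1 + N) ^ 5 ≤ C₅) :
    x ≤ 12 ^ 6 * (4 * Real.pi) ^ 3 * C₅ / ψ ^ 3 / (1 + N) ^ 2 := by
  have hπ := Real.pi_pos
  have h1 := one_le_of_frequency_gt hψ hρ hN hρN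
  set e := Real.exp (-(Real.pi / 4 * N))
  have he : 0 < e := Real.exp_pos _
  rw [le_div_iff₀ (by positivity)]
  calc x * (1 + N) ^ 2 ≤ e * (1 + N) ^ 2 * 1 := by rw [mul_one]; gcongr
    _ ≤ e * (1 + N) ^ 2 * (12 ^ 6 * (4 * Real.pi) ^ 3 * (1 + N) ^ 3 / ψ ^ 3) := by gcongr
    _ = 12 ^ 6 * (4 * Real.pi) ^ 3 / ψ ^ 3 * (e * (1 + N) ^ 5) := by ring
    _ ≤ 12 ^ 6 * (4 * Real.pi) ^ 3 / ψ ^ 3 * C₅ := by gcongr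
    _ = _ := by ring

/-- The smoothed characteristic function is close to the Fourier transform of the expansion. -/
lemma exists_fourier_approximation : ∃ C ψ₀, 0 ≤ C ∧ 1 ≤ ψ₀ ∧ ∀ σ : ℝ, 1 / 2 < σ → σ ≤ 3 / 2 →
    ψ₀ ≤ psi σ → ∀ (ξ : ℝ × ℝ) (Φ : ℂ),
    Tendsto (fun N => ∏ p ∈ primesLT N, eulerCharFun (primeWeight σ p)
      (2 * Real.pi * ξ.1 / √(Real.pi * psi σ)) (2 * Real.pi * ξ.2 / √(Real.pi * psi σ)))
      atTop (𝓝 Φ) →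
    ‖Φ * planeGauss (psi σ ^ 5)⁻¹ ξ - edgeworthFourier (psi σ) ξ‖
      ≤ C / psi σ ^ 3 * ((1 + ξ.1 ^ 2)⁻¹ * (1 + ξ.2 ^ 2)⁻¹) := by
  have hπ := Real.pi_pos
  obtain ⟨K₁, hK₁, hexp⟩ := exists_charFun_expansion
  obtain ⟨D, hdecay⟩ := exists_charFun_decay
  obtain ⟨K₂, hK₂, hgrow⟩ := exists_totalCumulantSum_growth
  obtain ⟨L, hL, hσL⟩ := exists_sigma_sub_half_le
  obtain ⟨ψ₁, hψ₁, hlog⟩ := exists_log_growth D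
  obtain ⟨F, hF, hfar⟩ := exists_far_bound
  obtain ⟨C₅, hC₅0, hC₅⟩ := exists_one_add_pow_mul_exp_le 5 hπ
  obtain ⟨C₈, hC₈0, hC₈⟩ := exists_one_add_pow_mul_exp_le 8 hπ
  obtain ⟨E₅, hE₅0, hE₅⟩ := exists_one_add_pow_mul_exp_le 5 (c := Real.pi / 4) (by positivity)
  set B₁ := (K₁ * (4 * Real.pi) ^ 3 + K₁ * L + Real.pi * (1 + 64 * K₂)) * C₅
  set B₂ := (12 ^ 6 * (4 * Real.pi) ^ 3) * (1 + K₂ * (8 * (4 * Real.pi) ^ 3)) * C₈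
  set B₃ := 12 ^ 6 * (4 * Real.pi) ^ 3 * E₅
  have hB₁ : 0 ≤ B₁ := by positivity
  have hB₂ : 0 ≤ B₂ := by positivity
  have hB₃ : 0 ≤ B₃ := by positivity
  refine ⟨B₁ + B₂ + B₃ + F, ψ₁, by positivity, hψ₁, fun σ hσ hσ2 hψ ξ Φ hΦ => ?_⟩
  set ψ := psi σ with hψdef
  have hψ1 : 1 ≤ ψ := hψ₁.trans hψ
  set u := 2 * Real.pi * ξ.1 / √(Real.pi * ψ) with hu
  set v := 2 * Real.pi * ξ.2 / √(Real.pi * ψ) with hv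
  set N := ξ.1 ^ 2 + ξ.2 ^ 2 with hNdef
  have hN : 0 ≤ N := by positivity
  set ρ := √(u ^ 2 + v ^ 2) with hρdef
  have hρ : 0 ≤ ρ := Real.sqrt_nonneg _
  have hρ2 : u ^ 2 + v ^ 2 = ρ ^ 2 := (Real.sq_sqrt (by positivity)).symm
  have hρN : ρ ^ 2 * ψ = 4 * Real.pi * N := by
    rw [← hρ2, hu, hv, div_pow, div_pow, Real.sq_sqrt (by positivity), hNdef]
    field_simp
    ring
  -- The estimates in each range are radial; this converts them to the product weight.
  have hweight : ((1 + N) ^ 2)⁻¹ ≤ (1 + ξ.1 ^ 2)⁻¹ * (1 + ξ.2 ^ 2)⁻¹ := by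
    rw [← mul_inv]
    gcongr
    nlinarith [sq_nonneg ξ.1, sq_nonneg ξ.2]
  suffices h : ‖Φ * planeGauss (ψ ^ 5)⁻¹ ξ - edgeworthFourier ψ ξ‖
      ≤ (B₁ + B₂ + B₃ + F) / ψ ^ 3 / (1 + N) ^ 2 by
    rw [div_eq_mul_inv _ ((1 + N) ^ 2)] at h
    exact h.trans (by gcongr)
  have hmono : ∀ b : ℝ, b ≤ B₁ + B₂ + B₃ + F →
      b / ψ ^ 3 / (1 + N) ^ 2 ≤ (B₁ + B₂ + B₃ + F) / ψ ^ 3 / (1 + N) ^ 2 := by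
    intro b hb
    gcongr
  have hg1 : planeGauss 1 ξ = Real.exp (-(Real.pi * N)) := by
    rw [planeGauss, one_pow, mul_one]
  have hgδ : planeGauss (ψ ^ 5)⁻¹ ξ = Real.exp (-(Real.pi * N / ψ ^ 10)) := by
    rw [planeGauss, hNdef]
    congr 2
    field_simp
  rw [edgeworthFourier_eq (by linarith), hg1, hgδ]
  have hSgrow := hgrow u v ρ hρ hρ2
  have hg01 : Real.exp (-(Real.pi * N / ψ ^ 10)) ≤ 1 := by
    rw [Real.exp_le_one_iff, neg_nonpos]
    positivity
  rcases le_or_gt ρ (1 / 12) with hsm | hlg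
  · have h1 := hexp σ u v ρ Φ hσ hσ2 hρ hsm hρ2 hΦ
    have h2 : ρ ^ 2 * psi σ / 4 = Real.pi * N := by
      rw [← hψdef, hρN]
      ring
    rw [h2] at h1
    refine (small_frequency_bound hK₁ hK₂ hL hψ1 hρ (by linarith) hN hρN (Real.exp_pos _).le hg01 ?_
      h1 (hσL σ hσ hσ2 (by linarith)) hSgrow (hC₅ N hN)).trans (hmono B₁ (by linarith))
    have h3 := Real.add_one_le_exp (-(Real.pi * N / ψ ^ 10))
    have h4 : Real.pi * N / ψ ^ 10 ≤ Real.pi * N / ψ ^ 3 := by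
      have : ψ ^ 3 ≤ ψ ^ 10 := pow_le_pow_right₀ hψ1 (by norm_num)
      gcongr
    linarith
  · have hmain := large_frequency_main_bound hK₂ hψ1 hlg.le hN hρN hSgrow (hC₈ N hN)
    have hΦg : ‖Φ * ((Real.exp (-(Real.pi * N / ψ ^ 10)) : ℝ) : ℂ)‖
        ≤ (B₃ + F) / ψ ^ 3 / (1 + N) ^ 2 := by
      rw [norm_mul, Complex.norm_real, Real.norm_of_nonneg (Real.exp_pos _).le]
      have hΦ1 : ‖Φ‖ ≤ 1 := by
        refine le_of_tendsto hΦ.norm (Eventually.of_forall fun n => ?_)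
        rw [norm_prod]
        exact Finset.prod_le_one (fun p _ => norm_nonneg _) fun p _ =>
          norm_eulerCharFun_le_one _ _ _
      -- Up to ψ⁶ the decay of Φ suffices and the smoothing factor is dropped; beyond, Φ is bounded
      -- by 1 and the smoothing factor does the work.
      rcases le_or_gt ρ (ψ ^ 6) with hmed | hfr
      · have h1 := hdecay σ u v ρ Φ hσ hρ hρ2 hΦ
        have h2 := hlog ψ ρ hψ hρ hmed
        have h3 : ‖Φ‖ ≤ Real.exp (-(Real.pi / 4 * N)) := by
          refine h1.trans (Real.exp_le_exp.2 (neg_le_neg ?_))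
          calc Real.pi / 4 * N = ρ ^ 2 / 8 * (ψ / 2) := by linear_combination -hρN / 16
            _ ≤ ρ ^ 2 / 8 * (ψ - D - Real.log (1 + (512 * ρ) ^ 2)) := by
                gcongr
                linarith
        refine (medium_frequency_bound hψ1 hlg.le hN hρN
          ((mul_le_of_le_one_right (norm_nonneg _) hg01).trans h3) (hE₅ N hN)).trans ?_
        gcongr
        exact le_add_of_nonneg_right hF
      · refine (mul_le_of_le_one_left (Real.exp_pos _).le hΦ1).trans
          ((hfar ψ ρ N hψ1 hfr.le hρN).trans ?_)
        gcongr
        exact le_add_of_nonneg_left hB₃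
    refine (norm_sub_le _ _).trans ((add_le_add hΦg hmain).trans ?_)
    rw [← add_div, ← add_div]
    refine hmono _ ?_
    linarith

/-! ### The law of κ and the final estimate -/

lemma sum_intervalIntegral_eq_setIntegral_edgeworthDensity {a b c d : ℝ} (hab : a ≤ b)
    (hcd : c ≤ d) (ψ : ℝ) :
    ∑ k ∈ Finset.range 6, 1 / √ψ ^ k * ∫ y in c..d, ∫ x in a..b,
        MvPolynomial.eval ![x, y] (edgeworthPoly k) * Real.exp (-Real.pi * (x ^ 2 + y ^ 2))
      = ∫ z in Set.Ioc a b ×ˢ Set.Ioc c d, edgeworthDensity ψ z := by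
  have hint : ∀ k, IntegrableOn (fun z : ℝ × ℝ => MvPolynomial.eval ![z.1, z.2] (edgeworthPoly k)
      * Real.exp (-Real.pi * (z.1 ^ 2 + z.2 ^ 2))) (Set.Ioc a b ×ˢ Set.Ioc c d) := fun k => by
    have hc : Continuous fun z : ℝ × ℝ => MvPolynomial.eval ![z.1, z.2] (edgeworthPoly k)
        * Real.exp (-Real.pi * (z.1 ^ 2 + z.2 ^ 2)) :=
      (continuous_eval_edgeworthPoly k).mul (by fun_prop)
    exact (hc.continuousOn.integrableOn_compact (isCompact_Icc.prod isCompact_Icc)).mono_set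
      (Set.prod_mono Set.Ioc_subset_Icc_self Set.Ioc_subset_Icc_self)
  unfold edgeworthDensity
  rw [integral_finsetSum _ fun k _ => (hint k).const_mul _]
  refine Finset.sum_congr rfl fun k _ => ?_
  rw [integral_const_mul, intervalIntegral.integral_of_le hcd]
  simp_rw [intervalIntegral.integral_of_le hab]
  have h := hint k
  rw [IntegrableOn, Measure.volume_eq_prod, ← Measure.prod_restrict] at h
  rw [Measure.volume_eq_prod, ← Measure.prod_restrict, integral_prod_symm _ h]

lemma one_eighth_le_psi {σ : ℝ} (hσ : 1 / 2 < σ) (hσ' : σ ≤ 3 / 2) : 1 / 8 ≤ psi σ := by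
  let two : Nat.Primes := ⟨2, Nat.prime_two⟩
  have hx : primeWeight σ two ^ 2 = (2 : ℝ) ^ (-(2 * σ)) := by
    rw [primeWeight, ← Real.rpow_natCast, ← Real.rpow_mul (by positivity)]
    congr 1
    push_cast
    ring
  have h1 : primeWeight σ two ^ 2 ≤ 1 / 2 := by
    rw [hx]
    calc (2 : ℝ) ^ (-(2 * σ)) ≤ 2 ^ (-1 : ℝ) :=
          Real.rpow_le_rpow_of_exponent_le (by norm_num) (by linarith)
      _ = 1 / 2 := by rw [Real.rpow_neg_one]; norm_num
  have h2 : 1 / 8 ≤ primeWeight σ two ^ 2 := by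
    rw [hx]
    calc (1 / 8 : ℝ) = 2 ^ (-3 : ℝ) := by
          rw [Real.rpow_neg (by norm_num), show (3 : ℝ) = ((3 : ℕ) : ℝ) by norm_num,
            Real.rpow_natCast]
          norm_num
      _ ≤ (2 : ℝ) ^ (-(2 * σ)) :=
          Real.rpow_le_rpow_of_exponent_le (by norm_num) (by linarith)
  have h0 : ∀ p, 0 ≤ eulerVar (primeWeight σ p) := fun p => eulerVar_nonneg _
  have hx0 : 0 ≤ primeWeight σ two := by unfold primeWeight; positivity
  exact h2.trans ((sq_le_eulerVar hx0 h1).trans (le_hasSum (hasSum_psi hσ) two fun p _ => h0 p))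

section law

variable {Ω : Type*} [MeasurableSpace Ω] {P : Measure Ω} {X : Nat.Primes → Ω → ℂ}

/-- The law of `κ(σ, X)` as a measure on the plane. -/
def kappaLaw (P : Measure Ω) (σ : ℝ) (X : Nat.Primes → Ω → ℂ) : Measure (ℝ × ℝ) :=
  P.map fun ω => ((kappa σ X ω).re, (kappa σ X ω).im)

variable [IsProbabilityMeasure P]

lemma aemeasurable_kappa_re_im (hX : IsUniformOnCircleFamily P X) {σ : ℝ} (hσ : 1 / 2 < σ) :
    AEMeasurable (fun ω => ((kappa σ X ω).re, (kappa σ X ω).im)) P := by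
  have h : AEMeasurable (kappa σ X) P := (aemeasurable_logRandomZeta hX hσ).div_const _
  exact (Complex.measurable_re.comp_aemeasurable h).prodMk
    (Complex.measurable_im.comp_aemeasurable h)

lemma isProbabilityMeasure_kappaLaw (hX : IsUniformOnCircleFamily P X) {σ : ℝ}
    (hσ : 1 / 2 < σ) : IsProbabilityMeasure (kappaLaw P σ X) :=
  Measure.isProbabilityMeasure_map (aemeasurable_kappa_re_im hX hσ)

lemma kappaLaw_real_rectangle (hX : IsUniformOnCircleFamily P X) {σ : ℝ} (hσ : 1 / 2 < σ)
    (a b c d : ℝ) :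
    (kappaLaw P σ X).real (Set.Icc a b ×ˢ Set.Icc c d)
      = P.real {ω | kappa σ X ω ∈ Set.Icc a b ×ℂ Set.Icc c d} := by
  rw [kappaLaw, measureReal_def, Measure.map_apply_of_aemeasurable
    (aemeasurable_kappa_re_im hX hσ) (measurableSet_Icc.prod measurableSet_Icc)]
  rfl

lemma tendsto_planeCharFun_kappaLaw (hX : IsUniformOnCircleFamily P X) {σ : ℝ}
    (hσ : 1 / 2 < σ) (ξ : ℝ × ℝ) :
    Tendsto (fun N => ∏ p ∈ primesLT N, eulerCharFun (primeWeight σ p)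
      (2 * Real.pi * ξ.1 / √(Real.pi * psi σ)) (2 * Real.pi * ξ.2 / √(Real.pi * psi σ)))
      atTop (𝓝 (planeCharFun (kappaLaw P σ X) ξ)) := by
  convert tendsto_prod_eulerCharFun hX hσ _ _ using 2
  rw [planeCharFun, kappaLaw, integral_map (aemeasurable_kappa_re_im hX hσ)
    ((continuous_const (y := ξ)).planeChar continuous_id').aestronglyMeasurable]
  refine integral_congr_ae (Eventually.of_forall fun ω => ?_)
  simp only [planeChar, kappa, Complex.div_ofReal_re, Complex.div_ofReal_im]
  congr 1
  push_cast
  ring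

end law

lemma exists_rectangle_expansion {a b c d : ℝ} (hab : a < b) (hcd : c < d) :
    ∃ C ψ₀ : ℝ, 0 ≤ C ∧ ∀ (Ω : Type*) [MeasurableSpace Ω] (P : Measure Ω)
      [IsProbabilityMeasure P] (X : Nat.Primes → Ω → ℂ), IsUniformOnCircleFamily P X →
      ∀ σ : ℝ, 1 / 2 < σ → σ ≤ 3 / 2 → ψ₀ ≤ psi σ →
        |P.real {ω | kappa σ X ω ∈ Set.Icc a b ×ℂ Set.Icc c d}
          - ∫ z in Set.Ioc a b ×ˢ Set.Ioc c d, edgeworthDensity (psi σ) z| ≤ C / psi σ ^ 3 := by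
  obtain ⟨C, ψ₁, hC, hψ₁, hfourier⟩ := exists_fourier_approximation
  obtain ⟨M, hM, hbound⟩ := exists_edgeworthDensity_bound
  have hab' := sub_pos.2 hab
  have hcd' := sub_pos.2 hcd
  -- The terms 2/(b - a) and 2/(d - c) in the threshold guarantee that the rectangle can be shrunk
  -- by ψ⁻³ on each side.
  refine ⟨C * Real.pi ^ 2 * ((b - a + 2) * (d - c + 2)) + 2 + M * (2 * (b - a + (d - c)) + 4),
    ψ₁ + 2 / (b - a) + 2 / (d - c), by positivity, fun Ω _ P _ X hX σ hσ hσ' hψ => ?_⟩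
  have := isProbabilityMeasure_kappaLaw hX hσ
  set ψ := psi σ with hψdef
  have hpos₁ : 0 < 2 / (b - a) := by positivity
  have hpos₂ : 0 < 2 / (d - c) := by positivity
  have hψ1 : 1 ≤ ψ := by linarith
  have hψ3 : ψ ≤ ψ ^ 3 := le_self_pow₀ hψ1 (by norm_num)
  have hη : ∀ {t : ℝ}, 0 < t → 2 / t ≤ ψ → 2 * (ψ ^ 3)⁻¹ ≤ t := fun {t} ht h => by
    rw [← div_eq_mul_inv, div_le_iff₀ (by positivity)]
    rw [div_le_iff₀ ht] at h
    nlinarith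
  -- With δ = ψ⁻⁵ and η = ψ⁻³ the tail δ²/η² is ψ⁻⁴ and the boundary strip costs O(ψ⁻³).
  have key := abs_measureReal_rectangle_sub_le (kappaLaw P σ X) (δ := (ψ ^ 5)⁻¹)
    (η := (ψ ^ 3)⁻¹) (ε := C / ψ ^ 3) (by positivity) (by positivity)
    (inv_le_one_of_one_le₀ (one_le_pow₀ hψ1)) hM (hη hab' (by linarith)) (hη hcd' (by linarith))
    (continuous_edgeworthDensity ψ) (hbound ψ (by linarith)) (integrable_edgeworthFourier ψ)
    (edgeworthDensity_eq_integral ψ)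
    (fun ξ => hfourier σ hσ hσ' (by linarith) ξ _ (tendsto_planeCharFun_kappaLaw hX hσ ξ))
  rw [kappaLaw_real_rectangle hX hσ] at key
  refine key.trans ?_
  have h4 : ((ψ ^ 5)⁻¹) ^ 2 / ((ψ ^ 3)⁻¹) ^ 2 ≤ 1 / ψ ^ 3 := by
    have : ((ψ ^ 5)⁻¹) ^ 2 / ((ψ ^ 3)⁻¹) ^ 2 = 1 / ψ ^ 4 := by field_simp
    rw [this]
    exact one_div_le_one_div_of_le (by positivity) (pow_le_pow_right₀ hψ1 (by norm_num))
  have : (C * Real.pi ^ 2 * ((b - a + 2) * (d - c + 2)) + 2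
      + M * (2 * (b - a + (d - c)) + 4)) / ψ ^ 3
      = C / ψ ^ 3 * Real.pi ^ 2 * ((b - a + 2) * (d - c + 2)) + 2 * (1 / ψ ^ 3)
        + M * (ψ ^ 3)⁻¹ * (2 * (b - a + (d - c)) + 4) := by field_simp
  rw [this]
  gcongr

/-- For large ψ_T, log log T is at most a constant times ψ_T, so ψ_T⁻³ is of the required order.
Otherwise log log T is itself bounded, and the trivial bound for both quantities suffices after
enlarging the constant. -/
lemma exists_rectangle_expansion_sigmaT {θ : ℝ} (hθ : 0 < θ) {a b c d : ℝ} (hab : a < b)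
    (hcd : c < d) :
    ∃ C : ℝ, ∀ (Ω : Type*) [MeasurableSpace Ω] (P : Measure Ω)
      [IsProbabilityMeasure P] (X : Nat.Primes → Ω → ℂ), IsUniformOnCircleFamily P X →
      ∀ T : ℝ, 10 ≤ T →
        |P.real {ω | kappa (sigmaT θ T) X ω ∈ Set.Icc a b ×ℂ Set.Icc c d}
          - ∫ z in Set.Ioc a b ×ˢ Set.Ioc c d, edgeworthDensity (psi (sigmaT θ T)) z|
        ≤ C / Real.log (Real.log T) ^ 3 := by
  obtain ⟨C, ψ₀, hC, hexp⟩ := exists_rectangle_expansion hab hcd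
  obtain ⟨K, hK⟩ := exists_psi_sigmaT_sub_le hθ
  obtain ⟨M, hM, hbound⟩ := exists_edgeworthDensity_bound
  have hK0 : 0 ≤ K := (abs_nonneg _).trans (hK 10 le_rfl)
  have hvol : 0 ≤ (b - a) * (d - c) := mul_nonneg (by linarith) (by linarith)
  refine ⟨max (C * ((1 + K) / θ) ^ 3)
    ((1 + M * ((b - a) * (d - c))) * ((max 1 ψ₀ + K) / θ) ^ 3), fun Ω _ P _ X hX T hT => ?_⟩
  obtain ⟨hσ, hσ'⟩ := sigmaT_mem hθ hT
  have hψ8 := one_eighth_le_psi hσ hσ'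
  have hKT := abs_le.1 (hK T hT)
  have hL : 0 < Real.log (Real.log T) :=
    Real.log_pos (by linarith [two_le_log_of_ten_le hT])
  set ψ := psi (sigmaT θ T) with hψdef
  set L := Real.log (Real.log T) with hLdef
  rcases le_or_gt (max 1 ψ₀) ψ with hψ | hψ
  · have hψ1 : 1 ≤ ψ := (le_max_left _ _).trans hψ
    have hLψ : L ≤ (1 + K) / θ * ψ := by
      rw [div_mul_eq_mul_div, le_div_iff₀ hθ]
      nlinarith
    calc _ ≤ C / ψ ^ 3 := hexp Ω P X hX _ hσ hσ' ((le_max_right _ _).trans hψ)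
      _ ≤ C * ((1 + K) / θ) ^ 3 / L ^ 3 := by
          rw [div_le_div_iff₀ (by positivity) (by positivity), mul_assoc, ← mul_pow]
          gcongr
      _ ≤ _ := by gcongr; exact le_max_left _ _
  · have hLb : L ≤ (max 1 ψ₀ + K) / θ := by
      rw [le_div_iff₀ hθ]
      nlinarith
    have hG : ‖∫ z in Set.Ioc a b ×ˢ Set.Ioc c d, edgeworthDensity ψ z‖
        ≤ M * ((b - a) * (d - c)) := by
      rw [← measureReal_rectangle hab.le hcd.le]
      exact norm_setIntegral_le_of_norm_le_const (measure_rectangle_lt_top a b c d)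
        fun z _ => hbound ψ hψ8 z
    have hP := abs_le.1 (abs_of_nonneg (measureReal_nonneg (μ := P)
      (s := {ω | kappa (sigmaT θ T) X ω ∈ Set.Icc a b ×ℂ Set.Icc c d}))).le
    have hP1 := measureReal_le_one (μ := P)
      (s := {ω | kappa (sigmaT θ T) X ω ∈ Set.Icc a b ×ℂ Set.Icc c d})
    calc _ ≤ 1 + M * ((b - a) * (d - c)) := by
          refine (abs_sub _ _).trans (add_le_add ?_ hG)
          rwa [abs_of_nonneg measureReal_nonneg]
      _ ≤ (1 + M * ((b - a) * (d - c))) * ((max 1 ψ₀ + K) / θ) ^ 3 / L ^ 3 := by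
          rw [le_div_iff₀ (by positivity)]
          gcongr
      _ ≤ _ := by gcongr; exact le_max_right _ _

end

theorem mainTheorem5 :
    -- the objects are well defined, and `ψ_T = θ log log T + O(1)`
    (∀ σ : ℝ, 1 / 2 < σ → Summable (psiTerm σ)) ∧
    (∀ (Ω : Type*) [MeasurableSpace Ω] (P : Measure Ω) [IsProbabilityMeasure P]
      (X : Nat.Primes → Ω → ℂ), IsUniformOnCircleFamily P X → ∀ σ : ℝ, 1 / 2 < σ →
        ∀ᵐ ω ∂P,
          Tendsto (fun N => partialLogRandomZeta σ X N ω) atTop (𝓝 (logRandomZeta σ X ω)) ∧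
          Tendsto (fun N => partialRandomZeta σ X N ω) atTop (𝓝 (randomZeta σ X ω)) ∧
          Complex.exp (logRandomZeta σ X ω) = randomZeta σ X ω) ∧
    (∀ θ : ℝ, 0 < θ → ∃ C : ℝ, ∀ T : ℝ, 10 ≤ T →
      |psi (sigmaT θ T) - θ * Real.log (Real.log T)| ≤ C) ∧
    -- the asymptotic expansion
    ∃ g : ℕ → MvPolynomial (Fin 2) ℝ,
      g 0 = 1 ∧ (∀ k ≤ 5, (g k).totalDegree ≤ k) ∧
      ∀ θ : ℝ, 0 < θ → ∀ a b c d : ℝ, a < b → c < d → ∃ C : ℝ,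
        ∀ (Ω : Type*) [MeasurableSpace Ω] (P : Measure Ω) [IsProbabilityMeasure P]
          (X : Nat.Primes → Ω → ℂ), IsUniformOnCircleFamily P X →
          ∀ T : ℝ, 10 ≤ T →
            |P.real {ω | kappa (sigmaT θ T) X ω ∈ Set.Icc a b ×ℂ Set.Icc c d} -
              ∑ k ∈ Finset.range 6, 1 / Real.sqrt (psi (sigmaT θ T)) ^ k *
                ∫ y in c..d, ∫ x in a..b,
                  MvPolynomial.eval ![x, y] (g k) * Real.exp (-Real.pi * (x ^ 2 + y ^ 2))|
            ≤ C / (Real.log (Real.log T)) ^ 3 := by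
  refine ⟨fun σ hσ => summable_psiTerm hσ, fun Ω _ P _ X hX σ hσ => randomZeta_wellDefined hX hσ,
    fun θ hθ => exists_psi_sigmaT_sub_le hθ, edgeworthPoly, edgeworthPoly_zero,
    fun k _ => totalDegree_edgeworthPoly_le k, fun θ hθ a b c d hab hcd => ?_⟩
  obtain ⟨C, hC⟩ := exists_rectangle_expansion_sigmaT hθ hab hcd
  refine ⟨C, fun Ω _ P _ X hX T hT => ?_⟩
  rw [sum_intervalIntegral_eq_setIntegral_edgeworthDensity hab.le hcd.le]
  exact hC Ω P X hX T hT
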